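/- Let $0<\mu<1$ and consider the Euler problem of two fixed centers $$H(q,p)=\tfrac12|p|^2-\frac{1-\mu}{|q-E|}-\frac{\mu}{|q-M|},\qquad E=(-\tfrac12,0),\ M=(\tfrac12,0),$$ at negative energies $H=c<0$. In the double covered elliptic coordinates $q=(\tfrac12\cosh\lambda\cos\nu,\tfrac12\sinh\lambda\sin\nu)$, $\lambda\in\mathbb R$, $\nu\in\mathbb R/2\pi\mathbb Z$, with conjugate momenta $p_\lambda,p_\nu$, the regularized orbits of energy $c$ are the solutions on $\{K=0\}$ of Hamilton's equations of $K=K_\lambda+K_\nu$, where $$K_\lambda=2p_\lambda^2-2\cosh\lambda-c\cosh^2\lambda,\qquad K_\nu=2p_\nu^2+2(1-2\mu)\cos\nu+c\cos^2\nu ;$$ points of the double cover that are exchanged by $(\lambda,\nu,p_\lambda,p_\nu)\mapsto(-\lambda,-\nu,-p_\lambda,-p_\nu)$ are identified, and periods and coverings of orbits are understood in this quotient and in the time of $K$. The first integral $G$ equals $K_\lambda$ on $\{K=0\}$. Fix one of the two primaries ($E$ at $\lambda=0,\nu=-\pi$, or $M$ at $\lambda=0,\nu=0$). Consider the regular tori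 $\{K_\lambda=g,\ K_\nu=-g\}$, $c<0$, on which $\lambda$ oscillates about $0$ and $\nu$ oscillates about its value at the primary (satellite motions), and let $T_\lambda,T_\nu$ be the least periods of the $\lambda$- and the $\nu$-motion. For relatively prime positive integers $k>l$, such a torus is a $T_{k,l}$-torus if $T_\nu/T_\lambda=k/l$; all orbits on it are periodic. The interior collision orbit of energy $c$ moves on the segment between the primary and the other one; the exterior collision orbit moves on the $q_1$-axis on the opposite side of the primary. Let $c_1=-1-2\sqrt{\mu(1-\mu)}$. Then for all relatively prime $k>l\ge1$ the $T_{k,l}$-torus family of the chosen primary is a curve $\{(g(c),c): c\in(c_b,c_d)\}$ with $g$ continuous, $c_b<c_1$ and $c_b<c_d\le0$, that is, the torus with values $(g,c)$ is a $T_{k,l}$-torus if and only if $c_b<c<c_d$ and $g=g(c)$. Moreover: 1. The family bifurcates, at energy $c_b$, from the $l$-fold covered interior collision orbit if $k+l$ is even, and from the $2l$-fold covered interior collision orbit if $k+l$ is odd. 2. If $c_d<0$, then the family dies, at energy $c_d$, at the $k$-fold covered exterior collision orbit if $k+l$ is even, and at the $2k$-fold covered exterior collision orbit if $k+l$ is odd.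 3. If the chosen primary has mass at most $\tfrac12$, then $c_d<0$. Here the family bifurcates from (dies at) the $m$-fold cover of a periodic orbit $\zeta$ of least period $\tau$ if, as $c\downarrow c_b$ (as $c\uparrow c_d$), the orbits $\gamma$ on the torus of energy $c$, with least period $T$ and up to a time shift, satisfy $T\to m\tau$ and $\sup_{0\le\theta\le1}|\gamma(T\theta)-\zeta(m\tau\theta)|\to0$, uniformly over all orbits on the torus. -/

import Mathlib

open Set Filter Topology

namespace EulerProblem

/-- The two fixed centers: the Earth at `(-1/2, 0)` with mass `1 - μ`, and the Moon at `(1/2, 0)`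
with mass `μ`. -/
inductive Primary where
  | earth
  | moon

/-- The mass of a primary. -/
noncomputable def Primary.mass (μ : ℝ) : Primary → ℝ
  | .earth => 1 - μ
  | .moon => μ

/-- The value of the angular elliptic coordinate `ν` at a primary (where also `lam = 0`); the Earth
is represented by `ν = -π`. -/
noncomputable def Primary.center : Primary → ℝ
  | .earth => -Real.pi
  | .moon => 0

/-- The critical energy of the Euler problem. -/
noncomputable def critEnergy (μ : ℝ) : ℝ := -1 - 2 * Real.sqrt (μ * (1 - μ))

/-- Phase points `((lam, p_lam), (ν, p_ν))` in double covered elliptic coordinates; `ν` is an angle,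
here lifted to `ℝ`. -/
abbrev Phase := (ℝ × ℝ) × (ℝ × ℝ)

/-- Position in the plane: `q = (cosh lam cos ν / 2, sinh lam sin ν / 2)`. -/
noncomputable def position (z : Phase) : ℝ × ℝ :=
  (Real.cosh z.1.1 * Real.cos z.2.1 / 2, Real.sinh z.1.1 * Real.sin z.2.1 / 2)

/-- The `lam`-part of the regularized Hamiltonian
`K = (H - c) (cosh² lam - cos² ν) = K_lam + K_ν`, as a function of `(lam, p_lam)`. -/
noncomputable def KLam (c : ℝ) (x : ℝ × ℝ) : ℝ :=
  2 * x.2 ^ 2 - 2 * Real.cosh x.1 - c * Real.cosh x.1 ^ 2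

/-- The `ν`-part of the regularized Hamiltonian, as a function of `(ν, p_ν)`. -/
noncomputable def KNu (μ c : ℝ) (x : ℝ × ℝ) : ℝ :=
  2 * x.2 ^ 2 + 2 * (1 - 2 * μ) * Real.cos x.1 + c * Real.cos x.1 ^ 2

/-- `x = (q, p)` solves Hamilton's equations `q' = ∂h/∂p`, `p' = -∂h/∂q`, for all times. -/
def IsHamiltonianMotion (h : ℝ × ℝ → ℝ) (x : ℝ → ℝ × ℝ) : Prop :=
  ∀ t : ℝ, HasDerivAt x
    (deriv (fun p => h ((x t).1, p)) (x t).2, -deriv (fun q => h (q, (x t).2)) (x t).1) t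

/-- Regularized orbits of energy `c` around the primary `e`: solutions of Hamilton's equations of
`K = K_lam + K_ν` on `K = 0`, in regularized time, that stay in the component of `e`. The lift of
the angle `ν` is the one near the center `e`; the orbit never meets the part of the `q₁`-axis
beyond the other primary. -/
structure IsOrbit (μ c : ℝ) (e : Primary) (γ : ℝ → Phase) : Prop where
  motion_lam : IsHamiltonianMotion (KLam c) (fun t => (γ t).1)
  motion_nu : IsHamiltonianMotion (KNu μ c) (fun t => (γ t).2)
  energy : ∀ t, KLam c (γ t).1 + KNu μ c (γ t).2 = 0
  component : ∀ t, |(γ t).2.1 - e.center| < Real.pi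

/-- Orbits on the level `(G, H) = (g, c)` around `e`; the first integral `G` equals `K_lam` on
`K = 0`. -/
def IsOrbitOnLevel (μ : ℝ) (e : Primary) (g c : ℝ) (γ : ℝ → Phase) : Prop :=
  IsOrbit μ c e γ ∧ ∀ t, KLam c (γ t).1 = g

/-- The interior collision orbit of `e`: it moves on the segment between the two primaries. -/
def IsInteriorCollisionOrbit (μ : ℝ) (e : Primary) (c : ℝ) (ζ : ℝ → Phase) : Prop :=
  IsOrbit μ c e ζ ∧ ∀ t, (position (ζ t)).2 = 0 ∧ |(position (ζ t)).1| ≤ 1 / 2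

/-- The exterior collision orbit of `e`: it moves on the `q₁`-axis, on the side of `e` that is
opposite to the other primary. -/
def IsExteriorCollisionOrbit (μ : ℝ) (e : Primary) (c : ℝ) (ζ : ℝ → Phase) : Prop :=
  IsOrbit μ c e ζ ∧ ∀ t, (position (ζ t)).2 = 0 ∧ 1 / 2 ≤ |(position (ζ t)).1|

/-- The value of `p_lam²` prescribed by `(G, H) = (g, c)`. -/
noncomputable def momentumLamSq (g c lam : ℝ) : ℝ :=
  (c * Real.cosh lam ^ 2 + 2 * Real.cosh lam + g) / 2

/-- The value of `p_ν²` prescribed by `(G, H) = (g, c)`. -/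
noncomputable def momentumNuSq (μ g c ν : ℝ) : ℝ :=
  (-c * Real.cos ν ^ 2 - 2 * (1 - 2 * μ) * Real.cos ν - g) / 2

/-- `(g, c)` carries a regular (Liouville) torus of satellite motions around `e`, at negative
energy: `lam` oscillates through `0`, and `ν` oscillates through the center without rotating, since
some values of `ν` are forbidden. (For `e = earth` and `μ < 1/2` these are the regions `S`, `S'` and
the curve between them, along which only the Moon component is singular; for `e = moon` it is
the region `S`.) -/
def IsSatelliteLevel (μ : ℝ) (e : Primary) (g c : ℝ) : Prop :=
  c < 0 ∧ 0 < momentumLamSq g c 0 ∧ 0 < momentumNuSq μ g c e.center ∧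
    ∃ ν, momentumNuSq μ g c ν < 0

/-- `T` is the least positive period of `f`. -/
def IsLeastPeriod {X : Type*} (f : ℝ → X) (T : ℝ) : Prop :=
  0 < T ∧ Function.Periodic f T ∧ ∀ S, 0 < S → Function.Periodic f S → T ≤ S

/-- The torus of `e` over `(g, c)` is a `T_{k,l}`-torus: it is regular and its rotation number
`T_ν / T_lam` equals `k / l`, where `T_lam` and `T_ν` are the common least periods of the `lam`- and
`ν`-motions of the orbits on it. -/
def IsTklTorus (μ : ℝ) (e : Primary) (k l : ℕ) (g c : ℝ) : Prop :=
  IsSatelliteLevel μ e g c ∧ (∃ γ, IsOrbitOnLevel μ e g c γ) ∧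
    ∃ Tlam Tnu : ℝ, Tnu / Tlam = (k : ℝ) / (l : ℝ) ∧
      ∀ γ, IsOrbitOnLevel μ e g c γ →
        IsLeastPeriod (fun t => (γ t).1) Tlam ∧ IsLeastPeriod (fun t => (γ t).2) Tnu

/-- Two points of the double cover represent the same point of the regularized phase space: they
agree, or differ by the involution `(lam, ν, p_lam, p_ν) ↦ (-lam, -ν, -p_lam, -p_ν)`, where `ν` is
taken modulo `2π`. -/
def SamePoint (z w : Phase) : Prop :=
  ∃ n : ℤ, w = z + ((0, 0), (2 * Real.pi * n, 0)) ∨ w = -z + ((0, 0), (2 * Real.pi * n, 0))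

/-- `T` is the least positive period of `γ` in the regularized phase space, the quotient of the
double cover by the involution. -/
def IsOrbitPeriod (γ : ℝ → Phase) (T : ℝ) : Prop :=
  0 < T ∧ (∀ t, SamePoint (γ (t + T)) (γ t)) ∧
    ∀ S, 0 < S → (∀ t, SamePoint (γ (t + S)) (γ t)) → T ≤ S

/-- For the family of tori over `(g c, c)`, as the energy `c` varies along the filter `F`: all orbits
on the torus converge, uniformly over the torus and as simply covered closed orbits with their
periods, to the `m`-fold cover of the periodic orbit `ζ`. -/
def ConvergesToCover (μ : ℝ) (e : Primary) (g : ℝ → ℝ) (F : Filter ℝ) (m : ℕ) (ζ : ℝ → Phase) :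
    Prop :=
  ∃ τ, IsOrbitPeriod ζ τ ∧
    ∀ ε > 0, ∀ᶠ c in F, ∀ γ, IsOrbitOnLevel μ e (g c) c γ →
      ∃ T s : ℝ, IsOrbitPeriod γ T ∧ |T - m * τ| < ε ∧
        ∀ θ ∈ Icc (0 : ℝ) 1, dist (γ (s + T * θ)) (ζ (m * τ * θ)) < ε

end EulerProblem

/-! Put h = -c and let a be the mass of e minus the other mass. In the coordinates x = tanh(λ/2) and
x = tan((ν - center)/2) both motions satisfy x'² = 2(A - 2Bx² + Cx⁴) with the same B = g + h.
Setting x = κ sin θ gives θ'² = 2(X cos²θ + Y sin²θ) with X = B + D, Y = 2D, D = 2√(gh + s), where s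
= 1 for λ and s = a² for ν. So both half periods are values of one complete elliptic integral,
`halfPeriod`. Angles stay regular at turning points and at κ = 0, the case of the collision orbits.

The heart is `ratio_lt_ratio`: at fixed energy T_ν/T_λ decreases strictly in g. The substitution t =
√Y tan θ turns the half period into an integral of 1/√((t² + X)(t² + Y)), and `halfPeriod_mul_lt`
compares products of two such integrals pointwise after symmetrisation. It needs only that D is
smaller for ν than for λ and that it grows faster in g there, by concavity of the square root.

At energy -h the satellite levels end above at the exterior collision line g = h + 2a. They end
below at the interior line g = h - 2 if h > 1 + √(1 - a²) = -c₁, and otherwise at a separatrix of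
the ν-motion, where the ratio is infinite (`exists_ratio_gt`). On both collision lines the ratio is
explicit in the monotone function `scaledHalf` and decreases in h, so k/l has one threshold on each:
the interior one is -c_b, the exterior one is -c_d if it lies at negative energy. Between them the
intermediate value theorem and monotonicity give exactly one g; outside them monotonicity excludes
all tori (`exists_energy_interval`). The same monotonicity makes g(c) continuous up to the
thresholds.

Multiplicities are a parity count. A half period reverses the sign of its own factor, while the
involution reverses both. Hence a period is n half periods of λ and m of ν with n ≡ m mod 2 and n :
m = k : l, minimally (k, l) or (2k, 2l). On a collision orbit only one factor moves, and its half
period already closes the orbit. -/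

namespace EulerProblem

/-! ### The half period as a complete elliptic integral -/

/-- The squared angular speed of an oscillation with parameters `X`, `Y`. -/
noncomputable def angForm (X Y θ : ℝ) : ℝ := 2 * (X * Real.cos θ ^ 2 + Y * Real.sin θ ^ 2)

lemma angForm_pos {X Y : ℝ} (hX : 0 < X) (hY : 0 < Y) (θ : ℝ) : 0 < angForm X Y θ := by
  have h1 : 2 * min X Y ≤ angForm X Y θ := by
    have h2 := mul_le_mul_of_nonneg_right (min_le_left X Y) (sq_nonneg (Real.cos θ))
    have h3 := mul_le_mul_of_nonneg_right (min_le_right X Y) (sq_nonneg (Real.sin θ))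
    have h4 : min X Y * Real.cos θ ^ 2 + min X Y * Real.sin θ ^ 2 = min X Y := by
      rw [← mul_add, Real.cos_sq_add_sin_sq, mul_one]
    unfold angForm
    linarith
  have := lt_min hX hY
  linarith

lemma continuous_angForm : Continuous fun p : (ℝ × ℝ) × ℝ => angForm p.1.1 p.1.2 p.2 := by
  unfold angForm; fun_prop

lemma angForm_add_pi (X Y θ : ℝ) : angForm X Y (θ + Real.pi) = angForm X Y θ := by
  simp [angForm, Real.cos_add_pi, Real.sin_add_pi]

lemma continuous_inv_sqrt_angForm {X Y : ℝ} (hX : 0 < X) (hY : 0 < Y) :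
    Continuous fun θ => 1 / √(angForm X Y θ) := by
  refine continuous_const.div ?_ fun θ => (Real.sqrt_pos.2 (angForm_pos hX hY θ)).ne'
  have : Continuous fun θ : ℝ => angForm X Y θ := by unfold angForm; fun_prop
  exact this.sqrt

/-- The time an oscillation with parameters `X`, `Y` needs to move from angle `0` to `θ`. -/
noncomputable def angTime (X Y θ : ℝ) : ℝ := ∫ t in (0 : ℝ)..θ, 1 / √(angForm X Y t)

/-- Half of the period of an oscillation with parameters `X`, `Y`. -/
noncomputable def halfPeriod (X Y : ℝ) : ℝ := angTime X Y Real.pi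

lemma hasDerivAt_angTime {X Y : ℝ} (hX : 0 < X) (hY : 0 < Y) (θ : ℝ) :
    HasDerivAt (angTime X Y) (1 / √(angForm X Y θ)) θ :=
  (continuous_inv_sqrt_angForm hX hY).integral_hasStrictDerivAt 0 θ |>.hasDerivAt

lemma angTime_zero (X Y : ℝ) : angTime X Y 0 = 0 := by simp [angTime]

lemma strictMono_angTime {X Y : ℝ} (hX : 0 < X) (hY : 0 < Y) : StrictMono (angTime X Y) := by
  refine strictMono_of_deriv_pos fun θ => ?_
  rw [(hasDerivAt_angTime hX hY θ).deriv]
  exact div_pos one_pos (Real.sqrt_pos.2 (angForm_pos hX hY θ))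

lemma halfPeriod_pos {X Y : ℝ} (hX : 0 < X) (hY : 0 < Y) : 0 < halfPeriod X Y := by
  rw [← angTime_zero X Y]
  exact strictMono_angTime hX hY Real.pi_pos

lemma angTime_add_pi {X Y : ℝ} (hX : 0 < X) (hY : 0 < Y) (θ : ℝ) :
    angTime X Y (θ + Real.pi) = angTime X Y θ + halfPeriod X Y := by
  have hper : Function.Periodic (fun t => 1 / √(angForm X Y t)) Real.pi := fun t => by
    simp only [angForm_add_pi]
  have hint : ∀ a b, IntervalIntegrable (fun t => 1 / √(angForm X Y t)) MeasureTheory.volume a b :=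
    fun a b => (continuous_inv_sqrt_angForm hX hY).intervalIntegrable a b
  have h := hper.intervalIntegral_add_eq θ 0
  rw [zero_add] at h
  unfold halfPeriod angTime
  rw [← h, intervalIntegral.integral_add_adjacent_intervals (hint _ _) (hint _ _)]

/-- Pairs of positive parameters. -/
abbrev PosPair := {q : ℝ × ℝ // 0 < q.1 ∧ 0 < q.2}

/-- Over the subtype `PosPair` the integrand is continuous everywhere, so the theorem on parametric
integrals with a variable endpoint applies. -/
lemma continuousOn_angTime :
    ContinuousOn (fun p : (ℝ × ℝ) × ℝ => angTime p.1.1 p.1.2 p.2)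
      {p | 0 < p.1.1 ∧ 0 < p.1.2} := by
  have hf : Continuous (Function.uncurry fun (q : PosPair × ℝ) (t : ℝ) =>
      1 / √(angForm q.1.1.1 q.1.1.2 t)) := by
    refine continuous_const.div ?_ fun z =>
      (Real.sqrt_pos.2 (angForm_pos (X := z.1.1.1.1) (Y := z.1.1.1.2) z.1.1.2.1 z.1.1.2.2 z.2)).ne'
    exact (continuous_angForm.comp (f := fun z : (PosPair × ℝ) × ℝ => (z.1.1.1, z.2))
      (by fun_prop)).sqrt
  have h := intervalIntegral.continuous_parametric_intervalIntegral_of_continuous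
    (μ := MeasureTheory.volume) (a₀ := 0) hf (s := fun q : PosPair × ℝ => q.2) continuous_snd
  rw [continuousOn_iff_continuous_domRestrict]
  have hg : Continuous fun p : {p : (ℝ × ℝ) × ℝ | 0 < p.1.1 ∧ 0 < p.1.2} =>
      ((⟨p.1.1, p.2⟩, p.1.2) : PosPair × ℝ) := by
    fun_prop
  exact h.comp hg

lemma continuousOn_halfPeriod :
    ContinuousOn (fun p : ℝ × ℝ => halfPeriod p.1 p.2) {p | 0 < p.1 ∧ 0 < p.2} :=
  continuousOn_angTime.comp (f := fun p : ℝ × ℝ => (p, Real.pi)) (by fun_prop) fun _ hp => hp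

/-- A shift of the angle by π/2 exchanges sine and cosine, and the integrand has period π. -/
lemma halfPeriod_comm (X Y : ℝ) : halfPeriod X Y = halfPeriod Y X := by
  have hper : Function.Periodic (fun t => 1 / √(angForm X Y t)) Real.pi := fun t => by
    simp only [angForm_add_pi]
  have h := hper.intervalIntegral_add_eq 0 (Real.pi / 2)
  unfold halfPeriod angTime
  rw [zero_add] at h
  rw [h, show Real.pi / 2 + Real.pi = Real.pi + Real.pi / 2 by ring]
  have h2 := intervalIntegral.integral_comp_add_right (fun t => 1 / √(angForm X Y t))
    (a := 0) (b := Real.pi) (Real.pi / 2)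
  rw [zero_add] at h2
  rw [← h2]
  refine intervalIntegral.integral_congr fun t _ => ?_
  simp only [angForm, Real.cos_add_pi_div_two, Real.sin_add_pi_div_two, neg_sq]
  rw [add_comm]

/-- This homogeneity makes the common scale g + h cancel from the period ratio. -/
lemma halfPeriod_mul {r : ℝ} (hr : 0 < r) (X Y : ℝ) :
    halfPeriod (r * X) (r * Y) = halfPeriod X Y / √r := by
  unfold halfPeriod angTime
  rw [← intervalIntegral.integral_div]
  refine intervalIntegral.integral_congr fun t _ => ?_
  have : angForm (r * X) (r * Y) t = r * angForm X Y t := by unfold angForm; ring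
  simp only [this, Real.sqrt_mul hr.le]
  rw [div_div, mul_comm (√r)]

lemma halfPeriod_lt {X Y X' Y' : ℝ} (hX : 0 < X) (hY : 0 < Y) (hXX : X < X') (hYY : Y < Y') :
    halfPeriod X' Y' < halfPeriod X Y := by
  have hX' := hX.trans hXX
  have hY' := hY.trans hYY
  have key : ∀ t, 1 / √(angForm X' Y' t) < 1 / √(angForm X Y t) := fun t => by
    refine one_div_lt_one_div_of_lt (Real.sqrt_pos.2 (angForm_pos hX hY t)) ?_
    refine Real.sqrt_lt_sqrt (angForm_pos hX hY t).le ?_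
    have := angForm_pos (sub_pos.2 hXX) (sub_pos.2 hYY) t
    unfold angForm at *
    linarith
  exact intervalIntegral.integral_lt_integral_of_continuousOn_of_le_of_exists_lt Real.pi_pos
    (continuous_inv_sqrt_angForm hX' hY').continuousOn
    (continuous_inv_sqrt_angForm hX hY).continuousOn (fun t _ => (key t).le)
    ⟨0, ⟨le_rfl, Real.pi_pos.le⟩, key 0⟩

lemma halfPeriod_le {X Y m : ℝ} (hm : 0 < m) (hX : m ≤ X) (hY : m ≤ Y) :
    halfPeriod X Y ≤ Real.pi / √(2 * m) := by
  have hX' := hm.trans_le hX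
  have hY' := hm.trans_le hY
  have key : ∀ t, 1 / √(angForm X Y t) ≤ 1 / √(2 * m) := fun t => by
    refine one_div_le_one_div_of_le (Real.sqrt_pos.2 (by linarith)) ?_
    refine Real.sqrt_le_sqrt ?_
    have h4 := Real.sin_sq_add_cos_sq t
    unfold angForm
    nlinarith [mul_le_mul_of_nonneg_right hX (sq_nonneg (Real.cos t)),
      mul_le_mul_of_nonneg_right hY (sq_nonneg (Real.sin t))]
  have := intervalIntegral.integral_mono_on Real.pi_pos.le
    ((continuous_inv_sqrt_angForm hX' hY').intervalIntegrable 0 Real.pi)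
    ((continuous_const (y := 1 / √(2 * m))).intervalIntegrable (μ := MeasureTheory.volume)
      0 Real.pi) (fun t _ => key t)
  rw [intervalIntegral.integral_const] at this
  unfold halfPeriod angTime
  refine this.trans (le_of_eq ?_)
  simp
  rw [div_eq_mul_inv]
  simp

/-- For θ between √X and 1 the squared speed is at most 2(1 + M)θ², so the integrand dominates a
multiple of 1/θ. This is the logarithmic divergence at a separatrix. -/
lemma le_halfPeriod_of_lt_one {X Y M : ℝ} (hX : 0 < X) (hX1 : X < 1) (hY : 0 < Y) (hYM : Y ≤ M) :
    -Real.log X / (2 * √(2 * (1 + M))) ≤ halfPeriod X Y := by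
  have hs : 0 < √X := Real.sqrt_pos.2 hX
  have hs1 : √X < 1 := by rw [Real.sqrt_lt' one_pos]; simpa using hX1
  have hpi : (1 : ℝ) ≤ Real.pi := by linarith [Real.pi_gt_three]
  have hint : ∀ a b, IntervalIntegrable (fun t => 1 / √(angForm X Y t)) MeasureTheory.volume a b :=
    fun a b => (continuous_inv_sqrt_angForm hX hY).intervalIntegrable a b
  have h1 : ∫ t in √X..1, 1 / √(angForm X Y t) ≤ halfPeriod X Y := by
    refine intervalIntegral.integral_mono_interval hs.le hs1.le hpi ?_ (hint _ _)
    exact Eventually.of_forall fun t => by simp only [Pi.zero_apply]; positivity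
  refine le_trans ?_ h1
  have hM : 0 < 1 + M := by linarith
  have h2 : ∫ t in √X..1, t⁻¹ * (1 / √(2 * (1 + M))) =
      -Real.log X / (2 * √(2 * (1 + M))) := by
    rw [intervalIntegral.integral_mul_const, integral_inv_of_pos hs one_pos, one_div (√X),
      Real.log_inv, Real.log_sqrt hX.le]
    field_simp
  rw [← h2]
  refine intervalIntegral.integral_mono_on hs1.le ?_ (hint _ _) ?_
  · refine ContinuousOn.intervalIntegrable ?_
    rw [uIcc_of_le hs1.le]
    exact (continuousOn_inv₀.mono fun t ht => (hs.trans_le ht.1).ne').mul continuousOn_const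
  · intro t ht
    have ht0 : 0 < t := hs.trans_le ht.1
    have hXt : X ≤ t ^ 2 := by
      have := mul_self_le_mul_self hs.le ht.1
      rw [Real.mul_self_sqrt hX.le] at this
      nlinarith
    rw [show t⁻¹ * (1 / √(2 * (1 + M))) = 1 / (t * √(2 * (1 + M))) by field_simp]
    refine one_div_le_one_div_of_le (Real.sqrt_pos.2 (angForm_pos hX hY t)) ?_
    refine Real.sqrt_le_iff.2 ⟨by positivity, ?_⟩
    rw [mul_pow, Real.sq_sqrt (by positivity)]
    have h5 : Real.sin t ^ 2 ≤ t ^ 2 := by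
      have h6 := Real.sin_le ht0.le
      have h7 : 0 ≤ Real.sin t := Real.sin_nonneg_of_nonneg_of_le_pi ht0.le (ht.2.trans hpi)
      nlinarith
    have h8 := Real.cos_sq_le_one t
    unfold angForm
    have h9 : X * Real.cos t ^ 2 ≤ t ^ 2 := by nlinarith [sq_nonneg (Real.cos t)]
    have h10 : Y * Real.sin t ^ 2 ≤ M * t ^ 2 := by nlinarith [sq_nonneg (Real.sin t)]
    nlinarith

/-- The half period blows up when `X` tends to zero and `Y` stays bounded. -/
lemma tendsto_halfPeriod_atTop {ι : Type*} {F : Filter ι} {X Y : ι → ℝ} {M : ℝ}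
    (hX : Tendsto X F (𝓝 0)) (hX0 : ∀ᶠ i in F, 0 < X i) (hY0 : ∀ᶠ i in F, 0 < Y i)
    (hYM : ∀ᶠ i in F, Y i ≤ M) : Tendsto (fun i => halfPeriod (X i) (Y i)) F atTop := by
  rcases F.eq_or_neBot with rfl | hF
  · simp
  have hM : 0 < M := by
    obtain ⟨i, h1, h2⟩ := (hY0.and hYM).exists
    linarith
  have h1 : Tendsto (fun i => -Real.log (X i) / (2 * √(2 * (1 + M)))) F atTop := by
    refine Tendsto.atTop_div_const (by positivity) ?_
    refine tendsto_neg_atBot_atTop.comp ?_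
    refine Real.tendsto_log_nhdsGT_zero.comp ?_
    exact tendsto_nhdsWithin_iff.2 ⟨hX, hX0⟩
  refine tendsto_atTop_mono' F ?_ h1
  filter_upwards [hX0, hY0, hYM, hX.eventually_lt_const one_pos] with i a b c d
  exact le_halfPeriod_of_lt_one a d b c

/-! ### Integrals over the line and strict log-supermodularity -/

open MeasureTheory in
lemma integrable_inv_sqrt_quartic {X Y : ℝ} (hX : 0 < X) (hY : 0 < Y) :
    Integrable fun t : ℝ => 1 / √((t ^ 2 + X) * (t ^ 2 + Y)) := by
  obtain ⟨m, hm, hmX, hmY, hm1⟩ : ∃ m, 0 < m ∧ m ≤ X ∧ m ≤ Y ∧ m ≤ 1 :=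
    ⟨min (min X Y) 1, by positivity, (min_le_left _ _).trans (min_le_left _ _),
      (min_le_left _ _).trans (min_le_right _ _), min_le_right _ _⟩
  refine (integrable_inv_one_add_sq.const_mul (1 / m)).mono' ?_ (Eventually.of_forall fun t => ?_)
  · refine (Continuous.div continuous_const (by fun_prop) fun t => ?_).aestronglyMeasurable
    exact (Real.sqrt_pos.2 (by positivity)).ne'
  · rw [Real.norm_of_nonneg (by positivity), ← one_div, one_div_mul_one_div]
    refine one_div_le_one_div_of_le (by positivity) (Real.le_sqrt_of_sq_le ?_)
    have h1 : m * (1 + t ^ 2) ≤ t ^ 2 + X := by nlinarith [sq_nonneg t]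
    have h2 : m * (1 + t ^ 2) ≤ t ^ 2 + Y := by nlinarith [sq_nonneg t]
    rw [pow_two (m * _)]
    exact mul_le_mul h1 h2 (by positivity) (by positivity)

-- The substitution t = √Y tan θ, made as an arctangent substitution followed by a scaling. The new
-- integrand is monotone in X and Y through two separate factors, which allows pointwise comparison.
open MeasureTheory in
lemma halfPeriod_eq_integral {X Y : ℝ} (hX : 0 < X) (hY : 0 < Y) :
    halfPeriod X Y = (1 / √2) * ∫ t : ℝ, 1 / √((t ^ 2 + X) * (t ^ 2 + Y)) := by
  have hper : Function.Periodic (fun t => 1 / √(angForm X Y t)) Real.pi := fun t => by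
    simp only [angForm_add_pi]
  have h := hper.intervalIntegral_add_eq 0 (-(Real.pi / 2))
  rw [zero_add, show -(Real.pi / 2) + Real.pi = Real.pi / 2 by ring] at h
  unfold halfPeriod angTime
  rw [h, intervalIntegral.integral_of_le (by linarith [Real.pi_pos]), integral_Ioc_eq_integral_Ioo,
    ← Real.range_arctan, ← image_univ,
    integral_image_eq_integral_abs_deriv_smul MeasurableSet.univ
      (fun x _ => (Real.hasDerivAt_arctan' x).hasDerivWithinAt)
      Real.arctan_injective.injOn, setIntegral_univ]
  have hY' : 0 < √Y := Real.sqrt_pos.2 hY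
  have h2 := Measure.integral_comp_mul_left
    (fun t : ℝ => 1 / √((t ^ 2 + X) * (t ^ 2 + Y))) (√Y)
  rw [abs_of_pos (inv_pos.2 hY'), smul_eq_mul, inv_mul_eq_div, eq_div_iff hY'.ne'] at h2
  rw [← h2, ← integral_mul_const, ← integral_const_mul]
  refine integral_congr_ae (Eventually.of_forall fun t => ?_)
  have ht : 0 < 1 + t ^ 2 := by positivity
  simp only [smul_eq_mul, abs_of_pos (inv_pos.2 ht), angForm, Real.sin_sq, Real.cos_sq_arctan,
    mul_pow, Real.sq_sqrt hY.le]
  have e1 : 2 * (X * (1 / (1 + t ^ 2)) + Y * (1 - 1 / (1 + t ^ 2))) =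
      2 * (Y * t ^ 2 + X) / (1 + t ^ 2) := by field_simp; ring
  have e2 : (Y * t ^ 2 + X) * (Y * t ^ 2 + Y) = Y * ((Y * t ^ 2 + X) * (1 + t ^ 2)) := by ring
  have hP : 0 < Y * t ^ 2 + X := by positivity
  rw [e1, e2, Real.sqrt_div (by positivity), Real.sqrt_mul (by positivity : (0:ℝ) ≤ 2),
    Real.sqrt_mul hY.le, Real.sqrt_mul hP.le]
  have h3 : 0 < √(1 + t ^ 2) := Real.sqrt_pos.2 ht
  have h4 : 0 < √(Y * t ^ 2 + X) := Real.sqrt_pos.2 hP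
  have h5 := Real.sq_sqrt ht.le
  field_simp
  rw [h5]

open MeasureTheory in
/-- A four functions inequality for integrals. -/
lemma integral_mul_integral_lt {f₁ f₂ f₃ f₄ : ℝ → ℝ} (h₁ : Integrable f₁) (h₂ : Integrable f₂)
    (h₃ : Integrable f₃) (h₄ : Integrable f₄)
    (h : ∀ x y, f₁ x * f₂ y + f₁ y * f₂ x < f₃ x * f₄ y + f₃ y * f₄ x) :
    (∫ x, f₁ x) * ∫ x, f₂ x < (∫ x, f₃ x) * ∫ x, f₄ x := by
  have a₁ := h₁.mul_prod h₂
  have a₂ := h₂.mul_prod h₁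
  have a₃ := h₃.mul_prod h₄
  have a₄ := h₄.mul_prod h₃
  -- Twice the difference of the two products as one double integral; each product enters in both
  -- orders of the variables, so the symmetrised pointwise inequality suffices.
  have key : 0 < ∫ z : ℝ × ℝ, (f₃ z.1 * f₄ z.2 + f₄ z.1 * f₃ z.2)
      - (f₁ z.1 * f₂ z.2 + f₂ z.1 * f₁ z.2) ∂(volume.prod volume) := by
    rw [integral_pos_iff_support_of_nonneg]
    · have : Function.support (fun z : ℝ × ℝ => (f₃ z.1 * f₄ z.2 + f₄ z.1 * f₃ z.2)
          - (f₁ z.1 * f₂ z.2 + f₂ z.1 * f₁ z.2)) = univ := by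
        refine eq_univ_of_forall fun z => ?_
        rw [Function.mem_support]
        have := h z.1 z.2
        apply ne_of_gt
        linarith [mul_comm (f₁ z.2) (f₂ z.1), mul_comm (f₃ z.2) (f₄ z.1)]
      rw [this]
      simp
    · intro z
      have := h z.1 z.2
      simp only [Pi.zero_apply]
      linarith [mul_comm (f₁ z.2) (f₂ z.1), mul_comm (f₃ z.2) (f₄ z.1)]
    · exact (a₃.add a₄).sub (a₁.add a₂)
  have e1 := integral_sub (a₃.add a₄) (a₁.add a₂)
  simp only [Pi.add_apply] at e1
  rw [e1, integral_add a₃ a₄, integral_add a₁ a₂] at key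
  have e := fun (f g : ℝ → ℝ) => integral_prod_mul (μ := (volume : Measure ℝ))
    (ν := (volume : Measure ℝ)) f g
  rw [e, e, e, e] at key
  linarith [mul_comm (∫ x, f₁ x) (∫ x, f₂ x), mul_comm (∫ x, f₃ x) (∫ x, f₄ x)]

/-- From (r - p)(r - q) > 0 follows r(p + q) < r² + pq ≤ r(r + s). -/
lemma add_lt_add_of_mul_le {p q r s : ℝ} (hr : 0 < r) (h1 : p < r)
    (h2 : q < r) (h3 : p * q ≤ r * s) : p + q < r + s := by
  have h4 : r * (p + q) < r * (r + s) := by nlinarith [mul_pos (sub_pos.2 h1) (sub_pos.2 h2)]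
  exact lt_of_mul_lt_mul_left h4 hr.le

lemma inv_sqrt_mul_inv_sqrt {A B : ℝ} (hA : 0 < A) : 1 / √A * (1 / √B) = 1 / √(A * B) := by
  rw [one_div_mul_one_div, Real.sqrt_mul hA.le]

/-- Relative growth: the larger increment on the smaller base gives the larger quotient, (q + b₂)/q
< (p + b₁)/p. -/
lemma mul_add_lt_add_mul {p q b₁ b₂ : ℝ} (hp : 0 < p) (hpq : p ≤ q) (hb₂ : 0 ≤ b₂)
    (hb : b₂ < b₁) : p * (q + b₂) < (p + b₁) * q := by
  nlinarith [mul_le_mul_of_nonneg_right hpq hb₂, mul_lt_mul_of_pos_right hb (hp.trans_le hpq)]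

/-- The crossed variant: e is the shift of the integration variable and d the shift of the
parameter, no longer attached to the same base. -/
lemma mul_add_lt_add_mul_add {p e d b₁ b₂ : ℝ} (hp : 0 < p) (he : 0 ≤ e) (hd : 0 ≤ d)
    (hb₂ : 0 ≤ b₂) (hb : b₂ < b₁) : p * (p + e + d + b₂) < (p + e + b₁) * (p + d) := by
  nlinarith [mul_lt_mul_of_pos_right hb hp, mul_nonneg he hd, mul_nonneg (hb₂.trans hb.le) hd]

/-- Strict log-supermodularity of the half periods along `X = B + D`, `Y = 2 D`: the increments
of `D` from `D₁` to `D₁'` and from `D₂` to `D₂'` are assumed to be decreasing. -/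
lemma halfPeriod_mul_lt {B B' D₁ D₁' D₂ D₂' : ℝ} (hB : B ≤ B') (hD₁ : 0 < D₁) (hX : 0 < B + D₁)
    (h12 : D₁ < D₂) (h1 : D₂' - D₂ < D₁' - D₁) (h2 : D₂ ≤ D₂') :
    halfPeriod (B' + D₁') (2 * D₁') * halfPeriod (B + D₂) (2 * D₂) <
      halfPeriod (B + D₁) (2 * D₁) * halfPeriod (B' + D₂') (2 * D₂') := by
  have hD₂ : 0 < D₂ := by linarith
  have hD₁' : 0 < D₁' := by linarith
  have hD₂' : 0 < D₂' := by linarith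
  have hX₂ : 0 < B + D₂ := by linarith
  have hX₁' : 0 < B' + D₁' := by linarith
  have hX₂' : 0 < B' + D₂' := by linarith
  rw [halfPeriod_eq_integral hX₁' (by linarith), halfPeriod_eq_integral hX₂ (by linarith),
    halfPeriod_eq_integral hX (by linarith), halfPeriod_eq_integral hX₂' (by linarith)]
  suffices H : (∫ t : ℝ, 1 / √((t ^ 2 + (B' + D₁')) * (t ^ 2 + 2 * D₁'))) *
      (∫ t : ℝ, 1 / √((t ^ 2 + (B + D₂)) * (t ^ 2 + 2 * D₂))) <
      (∫ t : ℝ, 1 / √((t ^ 2 + (B + D₁)) * (t ^ 2 + 2 * D₁))) *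
      (∫ t : ℝ, 1 / √((t ^ 2 + (B' + D₂')) * (t ^ 2 + 2 * D₂'))) by
    have h2 : (0 : ℝ) < 1 / √2 := by positivity
    have := mul_lt_mul_of_pos_left H (mul_pos h2 h2)
    linarith
  refine integral_mul_integral_lt (integrable_inv_sqrt_quartic hX₁' (by linarith))
    (integrable_inv_sqrt_quartic hX₂ (by linarith)) (integrable_inv_sqrt_quartic hX (by linarith))
    (integrable_inv_sqrt_quartic hX₂' (by linarith)) ?_
  have key : ∀ x y : ℝ, x ^ 2 ≤ y ^ 2 →
      1 / √((x ^ 2 + (B' + D₁')) * (x ^ 2 + 2 * D₁')) *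
        (1 / √((y ^ 2 + (B + D₂)) * (y ^ 2 + 2 * D₂))) +
      1 / √((y ^ 2 + (B' + D₁')) * (y ^ 2 + 2 * D₁')) *
        (1 / √((x ^ 2 + (B + D₂)) * (x ^ 2 + 2 * D₂))) <
      1 / √((x ^ 2 + (B + D₁)) * (x ^ 2 + 2 * D₁)) *
        (1 / √((y ^ 2 + (B' + D₂')) * (y ^ 2 + 2 * D₂'))) +
      1 / √((y ^ 2 + (B + D₁)) * (y ^ 2 + 2 * D₁)) *
        (1 / √((x ^ 2 + (B' + D₂')) * (x ^ 2 + 2 * D₂'))) := by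
    intro x y hxy
    have hu : 0 ≤ x ^ 2 := sq_nonneg x
    generalize x ^ 2 = u at *
    generalize y ^ 2 = v at *
    have hv : 0 ≤ v := hu.trans hxy
    -- The factors w + (B + D) and w + 2D satisfy the growth inequality separately, and the two
    -- inequalities are multiplied; `cross` works the same way.
    have main : ∀ s t : ℝ, 0 ≤ s → s ≤ t →
        (s + (B + D₁)) * (s + 2 * D₁) * ((t + (B' + D₂')) * (t + 2 * D₂')) <
        (s + (B' + D₁')) * (s + 2 * D₁') * ((t + (B + D₂)) * (t + 2 * D₂)) := by
      intro s t hs hst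
      have i1 := mul_add_lt_add_mul (p := s + (B + D₁)) (q := t + (B + D₂))
        (b₁ := B' - B + (D₁' - D₁)) (b₂ := B' - B + (D₂' - D₂)) (by linarith) (by linarith)
        (by linarith) (by linarith)
      have i2 := mul_add_lt_add_mul (p := s + 2 * D₁) (q := t + 2 * D₂)
        (b₁ := 2 * (D₁' - D₁)) (b₂ := 2 * (D₂' - D₂)) (by linarith) (by linarith)
        (by linarith) (by linarith)
      have i3 := mul_lt_mul'' i1 i2 (mul_nonneg (by linarith) (by linarith))
        (mul_nonneg (by linarith) (by linarith))
      refine lt_of_eq_of_lt ?_ (i3.trans_eq ?_) <;> ring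
    have cross : (u + (B + D₁)) * (u + 2 * D₁) * ((v + (B' + D₂')) * (v + 2 * D₂')) <
        (v + (B' + D₁')) * (v + 2 * D₁') * ((u + (B + D₂)) * (u + 2 * D₂)) := by
      have i1 := mul_add_lt_add_mul_add (p := u + (B + D₁)) (e := v - u) (d := D₂ - D₁)
        (b₁ := B' - B + (D₁' - D₁)) (b₂ := B' - B + (D₂' - D₂)) (by linarith) (by linarith)
        (by linarith) (by linarith) (by linarith)
      have i2 := mul_add_lt_add_mul_add (p := u + 2 * D₁) (e := v - u) (d := 2 * (D₂ - D₁))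
        (b₁ := 2 * (D₁' - D₁)) (b₂ := 2 * (D₂' - D₂)) (by linarith) (by linarith)
        (by linarith) (by linarith) (by linarith)
      have i3 := mul_lt_mul'' i1 i2 (mul_nonneg (by linarith) (by linarith))
        (mul_nonneg (by linarith) (by linarith))
      refine lt_of_eq_of_lt ?_ (i3.trans_eq ?_) <;> ring
    have pos : ∀ {w C D : ℝ}, 0 ≤ w → 0 < C + D → 0 < D →
        0 < (w + (C + D)) * (w + 2 * D) := fun hw hC hD =>
      mul_pos (by linarith) (by linarith)
    have p₁u := pos hu hX₁' hD₁'
    have p₁v := pos hv hX₁' hD₁'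
    have p₂u := pos hu hX₂ hD₂
    have p₂v := pos hv hX₂ hD₂
    have p₃u := pos hu hX hD₁
    have p₃v := pos hv hX hD₁
    have p₄u := pos hu hX₂' hD₂'
    have p₄v := pos hv hX₂' hD₂'
    have muv := main u v hu hxy
    have muu := main u u hu le_rfl
    have mvv := main v v hv le_rfl
    generalize (u + (B' + D₁')) * (u + 2 * D₁') = a₁ at *
    generalize (v + (B' + D₁')) * (v + 2 * D₁') = b₁ at *
    generalize (u + (B + D₂)) * (u + 2 * D₂) = a₂ at *
    generalize (v + (B + D₂)) * (v + 2 * D₂) = b₂ at *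
    generalize (u + (B + D₁)) * (u + 2 * D₁) = a₃ at *
    generalize (v + (B + D₁)) * (v + 2 * D₁) = b₃ at *
    generalize (u + (B' + D₂')) * (u + 2 * D₂') = a₄ at *
    generalize (v + (B' + D₂')) * (v + 2 * D₂') = b₄ at *
    rw [inv_sqrt_mul_inv_sqrt p₁u, inv_sqrt_mul_inv_sqrt p₁v, inv_sqrt_mul_inv_sqrt p₃u,
      inv_sqrt_mul_inv_sqrt p₃v]
    have sq_lt : ∀ {r s : ℝ}, 0 < r → r < s → 1 / √s < 1 / √r := fun hr hrs =>
      one_div_lt_one_div_of_lt (Real.sqrt_pos.2 hr) (Real.sqrt_lt_sqrt hr.le hrs)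
    -- `main` at (u, v) and `cross` show that the first summand on the right exceeds both summands
    -- on the left. `main` at (u, u) and (v, v) compares the products.
    refine add_lt_add_of_mul_le (by positivity) (sq_lt (by positivity) muv)
      (sq_lt (by positivity) cross) ?_
    rw [inv_sqrt_mul_inv_sqrt (by positivity), inv_sqrt_mul_inv_sqrt (by positivity)]
    refine (sq_lt (by positivity) ?_).le
    have := mul_lt_mul'' muu mvv (by positivity) (by positivity)
    refine lt_of_eq_of_lt ?_ (this.trans_eq ?_) <;> ring
  intro x y
  rcases le_total (x ^ 2) (y ^ 2) with h | h
  · exact key x y h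
  · have := key y x h
    linarith

/-! ### The angle as a function of time -/

lemma surjective_angTime {X Y : ℝ} (hX : 0 < X) (hY : 0 < Y) :
    Function.Surjective (angTime X Y) := by
  have hper : Function.Periodic (fun t => 1 / √(angForm X Y t)) Real.pi := fun t => by
    simp only [angForm_add_pi]
  have hint := (continuous_inv_sqrt_angForm hX hY).intervalIntegrable
    (μ := MeasureTheory.volume) 0 Real.pi
  have hpos : ∀ t, 0 < 1 / √(angForm X Y t) := fun t =>
    div_pos one_pos (Real.sqrt_pos.2 (angForm_pos hX hY t))
  refine Continuous.surjective
    (continuous_iff_continuousAt.2 fun t => (hasDerivAt_angTime hX hY t).continuousAt) ?_ ?_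
  · exact hper.tendsto_atTop_intervalIntegral_of_pos' hint hpos Real.pi_pos
  · exact hper.tendsto_atBot_intervalIntegral_of_pos' hint hpos Real.pi_pos

/-- The angle of an oscillation as a function of time. -/
noncomputable def angle (X Y : ℝ) : ℝ → ℝ := Function.invFun (angTime X Y)

section angle

variable {X Y : ℝ}

lemma angTime_angle (hX : 0 < X) (hY : 0 < Y) (t : ℝ) : angTime X Y (angle X Y t) = t :=
  Function.invFun_eq (surjective_angTime hX hY t)

lemma angle_angTime (hX : 0 < X) (hY : 0 < Y) (θ : ℝ) : angle X Y (angTime X Y θ) = θ :=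
  Function.leftInverse_invFun (strictMono_angTime hX hY).injective θ

lemma angle_lt_iff (hX : 0 < X) (hY : 0 < Y) {t θ : ℝ} : angle X Y t < θ ↔ t < angTime X Y θ := by
  rw [← (strictMono_angTime hX hY).lt_iff_lt, angTime_angle hX hY]

lemma lt_angle_iff (hX : 0 < X) (hY : 0 < Y) {t θ : ℝ} : θ < angle X Y t ↔ angTime X Y θ < t := by
  rw [← (strictMono_angTime hX hY).lt_iff_lt, angTime_angle hX hY]

/-- In the order topology it is enough to control strict inequalities for the inverse, and these
translate into inequalities for `angTime`, which is jointly continuous. -/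
lemma continuousOn_angle :
    ContinuousOn (fun p : (ℝ × ℝ) × ℝ => angle p.1.1 p.1.2 p.2) {p | 0 < p.1.1 ∧ 0 < p.1.2} := by
  have hopen : IsOpen {p : (ℝ × ℝ) × ℝ | 0 < p.1.1 ∧ 0 < p.1.2} :=
    IsOpen.and (isOpen_lt continuous_const (by fun_prop)) (isOpen_lt continuous_const (by fun_prop))
  intro p hp
  refine ContinuousAt.continuousWithinAt ?_
  have hmem := hopen.mem_nhds hp
  have hcont : ∀ θ : ℝ, ContinuousAt (fun q : (ℝ × ℝ) × ℝ => angTime q.1.1 q.1.2 θ) p := fun θ =>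
    (continuousOn_angTime.continuousAt (x := (p.1, θ)) (IsOpen.mem_nhds hopen hp)).comp
      (f := fun q : (ℝ × ℝ) × ℝ => (q.1, θ)) (by fun_prop)
  refine tendsto_order.2 ⟨fun θ hθ => ?_, fun θ hθ => ?_⟩
  · replace hθ := (lt_angle_iff hp.1 hp.2).1 hθ
    filter_upwards [hmem, (hcont θ).eventually_lt continuous_snd.continuousAt hθ] with q hq h
    rwa [lt_angle_iff hq.1 hq.2]
  · replace hθ := (angle_lt_iff hp.1 hp.2).1 hθ
    filter_upwards [hmem, continuous_snd.continuousAt.eventually_lt (hcont θ) hθ] with q hq h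
    rwa [angle_lt_iff hq.1 hq.2]

lemma continuous_angle (hX : 0 < X) (hY : 0 < Y) : Continuous (angle X Y) := by
  have := continuousOn_angle.comp_continuous (f := fun t : ℝ => ((X, Y), t)) (by fun_prop)
    fun _ => ⟨hX, hY⟩
  exact this

lemma hasDerivAt_angle (hX : 0 < X) (hY : 0 < Y) (t : ℝ) :
    HasDerivAt (angle X Y) (√(angForm X Y (angle X Y t))) t := by
  have h := HasDerivAt.of_local_left_inverse (continuous_angle hX hY).continuousAt
    (hasDerivAt_angTime hX hY (angle X Y t))
    (one_div_ne_zero (Real.sqrt_pos.2 (angForm_pos hX hY _)).ne')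
    (Eventually.of_forall (angTime_angle hX hY))
  simpa using h

lemma angle_add_halfPeriod (hX : 0 < X) (hY : 0 < Y) (t : ℝ) :
    angle X Y (t + halfPeriod X Y) = angle X Y t + Real.pi := by
  apply (strictMono_angTime hX hY).injective
  rw [angTime_angle hX hY, angTime_add_pi hX hY, angTime_angle hX hY]

lemma angle_add_nat_mul (hX : 0 < X) (hY : 0 < Y) (t : ℝ) (n : ℕ) :
    angle X Y (t + n * halfPeriod X Y) = angle X Y t + n * Real.pi := by
  induction n with
  | zero => simp
  | succ n ih =>
    rw [show t + ((n + 1 : ℕ) : ℝ) * halfPeriod X Y =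
      t + n * halfPeriod X Y + halfPeriod X Y by push_cast; ring, angle_add_halfPeriod hX hY, ih]
    push_cast; ring

lemma angle_add_int_mul (hX : 0 < X) (hY : 0 < Y) (t : ℝ) (n : ℤ) :
    angle X Y (t + n * halfPeriod X Y) = angle X Y t + n * Real.pi := by
  obtain ⟨m, rfl | rfl⟩ := n.eq_nat_or_neg
  · exact_mod_cast angle_add_nat_mul hX hY t m
  · have := angle_add_nat_mul hX hY (t + ((-(m : ℤ) : ℤ) : ℝ) * halfPeriod X Y) m
    push_cast at *
    rw [show t + -(m : ℝ) * halfPeriod X Y + m * halfPeriod X Y = t by ring] at this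
    linarith

lemma angle_injective (hX : 0 < X) (hY : 0 < Y) : Function.Injective (angle X Y) :=
  Function.LeftInverse.injective (angTime_angle hX hY)

/-- A time shift acts on the angle at one instant as a shift by a multiple of `π` only if it is
that multiple of the half period. -/
lemma eq_int_mul_halfPeriod (hX : 0 < X) (hY : 0 < Y) {t S : ℝ} {n : ℤ}
    (h : angle X Y (t + S) = angle X Y t + n * Real.pi) : S = n * halfPeriod X Y := by
  rw [← angle_add_int_mul hX hY] at h
  have := angle_injective hX hY h
  linarith

end angle

/-! ### Uniqueness for Hamilton's equations -/

/-- Solutions of Hamilton's equations of a `C²` Hamiltonian are determined by their values at one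
time. -/
lemma IsHamiltonianMotion.eq {h : ℝ × ℝ → ℝ} (hh : ContDiff ℝ 2 h) {x y : ℝ → ℝ × ℝ}
    (hx : IsHamiltonianMotion h x) (hy : IsHamiltonianMotion h y) {t₀ : ℝ} (h0 : x t₀ = y t₀) :
    x = y := by
  let v : ℝ × ℝ → ℝ × ℝ := fun z => (fderiv ℝ h z (0, 1), -fderiv ℝ h z (1, 0))
  have hv : ContDiff ℝ 1 v := by
    have : ContDiff ℝ 1 (fderiv ℝ h) := hh.fderiv_right (by norm_num)
    exact (this.clm_apply contDiff_const).prodMk (this.clm_apply contDiff_const).neg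
  have hvec : ∀ z : ℝ × ℝ, (deriv (fun p => h (z.1, p)) z.2, -deriv (fun q => h (q, z.2)) z.1)
      = v z := by
    intro z
    have hz := (hh.differentiable (by norm_num) z).hasFDerivAt
    have e1 := hz.comp_hasDerivAt_of_eq z.2
      ((hasDerivAt_const z.2 z.1).prodMk (hasDerivAt_id z.2)) rfl
    have e2 := hz.comp_hasDerivAt_of_eq z.1
      ((hasDerivAt_id z.1).prodMk (hasDerivAt_const z.1 z.2)) rfl
    exact Prod.ext e1.deriv (congrArg Neg.neg e2.deriv)
  simp only [IsHamiltonianMotion, hvec] at hx hy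
  have cx : Continuous x := continuous_iff_continuousAt.2 fun t => (hx t).continuousAt
  have cy : Continuous y := continuous_iff_continuousAt.2 fun t => (hy t).continuousAt
  -- The set of times of agreement is closed by continuity and open by local uniqueness, hence
  -- everything, since both solutions are global.
  have hclopen : IsClopen {t | x t = y t} := by
    refine ⟨isClosed_eq cx cy, isOpen_iff_mem_nhds.2 fun t ht => ?_⟩
    obtain ⟨K, s, hs, hK⟩ := (hv.contDiffAt (x := x t)).exists_lipschitzOnWith
    refine ODE_solution_unique_of_eventually (v := fun _ => v) (s := fun _ => s) (K := K)
      (Eventually.of_forall fun _ => hK) ?_ ?_ ht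
    · filter_upwards [cx.continuousAt.eventually hs] with u hu using ⟨hx u, hu⟩
    · filter_upwards [cy.continuousAt.eventually (ht ▸ hs)] with u hu using ⟨hy u, hu⟩
  have := hclopen.eq_univ ⟨t₀, h0⟩
  exact funext fun t => (this ▸ mem_univ t : t ∈ {t | x t = y t})

lemma IsHamiltonianMotion.comp_add {h : ℝ × ℝ → ℝ} {x : ℝ → ℝ × ℝ} (hx : IsHamiltonianMotion h x)
    (s : ℝ) : IsHamiltonianMotion h fun t => x (t + s) := fun t => (hx (t + s)).comp_add_const t s

/-! ### Oscillations in rational coordinates -/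

/-- The common form of both oscillations in rational coordinates. -/
noncomputable def osc (κ θ : ℝ) : ℝ := κ * Real.sin θ

/-- The velocity of `osc`. -/
noncomputable def oscVel (κ X Y θ : ℝ) : ℝ := κ * Real.cos θ * √(angForm X Y θ)

lemma hasDerivAt_osc {X Y : ℝ} (hX : 0 < X) (hY : 0 < Y) (κ t : ℝ) :
    HasDerivAt (fun t => osc κ (angle X Y t)) (oscVel κ X Y (angle X Y t)) t := by
  have := ((Real.hasDerivAt_sin _).comp t (hasDerivAt_angle hX hY t)).const_mul κ
  simpa [oscVel, osc, mul_assoc] using this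

/-- The energy relation of the oscillation. No hypothesis divides by κ, so κ = 0 is admitted; in
that case X = Y. -/
lemma oscVel_sq {X Y : ℝ} (hX : 0 < X) (hY : 0 < Y) {κ A B C : ℝ} (hA : κ ^ 2 * X = A)
    (hC : C * κ ^ 2 = X - Y) (hB : 2 * X - Y = 2 * B) (θ : ℝ) :
    oscVel κ X Y θ ^ 2 = 2 * (A - 2 * B * osc κ θ ^ 2 + C * osc κ θ ^ 4) := by
  have hf := Real.sq_sqrt (angForm_pos hX hY θ).le
  unfold oscVel osc
  rw [mul_pow, hf, mul_pow, Real.cos_sq']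
  unfold angForm
  rw [Real.cos_sq']
  linear_combination (-2 * Real.sin θ ^ 4 * κ ^ 2) * hC + 2 * hA
    - (2 * κ ^ 2 * Real.sin θ ^ 2) * hB

/-- Newton's equation for the quartic energy. It is obtained through the angle, since
differentiating the energy relation would require dividing by the velocity, which vanishes at
turning points. -/
lemma hasDerivAt_oscVel {X Y : ℝ} (hX : 0 < X) (hY : 0 < Y) {κ B C : ℝ}
    (hC : C * κ ^ 2 = X - Y) (hB : 2 * X - Y = 2 * B) (t : ℝ) :
    HasDerivAt (fun t => oscVel κ X Y (angle X Y t))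
      (-4 * B * osc κ (angle X Y t) + 4 * C * osc κ (angle X Y t) ^ 3) t := by
  set θ := angle X Y t with hθ
  have hpos := angForm_pos hX hY θ
  have hform : HasDerivAt (angForm X Y)
      (2 * (X * (2 * Real.cos θ * (-Real.sin θ)) + Y * (2 * Real.sin θ * Real.cos θ))) θ := by
    have h1 := (((Real.hasDerivAt_cos θ).pow 2).const_mul X).add
      (((Real.hasDerivAt_sin θ).pow 2).const_mul Y)
    refine (h1.const_mul 2).congr_deriv ?_
    norm_num
  have h1 : HasDerivAt (oscVel κ X Y) _ θ :=
    ((Real.hasDerivAt_cos θ).const_mul κ).mul (hform.sqrt hpos.ne')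
  have h2 := h1.comp t (hasDerivAt_angle hX hY t)
  refine h2.congr_deriv ?_
  rw [← hθ]
  have hf := Real.sq_sqrt hpos.le
  have hw : √(angForm X Y θ) ≠ 0 := (Real.sqrt_pos.2 hpos).ne'
  have hs := Real.sin_sq_add_cos_sq θ
  have e : ∀ w d : ℝ, w ≠ 0 → (κ * -Real.sin θ * w + κ * Real.cos θ * (d / (2 * w))) * w =
      -κ * Real.sin θ * w ^ 2 + κ * Real.cos θ * d / 2 := fun w d hw => by field_simp
  rw [e _ _ hw, hf]
  unfold osc angForm
  rw [Real.cos_sq']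
  linear_combination (-4 * κ * Real.sin θ ^ 3) * hC - (2 * κ * Real.sin θ) * hB
    + (2 * κ * Real.sin θ * (Y - X)) * hs

/-- Parameters `κ`, `X`, `Y` of the oscillation `y ^ 2 = 2 (A - 2 B x ^ 2 + C x ^ 4)` about `0`. -/
structure OscParams (κ X Y A B C : ℝ) : Prop where
  X_pos : 0 < X
  Y_pos : 0 < Y
  amp_nonneg : 0 ≤ κ
  amp_sq : κ ^ 2 * X = A
  mid : 2 * X - Y = 2 * B
  top : C * κ ^ 2 = X - Y

/-- Exhibits the turning points: if A > 0 and Y ≥ X, the quartic is negative beyond |x| = κ. -/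
lemma OscParams.factor {κ X Y A B C : ℝ} (hp : OscParams κ X Y A B C) (x : ℝ) :
    A * (A - 2 * B * x ^ 2 + C * x ^ 4) = X * (κ ^ 2 - x ^ 2) * (A + (Y - X) * x ^ 2) := by
  linear_combination (-(A + (Y - X) * x ^ 2) - C * x ^ 4) * hp.amp_sq
    + X * x ^ 4 * hp.top + A * x ^ 2 * hp.mid

lemma OscParams.exists_angle {κ X Y A B C x y : ℝ} (hp : OscParams κ X Y A B C) (hκ : 0 < κ)
    (hx : x ^ 2 ≤ κ ^ 2) (hy : y ^ 2 = 2 * (A - 2 * B * x ^ 2 + C * x ^ 4)) :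
    ∃ θ, osc κ θ = x ∧ oscVel κ X Y θ = y := by
  have habs := abs_le.1 (abs_le_of_sq_le_sq hx hκ.le)
  have h1 : -1 ≤ x / κ := by rw [le_div_iff₀ hκ]; linarith
  have h2 : x / κ ≤ 1 := by rw [div_le_iff₀ hκ]; linarith
  have h3 := Real.sin_arcsin h1 h2
  have h4 : osc κ (Real.arcsin (x / κ)) = x := by
    rw [osc, h3]; field_simp
  have h5 := oscVel_sq hp.X_pos hp.Y_pos hp.amp_sq hp.top hp.mid (Real.arcsin (x / κ))
  rw [h4, ← hy] at h5
  -- The arcsine is the branch of nonnegative velocity; the reflected angle has the same position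
  -- and the opposite velocity.
  rcases sq_eq_sq_iff_eq_or_eq_neg.1 h5 with h | h
  · exact ⟨_, h4, h⟩
  · refine ⟨Real.pi - Real.arcsin (x / κ), ?_, ?_⟩
    · rw [osc, Real.sin_pi_sub]; exact h4
    · have : oscVel κ X Y (Real.pi - Real.arcsin (x / κ)) =
          -oscVel κ X Y (Real.arcsin (x / κ)) := by
        simp [oscVel, angForm, Real.sin_pi_sub, Real.cos_pi_sub]
      rw [this, h, neg_neg]

lemma osc_sq_le (κ θ : ℝ) : osc κ θ ^ 2 ≤ κ ^ 2 := by
  rw [osc, mul_pow]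
  exact mul_le_of_le_one_right (sq_nonneg _) (Real.sin_sq_le_one θ)

lemma osc_add_int_mul_pi (κ θ : ℝ) (n : ℤ) : osc κ (θ + n * Real.pi) = (-1) ^ n * osc κ θ := by
  rw [osc, Real.sin_add_int_mul_pi, osc]; ring

lemma oscVel_add_int_mul_pi (κ X Y θ : ℝ) (n : ℤ) :
    oscVel κ X Y (θ + n * Real.pi) = (-1) ^ n * oscVel κ X Y θ := by
  have h : angForm X Y (θ + n * Real.pi) = angForm X Y θ := by
    have h1 : (((-1 : ℝ) ^ n)) ^ 2 = 1 := by
      rw [← zpow_natCast, ← zpow_mul, mul_comm, zpow_mul]; simp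
    simp only [angForm, Real.cos_add_int_mul_pi, Real.sin_add_int_mul_pi, mul_pow, h1, one_mul]
  rw [oscVel, h, Real.cos_add_int_mul_pi, oscVel]; ring

/-- Position and velocity together determine the angle up to multiples of `2 π`, and up to odd
multiples of `π` when their signs are reversed. -/
lemma exists_int_of_osc_eq {κ X Y θ θ' ε : ℝ} (hκ : 0 < κ) (hX : 0 < X) (hY : 0 < Y)
    (hε : ε = 1 ∨ ε = -1) (h1 : osc κ θ' = ε * osc κ θ)
    (h2 : oscVel κ X Y θ' = ε * oscVel κ X Y θ) :
    ∃ n : ℤ, θ' = θ + n * Real.pi ∧ (-1 : ℝ) ^ n = ε := by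
  have hε2 : ε ^ 2 = 1 := by rcases hε with rfl | rfl <;> norm_num
  have hs : Real.sin θ' = ε * Real.sin θ := by
    have : κ * Real.sin θ' = κ * (ε * Real.sin θ) := by
      simp only [osc] at h1; rw [h1]; ring
    exact mul_left_cancel₀ hκ.ne' this
  have hf : angForm X Y θ' = angForm X Y θ := by
    simp only [angForm, Real.cos_sq', hs, mul_pow, hε2, one_mul]
  have hc : Real.cos θ' = ε * Real.cos θ := by
    simp only [oscVel, hf] at h2
    have hw : √(angForm X Y θ) ≠ 0 := (Real.sqrt_pos.2 (angForm_pos hX hY θ)).ne'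
    have : κ * √(angForm X Y θ) * Real.cos θ' = κ * √(angForm X Y θ) * (ε * Real.cos θ) := by
      linear_combination h2
    exact mul_left_cancel₀ (mul_ne_zero hκ.ne' hw) this
  have hsub : Real.sin (θ' - θ) = 0 := by rw [Real.sin_sub, hs, hc]; ring
  obtain ⟨n, hn⟩ := Real.sin_eq_zero_iff.1 hsub
  refine ⟨n, by linarith, ?_⟩
  have hcos : Real.cos (θ' - θ) = ε := by
    rw [Real.cos_sub, hs, hc]
    linear_combination ε * Real.sin_sq_add_cos_sq θ
  rw [← hn, Real.cos_int_mul_pi] at hcos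
  exact hcos

/-! ### The two level curves in elliptic coordinates; the λ-motion -/

/-- The level curve of the `lam`-oscillation, parametrized by the angle. -/
noncomputable def lamCurve (κ X Y θ : ℝ) : ℝ × ℝ :=
  (Real.log (1 + osc κ θ) - Real.log (1 - osc κ θ), oscVel κ X Y θ / (2 * (1 - osc κ θ ^ 2)))

/-- The level curve of the `ν`-oscillation, relative to the center, parametrized by the angle. -/
noncomputable def nuCurve (κ X Y θ : ℝ) : ℝ × ℝ :=
  (2 * Real.arctan (osc κ θ), oscVel κ X Y θ / (2 * (1 + osc κ θ ^ 2)))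

lemma abs_osc_lt_one {κ : ℝ} (hκ0 : 0 ≤ κ) (hκ1 : κ < 1) (θ : ℝ) :
    -1 < osc κ θ ∧ osc κ θ < 1 := by
  have := abs_le_of_sq_le_sq (osc_sq_le κ θ) hκ0
  exact abs_lt.1 (this.trans_lt hκ1)

/-- The difference of logarithms is 2 artanh x, so these are the half-argument formulas for x =
tanh(λ/2). -/
lemma cosh_log_sub {x : ℝ} (h1 : -1 < x) (h2 : x < 1) :
    Real.cosh (Real.log (1 + x) - Real.log (1 - x)) = (1 + x ^ 2) / (1 - x ^ 2) ∧
    Real.sinh (Real.log (1 + x) - Real.log (1 - x)) = 2 * x / (1 - x ^ 2) := by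
  have a : 0 < 1 + x := by linarith
  have b : 0 < 1 - x := by linarith
  have c : 1 - x ^ 2 ≠ 0 := by nlinarith
  rw [← Real.log_div a.ne' b.ne', Real.cosh_log (by positivity), Real.sinh_log (by positivity)]
  constructor <;> field_simp <;> ring

lemma cos_two_mul_arctan (x : ℝ) : Real.cos (2 * Real.arctan x) = (1 - x ^ 2) / (1 + x ^ 2) := by
  have : 1 + x ^ 2 ≠ 0 := by positivity
  rw [Real.cos_two_mul, Real.cos_sq_arctan]; field_simp; ring

lemma sin_two_mul_arctan (x : ℝ) : Real.sin (2 * Real.arctan x) = 2 * x / (1 + x ^ 2) := by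
  have h : 0 < 1 + x ^ 2 := by positivity
  rw [Real.sin_two_mul, Real.sin_arctan, Real.cos_arctan]
  have h2 := Real.sq_sqrt h.le
  have h3 : √(1 + x ^ 2) ≠ 0 := (Real.sqrt_pos.2 h).ne'
  have h4 := h.ne'
  field_simp
  rw [h2]

lemma deriv_KLam_snd (c q p : ℝ) : deriv (fun p => KLam c (q, p)) p = 4 * p := by
  have : HasDerivAt (fun p => KLam c (q, p)) (4 * p) p := by
    have h := ((((hasDerivAt_id p).pow 2).const_mul 2).sub_const (2 * Real.cosh q)).sub_const
      (c * Real.cosh q ^ 2)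
    refine h.congr_deriv ?_
    simp; ring
  exact this.deriv

lemma deriv_KLam_fst (c q p : ℝ) : deriv (fun q => KLam c (q, p)) q =
    -2 * Real.sinh q * (1 + c * Real.cosh q) := by
  have : HasDerivAt (fun q => KLam c (q, p)) (-2 * Real.sinh q * (1 + c * Real.cosh q)) q := by
    have h := (((Real.hasDerivAt_cosh q).const_mul 2).const_sub (2 * p ^ 2)).sub
      (((Real.hasDerivAt_cosh q).pow 2).const_mul c)
    refine h.congr_deriv ?_
    simp; ring
  exact this.deriv

lemma deriv_KNu_snd (μ c q p : ℝ) : deriv (fun p => KNu μ c (q, p)) p = 4 * p := by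
  have : HasDerivAt (fun p => KNu μ c (q, p)) (4 * p) p := by
    have h := ((((hasDerivAt_id p).pow 2).const_mul 2).add_const
      (2 * (1 - 2 * μ) * Real.cos q)).add_const (c * Real.cos q ^ 2)
    refine h.congr_deriv ?_
    simp; ring
  exact this.deriv

lemma deriv_KNu_fst (μ c q p : ℝ) : deriv (fun q => KNu μ c (q, p)) q =
    -2 * Real.sin q * ((1 - 2 * μ) + c * Real.cos q) := by
  have : HasDerivAt (fun q => KNu μ c (q, p)) (-2 * Real.sin q * ((1 - 2 * μ) + c * Real.cos q))
      q := by
    have h := (((Real.hasDerivAt_cos q).const_mul (2 * (1 - 2 * μ))).const_add (2 * p ^ 2)).add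
      (((Real.hasDerivAt_cos q).pow 2).const_mul c)
    refine h.congr_deriv ?_
    simp; ring
  exact this.deriv

lemma contDiff_KLam (c : ℝ) : ContDiff ℝ 2 (KLam c) := by
  unfold KLam; fun_prop

lemma contDiff_KNu (μ c : ℝ) : ContDiff ℝ 2 (KNu μ c) := by
  unfold KNu; fun_prop

section lam

variable {κ X Y g h : ℝ}

lemma KLam_lamCurve (hp : OscParams κ X Y (g + 2 - h) (g + h) (g - 2 - h)) (hκ : κ < 1) (θ : ℝ) :
    KLam (-h) (lamCurve κ X Y θ) = g := by
  obtain ⟨h1, h2⟩ := abs_osc_lt_one hp.amp_nonneg hκ θ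
  have hv := oscVel_sq hp.X_pos hp.Y_pos hp.amp_sq hp.top hp.mid θ
  simp only [KLam, lamCurve, (cosh_log_sub h1 h2).1, div_pow, mul_pow, hv]
  have c : 1 - osc κ θ ^ 2 ≠ 0 := by nlinarith
  field_simp
  ring

lemma isHamiltonianMotion_lamCurve (hp : OscParams κ X Y (g + 2 - h) (g + h) (g - 2 - h))
    (hκ : κ < 1) : IsHamiltonianMotion (KLam (-h)) fun t => lamCurve κ X Y (angle X Y t) := by
  intro t
  obtain ⟨h1, h2⟩ := abs_osc_lt_one hp.amp_nonneg hκ (angle X Y t)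
  have hv := oscVel_sq hp.X_pos hp.Y_pos hp.amp_sq hp.top hp.mid (angle X Y t)
  have dx := hasDerivAt_osc hp.X_pos hp.Y_pos κ t
  have dy := hasDerivAt_oscVel hp.X_pos hp.Y_pos hp.top hp.mid t
  have a : 1 + osc κ (angle X Y t) ≠ 0 := by linarith
  have b : 1 - osc κ (angle X Y t) ≠ 0 := by linarith
  have c : 1 - osc κ (angle X Y t) ^ 2 ≠ 0 := by nlinarith
  have d1 := ((dx.const_add 1).log a).sub ((dx.const_sub 1).log b)
  have d2 := dy.div (((dx.fun_pow 2).const_sub 1).const_mul 2) (mul_ne_zero two_ne_zero c)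
  refine (d1.prodMk d2).congr_deriv ?_
  simp only [deriv_KLam_snd, deriv_KLam_fst, lamCurve, (cosh_log_sub h1 h2).1,
    (cosh_log_sub h1 h2).2]
  generalize osc κ (angle X Y t) = x at *
  generalize oscVel κ X Y (angle X Y t) = y at *
  refine Prod.ext ?_ ?_
  · simp only
    field_simp
    ring
  · field_simp
    linear_combination (2 * x) * hv

/-- Every motion on a level of `K_lam` runs along the level curve. -/
lemma exists_eq_lamCurve (hp : OscParams κ X Y (g + 2 - h) (g + h) (g - 2 - h)) (hκ0 : 0 < κ)
    (hκ : κ < 1) (hXY : X ≤ Y) {z : ℝ → ℝ × ℝ} (hz : IsHamiltonianMotion (KLam (-h)) z)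
    (hE : KLam (-h) (z 0) = g) : ∃ s, ∀ t, z t = lamCurve κ X Y (angle X Y (t + s)) := by
  obtain ⟨θ, hθ⟩ : ∃ θ, z 0 = lamCurve κ X Y θ := by
    set x := Real.tanh ((z 0).1 / 2) with hx
    have h1 : -1 < x := Real.neg_one_lt_tanh _
    have h2 : x < 1 := Real.tanh_lt_one _
    have hlog : Real.log (1 + x) - Real.log (1 - x) = (z 0).1 := by
      have := Real.artanh_tanh ((z 0).1 / 2)
      rw [← hx, Real.artanh_eq_half_log ⟨h1.le, h2.le⟩,
        Real.log_div (by linarith) (by linarith)] at this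
      linarith
    have hc := (cosh_log_sub h1 h2).1
    rw [hlog] at hc
    have c : 1 - x ^ 2 ≠ 0 := by nlinarith
    have cpos : 0 < 1 - x ^ 2 := by nlinarith
    have hy : (2 * (z 0).2 * (1 - x ^ 2)) ^ 2 =
        2 * ((g + 2 - h) - 2 * (g + h) * x ^ 2 + (g - 2 - h) * x ^ 4) := by
      rw [KLam, hc] at hE
      field_simp at hE
      linear_combination 2 * hE
    have hA : 0 < g + 2 - h := by
      rw [← hp.amp_sq]; exact mul_pos (pow_pos hκ0 2) hp.X_pos
    have hxκ : x ^ 2 ≤ κ ^ 2 := by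
      by_contra hlt
      push Not at hlt
      -- Beyond the amplitude the quartic would be negative, although it is half of a square by
      -- `hy`.
      have e := hp.factor x
      have n1 : X * (κ ^ 2 - x ^ 2) * ((g + 2 - h) + (Y - X) * x ^ 2) < 0 := by
        refine mul_neg_of_neg_of_pos (mul_neg_of_pos_of_neg hp.X_pos (by linarith)) ?_
        nlinarith [mul_nonneg (sub_nonneg.2 hXY) (sq_nonneg x)]
      rw [← e] at n1
      nlinarith [sq_nonneg (2 * (z 0).2 * (1 - x ^ 2))]
    obtain ⟨θ, e1, e2⟩ := hp.exists_angle hκ0 hxκ hy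
    refine ⟨θ, Prod.ext ?_ ?_⟩
    · simp only [lamCurve, e1, hlog]
    · simp only [lamCurve, e1, e2]
      field_simp
  refine ⟨angTime X Y θ, fun t => ?_⟩
  have hm := (isHamiltonianMotion_lamCurve hp hκ).comp_add (angTime X Y θ)
  have := hz.eq (contDiff_KLam _) hm (t₀ := 0)
    (by simp only [zero_add, angle_angTime hp.X_pos hp.Y_pos]; exact hθ)
  exact congrFun this t

end lam

/-! ### The ν-motion about a primary -/

/-- The difference between the mass of `e` and the mass of the other primary. -/
noncomputable def massDiff (μ : ℝ) (e : Primary) : ℝ := 2 * e.mass μ - 1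

lemma sin_center (e : Primary) : Real.sin e.center = 0 := by
  cases e <;> simp [Primary.center]

lemma cos_center_sq (e : Primary) : Real.cos e.center ^ 2 = 1 := by
  cases e <;> simp [Primary.center]

lemma mul_cos_center (μ : ℝ) (e : Primary) :
    (1 - 2 * μ) * Real.cos e.center = -massDiff μ e := by
  cases e
  · simp [Primary.center, massDiff, Primary.mass]; ring
  · simp [Primary.center, massDiff, Primary.mass]

lemma cos_center_add (e : Primary) (φ : ℝ) :
    Real.cos (e.center + φ) = Real.cos e.center * Real.cos φ := by
  rw [Real.cos_add, sin_center]; ring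

lemma sin_center_add (e : Primary) (φ : ℝ) :
    Real.sin (e.center + φ) = Real.cos e.center * Real.sin φ := by
  rw [Real.sin_add, sin_center]; ring

/-- Measured from the center, the ν-Hamiltonian depends on the primary only through `massDiff`, so
Earth and Moon are treated together. -/
lemma KNu_center_add (μ h : ℝ) (e : Primary) (φ p : ℝ) :
    KNu μ (-h) (e.center + φ, p) =
      2 * p ^ 2 - 2 * massDiff μ e * Real.cos φ - h * Real.cos φ ^ 2 := by
  simp only [KNu, cos_center_add]
  linear_combination (2 * Real.cos φ) * mul_cos_center μ e - h * Real.cos φ ^ 2 * cos_center_sq e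

lemma deriv_KNu_center_add (μ h : ℝ) (e : Primary) (φ p : ℝ) :
    -deriv (fun q => KNu μ (-h) (q, p)) (e.center + φ) =
      -2 * Real.sin φ * (massDiff μ e + h * Real.cos φ) := by
  rw [deriv_KNu_fst, cos_center_add, sin_center_add]
  linear_combination (2 * Real.sin φ) * mul_cos_center μ e
    - 2 * h * Real.sin φ * Real.cos φ * cos_center_sq e

/-- If p(0) > 0, then φ grows at least linearly in forward time; otherwise p(-1) < 0 and the
time-reversed motion has this property. -/
lemma not_bounded_of_strictMono {φ p : ℝ → ℝ} (hφ : ∀ t, HasDerivAt φ (4 * p t) t)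
    (hp : StrictMono p) {M : ℝ} (hM : ∀ t, |φ t| < M) : False := by
  have key : ∀ {φ p : ℝ → ℝ}, (∀ t, HasDerivAt φ (4 * p t) t) → StrictMono p →
      (∀ t, |φ t| < M) → 0 < p 0 → False := by
    intro φ p hφ hp hM h0
    have hmono : MonotoneOn (fun t => φ t - 4 * p 0 * t) (Ici 0) := by
      have hd : ∀ t, HasDerivAt (fun t => φ t - 4 * p 0 * t) (4 * p t - 4 * p 0) t := fun t =>
        ((hφ t).sub ((hasDerivAt_id t).const_mul (4 * p 0))).congr_deriv (by ring)
      refine monotoneOn_of_deriv_nonneg (convex_Ici 0)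
        (fun t _ => (hd t).continuousAt.continuousWithinAt)
        (fun t _ => (hd t).differentiableAt.differentiableWithinAt) fun t ht => ?_
      rw [interior_Ici] at ht
      rw [(hd t).deriv]
      have := hp ht
      linarith
    have hM0 : 0 < M := (abs_nonneg _).trans_lt (hM 0)
    have hT : 0 ≤ M / (2 * p 0) := by positivity
    have := hmono (self_mem_Ici) hT hT
    have h1 := abs_lt.1 (hM 0)
    have h2 := abs_lt.1 (hM (M / (2 * p 0)))
    have h3 : 4 * p 0 * (M / (2 * p 0)) = 2 * M := by field_simp; ring
    simp only [h3] at this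
    linarith
  rcases lt_or_ge 0 (p 0) with h0 | h0
  · exact key hφ hp hM h0
  · have h1 : p (-1) < 0 := (hp (by norm_num)).trans_le h0
    refine key (φ := fun t => φ (-t - 1)) (p := fun t => -p (-t - 1)) (fun t => ?_)
      (fun s t hst => neg_lt_neg (hp (by linarith))) (fun t => hM _) (by simpa using h1)
    have := (hφ (-t - 1)).comp t ((hasDerivAt_neg t).sub_const 1)
    refine this.congr_deriv ?_
    ring

section nu

variable {κ X Y g h μ : ℝ} {e : Primary}

/-- The `ν`-oscillation about the center `e`. -/
noncomputable def nuOrbit (e : Primary) (κ X Y θ : ℝ) : ℝ × ℝ := (e.center, 0) + nuCurve κ X Y θ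

lemma nuOrbit_eq (e : Primary) (κ X Y θ : ℝ) : nuOrbit e κ X Y θ =
    (e.center + 2 * Real.arctan (osc κ θ), oscVel κ X Y θ / (2 * (1 + osc κ θ ^ 2))) := by
  simp [nuOrbit, nuCurve]

lemma abs_nuOrbit_sub_center (e : Primary) (κ X Y θ : ℝ) :
    |(nuOrbit e κ X Y θ).1 - e.center| < Real.pi := by
  rw [nuOrbit_eq, abs_lt]
  constructor
  · have := Real.neg_pi_div_two_lt_arctan (osc κ θ); simp only; linarith
  · have := Real.arctan_lt_pi_div_two (osc κ θ); simp only; linarith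

lemma KNu_nuOrbit (hp : OscParams κ X Y (h + 2 * massDiff μ e - g) (g + h)
    (h - 2 * massDiff μ e - g)) (θ : ℝ) : KNu μ (-h) (nuOrbit e κ X Y θ) = -g := by
  have hv := oscVel_sq hp.X_pos hp.Y_pos hp.amp_sq hp.top hp.mid θ
  rw [nuOrbit_eq, KNu_center_add, cos_two_mul_arctan]
  simp only [div_pow, mul_pow, hv]
  have c : 1 + osc κ θ ^ 2 ≠ 0 := by positivity
  field_simp
  ring

lemma isHamiltonianMotion_nuOrbit (hp : OscParams κ X Y (h + 2 * massDiff μ e - g) (g + h)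
    (h - 2 * massDiff μ e - g)) :
    IsHamiltonianMotion (KNu μ (-h)) fun t => nuOrbit e κ X Y (angle X Y t) := by
  intro t
  have hv := oscVel_sq hp.X_pos hp.Y_pos hp.amp_sq hp.top hp.mid (angle X Y t)
  have dx := hasDerivAt_osc hp.X_pos hp.Y_pos κ t
  have dy := hasDerivAt_oscVel hp.X_pos hp.Y_pos hp.top hp.mid t
  have c : 1 + osc κ (angle X Y t) ^ 2 ≠ 0 := by positivity
  have d1 := (dx.arctan.const_mul 2).const_add e.center
  have d2 := dy.div (((dx.fun_pow 2).const_add 1).const_mul 2) (mul_ne_zero two_ne_zero c)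
  simp only [nuOrbit_eq]
  refine (d1.prodMk d2).congr_deriv ?_
  rw [deriv_KNu_snd, deriv_KNu_center_add, cos_two_mul_arctan, sin_two_mul_arctan]
  generalize osc κ (angle X Y t) = x at *
  generalize oscVel κ X Y (angle X Y t) = y at *
  refine Prod.ext ?_ ?_
  · simp only
    field_simp
    ring
  · field_simp
    linear_combination (-2 * x) * hv

/-- A motion in the component of `e` stays in the well around `e`. -/
lemma le_of_motion_nu (hh : 0 < h) (hp : OscParams κ X Y (h + 2 * massDiff μ e - g) (g + h)
    (h - 2 * massDiff μ e - g)) (hκ0 : 0 < κ) {z : ℝ → ℝ × ℝ}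
    (hz : IsHamiltonianMotion (KNu μ (-h)) z) (hE : ∀ t, KNu μ (-h) (z t) = -g)
    (hcomp : ∀ t, |(z t).1 - e.center| < Real.pi) (t : ℝ) :
    Y / 4 ≤ h * Real.cos ((z t).1 - e.center) + massDiff μ e := by
  set a := massDiff μ e with ha
  have hA : 0 < h + 2 * a - g := by
    rw [← hp.amp_sq]; exact mul_pos (pow_pos hκ0 2) hp.X_pos
  have hX := hp.X_pos
  have hY := hp.Y_pos
  have hmid := hp.mid
  -- A consequence of AC = X(X - Y): Y/4 is the root √(gh + a²) of the discriminant in cos φ.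
  have hdisc : (Y / 4) ^ 2 = g * h + a ^ 2 := by
    have h1 : (h + 2 * a - g) * (h - 2 * a - g) = X * (X - Y) := by
      rw [← hp.top, ← hp.amp_sq]; ring
    have h2 : X = g + h + Y / 2 := by linarith
    rw [h2] at h1
    linear_combination (1 / 4) * h1
  have hsq : (h + a) ^ 2 = (Y / 4) ^ 2 + h * (h + 2 * a - g) := by rw [hdisc]; ring
  have hha : 0 < h + a := by
    by_contra hneg
    push Not at hneg
    nlinarith [mul_pos hh hA]
  obtain ⟨φ, hφ⟩ : ∃ φ : ℝ → ℝ, ∀ t, (z t).1 = e.center + φ t :=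
    ⟨fun t => (z t).1 - e.center, fun t => by ring⟩
  have hzt : ∀ t, z t = (e.center + φ t, (z t).2) := fun t => Prod.ext (hφ t) rfl
  have dφ : ∀ t, HasDerivAt φ (4 * (z t).2) t := fun t => by
    have h1 := (hasFDerivAt_fst.comp_hasDerivAt t (hz t)).sub_const e.center
    have h2 : φ = fun t => (z t).1 - e.center := funext fun t => by rw [hφ t]; ring
    rw [h2]
    refine h1.congr_deriv ?_
    exact deriv_KNu_snd μ (-h) _ _
  have dp : ∀ t, HasDerivAt (fun t => (z t).2)
      (-2 * Real.sin (φ t) * (a + h * Real.cos (φ t))) t := fun t => by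
    have h1 := hasFDerivAt_snd.comp_hasDerivAt t (hz t)
    refine h1.congr_deriv ?_
    rw [← deriv_KNu_center_add μ h e (φ t) (z t).2, ← hφ t]
    rfl
  have cφ : Continuous φ := continuous_iff_continuousAt.2 fun t => (dφ t).continuousAt
  have hb : ∀ t, |φ t| < Real.pi := fun t => by
    have := hcomp t; rwa [hφ t, add_sub_cancel_left] at this
  rw [hφ t, add_sub_cancel_left]
  -- Conservation of energy with the square completed in cos φ: h cos φ + a never enters the gap
  -- (-Y/4, Y/4).
  have hF : ∀ t, (Y / 4) ^ 2 ≤ (h * Real.cos (φ t) + a) ^ 2 := fun t => by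
    have h1 := hE t
    rw [hzt t, KNu_center_add] at h1
    have h2 : 0 ≤ h * (2 * (z t).2 ^ 2) := by positivity
    have h3 : 2 * (z t).2 ^ 2 = 2 * a * Real.cos (φ t) + h * Real.cos (φ t) ^ 2 - g := by
      rw [ha]; linarith
    rw [h3] at h2
    rw [hdisc]
    nlinarith
  have hF' : ∀ t, Y / 4 ≤ h * Real.cos (φ t) + a ∨ h * Real.cos (φ t) + a ≤ -(Y / 4) := fun t => by
    have := sq_le_sq.1 (hF t)
    rw [abs_of_pos (by linarith)] at this
    rcases le_abs.1 this with h | h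
    · exact Or.inl h
    · exact Or.inr (by linarith)
  by_contra hcon
  have cF : Continuous fun t => h * Real.cos (φ t) + a := by fun_prop
  -- A motion outside the well at one time stays outside, as a continuous function cannot jump the
  -- gap.
  have hneg : ∀ t, h * Real.cos (φ t) + a ≤ -(Y / 4) := fun u => by
    refine (hF' u).resolve_left fun hu => ?_
    obtain ⟨w, hw⟩ := mem_range_of_exists_le_of_exists_ge cF (c := 0)
      ⟨t, by have := (hF' t).resolve_left hcon; linarith⟩ ⟨u, by linarith⟩
    have := hF w
    simp only at hw
    rw [hw] at this
    nlinarith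
  have hne : ∀ t, φ t ≠ 0 := fun t h0 => by
    have := hneg t
    rw [h0, Real.cos_zero] at this
    linarith
  have hsign : (∀ t, 0 < φ t) ∨ ∀ t, φ t < 0 := by
    by_contra hcontra
    push Not at hcontra
    obtain ⟨⟨u, hu⟩, ⟨v, hv⟩⟩ := hcontra
    obtain ⟨w, hw⟩ := mem_range_of_exists_le_of_exists_ge cφ ⟨u, hu⟩ ⟨v, hv⟩
    exact hne w hw
  -- Outside the well the force points away from the center, so the momentum is strictly monotone
  -- and φ unbounded, against |φ| < π.
  rcases hsign with hs | hs
  · refine not_bounded_of_strictMono dφ (strictMono_of_deriv_pos fun t => ?_) hb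
    rw [(dp t).deriv]
    have h1 := Real.sin_pos_of_pos_of_lt_pi (hs t) (abs_lt.1 (hb t)).2
    have h2 := hneg t
    nlinarith
  · refine not_bounded_of_strictMono (φ := fun t => -φ t) (p := fun t => -(z t).2)
      (fun t => ((dφ t).neg).congr_deriv (by ring)) (strictMono_of_deriv_pos fun t => ?_)
      (M := Real.pi) (fun t => by rw [abs_neg]; exact hb t)
    rw [(dp t).fun_neg.deriv]
    have h1 := Real.sin_neg_of_neg_of_neg_pi_lt (hs t) (abs_lt.1 (hb t)).1
    have h2 := hneg t
    nlinarith

/-- Every motion on a level of `K_ν` in the component of `e` runs along the level curve. -/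
lemma exists_eq_nuOrbit (hh : 0 < h) (hp : OscParams κ X Y (h + 2 * massDiff μ e - g) (g + h)
    (h - 2 * massDiff μ e - g)) (hκ0 : 0 < κ) {z : ℝ → ℝ × ℝ}
    (hz : IsHamiltonianMotion (KNu μ (-h)) z) (hE : ∀ t, KNu μ (-h) (z t) = -g)
    (hcomp : ∀ t, |(z t).1 - e.center| < Real.pi) :
    ∃ s, ∀ t, z t = nuOrbit e κ X Y (angle X Y (t + s)) := by
  have hwell := le_of_motion_nu hh hp hκ0 hz hE hcomp 0
  obtain ⟨θ, hθ⟩ : ∃ θ, z 0 = nuOrbit e κ X Y θ := by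
    set a := massDiff μ e with ha
    have hA : 0 < h + 2 * a - g := by
      rw [← hp.amp_sq]; exact mul_pos (pow_pos hκ0 2) hp.X_pos
    obtain ⟨φ, hφ⟩ : ∃ φ, φ = (z 0).1 - e.center := ⟨_, rfl⟩
    set x := Real.tan (φ / 2) with hx
    have hb := abs_lt.1 (hcomp 0)
    rw [← hφ] at hb hwell
    have hat : 2 * Real.arctan x = φ := by
      rw [hx, Real.arctan_tan (by linarith) (by linarith)]; ring
    have hz0 : z 0 = (e.center + φ, (z 0).2) := Prod.ext (by rw [hφ]; ring) rfl
    have hc := cos_two_mul_arctan x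
    rw [hat] at hc
    have c : 1 + x ^ 2 ≠ 0 := by positivity
    have hE0 := hE 0
    rw [hz0, KNu_center_add, hc, ← ha] at hE0
    rw [hc] at hwell
    have hy : (2 * (z 0).2 * (1 + x ^ 2)) ^ 2 =
        2 * ((h + 2 * a - g) - 2 * (g + h) * x ^ 2 + (h - 2 * a - g) * x ^ 4) := by
      field_simp at hE0
      linear_combination 2 * hE0
    have hxκ : x ^ 2 ≤ κ ^ 2 := by
      have h1 : (h + 2 * a - g) * (h - 2 * a - g) = X * (X - Y) := by
        rw [← hp.top, ← hp.amp_sq]; ring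
      have hX := hp.X_pos
      have hY := hp.Y_pos
      have h2 : X = g + h + Y / 2 := by linarith [hp.mid]
      -- The well condition in terms of x, cleared of denominators; `hrel` identifies the resulting
      -- bound on x² with A/X = κ². The factorisation used for λ is not enough here, because Y ≥ X
      -- can fail and a second well appear.
      have hw : x ^ 2 * (h - a + Y / 4) ≤ h + a - Y / 4 := by
        have h3 : h * ((1 - x ^ 2) / (1 + x ^ 2)) + a - Y / 4 =
            ((h + a - Y / 4) - x ^ 2 * (h - a + Y / 4)) / (1 + x ^ 2) := by field_simp; ring
        have h4 : 0 ≤ ((h + a - Y / 4) - x ^ 2 * (h - a + Y / 4)) / (1 + x ^ 2) := by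
          rw [← h3]; linarith
        have h5 : 0 < 1 + x ^ 2 := by positivity
        have h6 := (le_div_iff₀ h5).1 h4
        linarith
      have hrel : X * (h + a - Y / 4) = (h + 2 * a - g) * (h - a + Y / 4) := by
        rw [h2] at h1 ⊢
        linear_combination (-1 / 2) * h1
      have hw2 : x ^ 2 * X * (h + a - Y / 4) ≤ (h + 2 * a - g) * (h + a - Y / 4) := by
        nlinarith
      have hd : (Y / 4) ^ 2 = g * h + a ^ 2 := by
        rw [h2] at h1
        linear_combination (1 / 4) * h1
      have hsq : (h + a - Y / 4) * (h + a + Y / 4) = h * (h + 2 * a - g) := by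
        linear_combination -hd
      have hpos : 0 < h + a - Y / 4 := by
        by_contra hneg
        push Not at hneg
        nlinarith [mul_pos hh hA]
      have hfin : x ^ 2 * X ≤ h + 2 * a - g := le_of_mul_le_mul_right hw2 hpos
      rw [← hp.amp_sq] at hfin
      exact le_of_mul_le_mul_right hfin hX
    obtain ⟨θ, e1, e2⟩ := hp.exists_angle hκ0 hxκ hy
    refine ⟨θ, ?_⟩
    rw [nuOrbit_eq, e1, e2, hat, hz0]
    refine Prod.ext rfl ?_
    simp only
    field_simp
  refine ⟨angTime X Y θ, fun t => ?_⟩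
  have hm := (isHamiltonianMotion_nuOrbit (e := e) hp).comp_add (angTime X Y θ)
  have := hz.eq (contDiff_KNu _ _) hm (t₀ := 0)
    (by simp only [zero_add, angle_angTime hp.X_pos hp.Y_pos]; exact hθ)
  exact congrFun this t

end nu

/-! ### Oscillation parameters on a level and satellite levels -/

/-- The parameter `X` of the oscillations on the level `(g, -h)`; `s = 1` for the
`lam`-oscillation, and `s = massDiff ^ 2` for the `ν`-oscillation. -/
noncomputable def levelX (s g h : ℝ) : ℝ := g + h + 2 * √(g * h + s)

/-- The parameter `Y` of the oscillations on the level `(g, -h)`. -/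
noncomputable def levelY (s g h : ℝ) : ℝ := 4 * √(g * h + s)

/-- The amplitude of the `lam`-oscillation. -/
noncomputable def ampLam (g h : ℝ) : ℝ := √((g + 2 - h) / levelX 1 g h)

/-- The amplitude of the `ν`-oscillation. -/
noncomputable def ampNu (a g h : ℝ) : ℝ := √((h + 2 * a - g) / levelX (a ^ 2) g h)

/-- The set of levels on which both oscillations have positive parameters. -/
def IsRegularLevel (a g h : ℝ) : Prop := 0 < h ∧ 0 < g * h + a ^ 2 ∧ 0 < levelX (a ^ 2) g h

section level

variable {a g h : ℝ}

lemma levelX_le {s t : ℝ} (hst : s ≤ t) : levelX s g h ≤ levelX t g h := by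
  have : √(g * h + s) ≤ √(g * h + t) := Real.sqrt_le_sqrt (by linarith)
  unfold levelX; linarith

lemma levelY_pos {s : ℝ} (hs : 0 < g * h + s) : 0 < levelY s g h :=
  mul_pos (by norm_num) (Real.sqrt_pos.2 hs)

lemma IsRegularLevel.levelX_one_pos (hr : IsRegularLevel a g h) (ha : a ^ 2 < 1) :
    0 < levelX 1 g h := hr.2.2.trans_le (levelX_le ha.le)

lemma IsRegularLevel.levelY_one_pos (hr : IsRegularLevel a g h) (ha : a ^ 2 < 1) :
    0 < levelY 1 g h := levelY_pos (by linarith [hr.2.1])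

lemma IsRegularLevel.levelY_pos (hr : IsRegularLevel a g h) :
    0 < levelY (a ^ 2) g h := EulerProblem.levelY_pos hr.2.1

/-- The bound on g is not strict: equality is the interior collision line, where the amplitude
vanishes. -/
lemma oscParams_lam (hr : IsRegularLevel a g h) (ha : a ^ 2 < 1) (h1 : h - 2 ≤ g) :
    OscParams (ampLam g h) (levelX 1 g h) (levelY 1 g h) (g + 2 - h) (g + h) (g - 2 - h) := by
  have hX := hr.levelX_one_pos ha
  have hA : 0 ≤ g + 2 - h := by linarith
  have hw := Real.sq_sqrt (show 0 ≤ g * h + 1 by linarith [hr.2.1])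
  have hκ : ampLam g h ^ 2 = (g + 2 - h) / levelX 1 g h := Real.sq_sqrt (div_nonneg hA hX.le)
  refine ⟨hX, hr.levelY_one_pos ha, Real.sqrt_nonneg _, ?_, ?_, ?_⟩
  · rw [hκ]; field_simp
  · unfold levelX levelY; ring
  · rw [hκ, mul_div_assoc', div_eq_iff hX.ne']
    unfold levelX levelY
    linear_combination 4 * hw

lemma oscParams_nu (hr : IsRegularLevel a g h) (h1 : g ≤ h + 2 * a) :
    OscParams (ampNu a g h) (levelX (a ^ 2) g h) (levelY (a ^ 2) g h) (h + 2 * a - g) (g + h)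
      (h - 2 * a - g) := by
  have hX := hr.2.2
  have hA : 0 ≤ h + 2 * a - g := by linarith
  have hw := Real.sq_sqrt hr.2.1.le
  have hκ : ampNu a g h ^ 2 = (h + 2 * a - g) / levelX (a ^ 2) g h :=
    Real.sq_sqrt (div_nonneg hA hX.le)
  refine ⟨hX, hr.levelY_pos, Real.sqrt_nonneg _, ?_, ?_, ?_⟩
  · rw [hκ]; field_simp
  · unfold levelX levelY; ring
  · rw [hκ, mul_div_assoc', div_eq_iff hX.ne']
    unfold levelX levelY
    linear_combination 4 * hw

lemma ampLam_pos (hr : IsRegularLevel a g h) (ha : a ^ 2 < 1) (h1 : h - 2 < g) :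
    0 < ampLam g h := Real.sqrt_pos.2 (div_pos (by linarith) (hr.levelX_one_pos ha))

lemma ampNu_pos (hr : IsRegularLevel a g h) (h1 : g < h + 2 * a) :
    0 < ampNu a g h := Real.sqrt_pos.2 (div_pos (by linarith) hr.2.2)

/-- Otherwise √(gh + 1) ≤ 1 - h, whence g ≤ h - 2, and A would be nonpositive while X is positive.
-/
lemma ampLam_lt_one (hr : IsRegularLevel a g h) (ha : a ^ 2 < 1) :
    ampLam g h < 1 := by
  have hX := hr.levelX_one_pos ha
  have h0 := hr.1
  rw [ampLam, Real.sqrt_lt' one_pos, one_pow, div_lt_one hX]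
  have hpos : 0 < g * h + 1 := by linarith [hr.2.1]
  have hw := Real.sq_sqrt hpos.le
  have hw0 := Real.sqrt_pos.2 hpos
  unfold levelX at *
  by_contra hcon
  push Not at hcon
  have h2 : √(g * h + 1) ≤ 1 - h := by linarith
  have h3 : h * g ≤ h * (h - 2) := by nlinarith
  have h4 : g ≤ h - 2 := le_of_mul_le_mul_left h3 h0
  linarith

/-- It suffices that (g - h)² ≤ 4, which holds between the two collision lines because |a| < 1. -/
lemma levelX_le_levelY (hr : IsRegularLevel a g h) (ha : a ^ 2 < 1) (h1 : h - 2 ≤ g)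
    (h2 : g ≤ h + 2 * a) : levelX 1 g h ≤ levelY 1 g h := by
  have ha1 := (abs_lt.1 ((sq_lt_one_iff_abs_lt_one a).1 ha)).2
  have hpos : 0 < g * h + 1 := by linarith [hr.2.1]
  have hw := Real.sq_sqrt hpos.le
  have hw0 := Real.sqrt_pos.2 hpos
  unfold levelX levelY
  have : g + h ≤ 2 * √(g * h + 1) := by
    by_contra hcon
    push Not at hcon
    nlinarith [mul_nonneg (sub_nonneg.2 h1) (by linarith : 0 ≤ h + 2 - g)]
  linarith

/-- The product form of the two boundary expressions of the `ν`-oscillation. -/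
lemma levelX_factor (hpos : 0 ≤ g * h + a ^ 2) :
    h * levelX (a ^ 2) g h = (h + a + √(g * h + a ^ 2)) * (h - a + √(g * h + a ^ 2)) ∧
    h * (h + 2 * a - g) = (h + a - √(g * h + a ^ 2)) * (h + a + √(g * h + a ^ 2)) := by
  have hw := Real.sq_sqrt hpos
  unfold levelX
  constructor
  · linear_combination -hw
  · linear_combination hw

lemma IsRegularLevel.sqrt_lt (hr : IsRegularLevel a g h) (h1 : g < h + 2 * a) :
    √(g * h + a ^ 2) < h + a ∧ a - h < √(g * h + a ^ 2) := by
  obtain ⟨e1, e2⟩ := levelX_factor hr.2.1.le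
  have p1 := mul_pos hr.1 hr.2.2
  have p2 := mul_pos hr.1 (sub_pos.2 h1)
  rw [e1] at p1
  rw [e2] at p2
  have hw0 := Real.sqrt_pos.2 hr.2.1
  have h0 := hr.1
  have h3 : 0 < h + a + √(g * h + a ^ 2) := by
    by_contra hcon
    push Not at hcon
    nlinarith
  have h4 := (pos_iff_pos_of_mul_pos p1).1 h3
  have h5 := (pos_iff_pos_of_mul_pos p2).2 h3
  constructor <;> linarith

end level

lemma massDiff_sq_lt_one {μ : ℝ} (h0 : 0 < μ) (h1 : μ < 1) (e : Primary) :
    massDiff μ e ^ 2 < 1 := by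
  cases e <;> simp only [massDiff, Primary.mass] <;> nlinarith

lemma momentumNuSq_center_add (μ g h φ : ℝ) (e : Primary) :
    momentumNuSq μ g (-h) (e.center + φ) =
      (h * Real.cos φ ^ 2 + 2 * massDiff μ e * Real.cos φ - g) / 2 := by
  rw [momentumNuSq, cos_center_add]
  linear_combination (-Real.cos φ) * mul_cos_center μ e
    + h * Real.cos φ ^ 2 / 2 * cos_center_sq e

/-- With v = cos(ν - center), ν is forbidden iff (hv + a)² < gh + a². That such v exists in [-1, 1]
is what the positivity of gh + a² and of `levelX` encodes. -/
lemma isSatelliteLevel_iff {μ g h : ℝ} {e : Primary} :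
    IsSatelliteLevel μ e g (-h) ↔
      IsRegularLevel (massDiff μ e) g h ∧ h - 2 < g ∧ g < h + 2 * massDiff μ e := by
  set a := massDiff μ e with ha
  have hl : momentumLamSq g (-h) 0 = (g + 2 - h) / 2 := by simp [momentumLamSq]; ring
  have hn : momentumNuSq μ g (-h) e.center = (h + 2 * a - g) / 2 := by
    have := momentumNuSq_center_add μ g h 0 e
    simpa using this
  have hex : (∃ ν, momentumNuSq μ g (-h) ν < 0) ↔
      ∃ v, -1 ≤ v ∧ v ≤ 1 ∧ h * v ^ 2 + 2 * a * v - g < 0 := by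
    constructor
    · rintro ⟨ν, hν⟩
      refine ⟨Real.cos (ν - e.center), Real.neg_one_le_cos _, Real.cos_le_one _, ?_⟩
      have := momentumNuSq_center_add μ g h (ν - e.center) e
      rw [add_sub_cancel] at this
      rw [this] at hν
      linarith
    · rintro ⟨v, h1, h2, h3⟩
      refine ⟨e.center + Real.arccos v, ?_⟩
      rw [momentumNuSq_center_add, Real.cos_arccos h1 h2]
      linarith
  rw [IsSatelliteLevel, hl, hn, hex]
  constructor
  · rintro ⟨h0, h1, h2, v, v1, v2, hv⟩
    have h0 : 0 < h := by linarith
    have hsq : (h * v + a) ^ 2 < g * h + a ^ 2 := by nlinarith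
    have hpos : 0 < g * h + a ^ 2 := (sq_nonneg _).trans_lt hsq
    have hw := Real.sq_lt.1 hsq
    obtain ⟨e1, e2⟩ := levelX_factor hpos.le
    have hA : 0 < h + 2 * a - g := by linarith
    have p2 := mul_pos h0 hA
    rw [e2] at p2
    refine ⟨⟨h0, hpos, ?_⟩, by linarith, by linarith⟩
    have h5 : 0 < h + a + √(g * h + a ^ 2) := by nlinarith
    have h6 : 0 < h - a + √(g * h + a ^ 2) := by nlinarith
    have := mul_pos h5 h6
    rw [← e1] at this
    exact pos_of_mul_pos_right this h0.le
  · rintro ⟨hr, h1, h2⟩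
    have h0 := hr.1
    have hw := Real.sq_sqrt hr.2.1.le
    have hw0 := Real.sqrt_pos.2 hr.2.1
    obtain ⟨h3, h4⟩ := hr.sqrt_lt h2
    refine ⟨by linarith, by linarith, by linarith, ?_⟩
    -- The witness minimises the quadratic in v over [-1, 1]: the vertex -a/h if it lies there, and
    -- the endpoint -1 otherwise.
    rcases le_total a h with hah | hah
    · refine ⟨-a / h, ?_, ?_, ?_⟩
      · rw [le_div_iff₀ h0]; linarith
      · rw [div_le_iff₀ h0]; linarith
      · have : h * (-a / h) ^ 2 + 2 * a * (-a / h) - g = -(g * h + a ^ 2) / h := by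
          field_simp; ring
        rw [this]
        exact div_neg_of_neg_of_pos (by linarith [hr.2.1]) h0
    · refine ⟨-1, le_rfl, by norm_num, ?_⟩
      have : h * (h * (-1) ^ 2 + 2 * a * (-1) - g) < h * 0 := by nlinarith
      exact lt_of_mul_lt_mul_left this h0.le

/-- The motions on the level `(g, -h)` around `e`, with phase shifts. -/
noncomputable def levelOrbit (μ : ℝ) (e : Primary) (g h s₁ s₂ : ℝ) (t : ℝ) : Phase :=
  (lamCurve (ampLam g h) (levelX 1 g h) (levelY 1 g h)
    (angle (levelX 1 g h) (levelY 1 g h) (t + s₁)),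
   nuOrbit e (ampNu (massDiff μ e) g h) (levelX (massDiff μ e ^ 2) g h)
    (levelY (massDiff μ e ^ 2) g h)
    (angle (levelX (massDiff μ e ^ 2) g h) (levelY (massDiff μ e ^ 2) g h) (t + s₂)))

section orbit

variable {μ g h : ℝ} {e : Primary}

lemma isOrbitOnLevel_levelOrbit (ha : massDiff μ e ^ 2 < 1)
    (hr : IsRegularLevel (massDiff μ e) g h) (h1 : h - 2 ≤ g) (h2 : g ≤ h + 2 * massDiff μ e)
    (s₁ s₂ : ℝ) : IsOrbitOnLevel μ e g (-h) (levelOrbit μ e g h s₁ s₂) := by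
  have pl := oscParams_lam hr ha h1
  have pn := oscParams_nu hr h2
  have hκ := ampLam_lt_one hr ha
  refine ⟨⟨(isHamiltonianMotion_lamCurve pl hκ).comp_add s₁,
    (isHamiltonianMotion_nuOrbit pn).comp_add s₂, fun t => ?_,
    fun t => abs_nuOrbit_sub_center _ _ _ _ _⟩, fun t => ?_⟩
  · rw [levelOrbit, KLam_lamCurve pl hκ, KNu_nuOrbit pn]; ring
  · rw [levelOrbit, KLam_lamCurve pl hκ]

lemma IsOrbitOnLevel.exists_eq (ha : massDiff μ e ^ 2 < 1)
    (hr : IsRegularLevel (massDiff μ e) g h) (h1 : h - 2 < g) (h2 : g < h + 2 * massDiff μ e)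
    {γ : ℝ → Phase} (hγ : IsOrbitOnLevel μ e g (-h) γ) :
    ∃ s₁ s₂, γ = levelOrbit μ e g h s₁ s₂ := by
  obtain ⟨s₁, hs₁⟩ := exists_eq_lamCurve (oscParams_lam hr ha h1.le) (ampLam_pos hr ha h1)
    (ampLam_lt_one hr ha) (levelX_le_levelY hr ha h1.le h2.le) hγ.1.motion_lam (hγ.2 0)
  obtain ⟨s₂, hs₂⟩ := exists_eq_nuOrbit hr.1 (oscParams_nu hr h2.le) (ampNu_pos hr h2)
    hγ.1.motion_nu (fun t => by have := hγ.1.energy t; rw [hγ.2 t] at this; linarith)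
    hγ.1.component
  exact ⟨s₁, s₂, funext fun t => Prod.ext (hs₁ t) (hs₂ t)⟩

end orbit

/-! ### Periods in the double cover and in the quotient -/

lemma neg_one_zpow_cases (n : ℤ) : (-1 : ℝ) ^ n = 1 ∨ (-1 : ℝ) ^ n = -1 := by
  rcases n.even_or_odd with h | h
  · exact Or.inl h.neg_one_zpow
  · exact Or.inr h.neg_one_zpow

/-- Half a turn of the angle acts as the λ-part of the involution; this is the source of the parity
rule for the coverings. -/
lemma lamCurve_add_int_mul_pi (κ X Y θ : ℝ) (n : ℤ) :
    lamCurve κ X Y (θ + n * Real.pi) = ((-1 : ℝ) ^ n) • lamCurve κ X Y θ := by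
  rw [lamCurve, osc_add_int_mul_pi, oscVel_add_int_mul_pi, lamCurve]
  rcases neg_one_zpow_cases n with h | h <;> simp only [h]
  · simp
  · refine Prod.ext ?_ ?_
    · simp only [Prod.smul_mk, smul_eq_mul]
      rw [show 1 + -1 * osc κ θ = 1 - osc κ θ by ring,
        show 1 - -1 * osc κ θ = 1 + osc κ θ by ring]
      ring
    · simp [neg_div]

lemma nuCurve_add_int_mul_pi (κ X Y θ : ℝ) (n : ℤ) :
    nuCurve κ X Y (θ + n * Real.pi) = ((-1 : ℝ) ^ n) • nuCurve κ X Y θ := by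
  rw [nuCurve, osc_add_int_mul_pi, oscVel_add_int_mul_pi, nuCurve]
  rcases neg_one_zpow_cases n with h | h <;> simp only [h]
  · simp
  · refine Prod.ext ?_ ?_
    · simp [Real.arctan_neg]
    · simp [neg_div]

lemma exists_int_of_lamCurve_eq {κ X Y θ θ' ε : ℝ} (hκ0 : 0 < κ) (hκ : κ < 1) (hX : 0 < X)
    (hY : 0 < Y) (hε : ε = 1 ∨ ε = -1) (h : lamCurve κ X Y θ' = ε • lamCurve κ X Y θ) :
    ∃ n : ℤ, θ' = θ + n * Real.pi ∧ (-1 : ℝ) ^ n = ε := by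
  have hosc : ∀ θ, osc κ θ =
      Real.sinh (lamCurve κ X Y θ).1 / (1 + Real.cosh (lamCurve κ X Y θ).1) := fun θ => by
    obtain ⟨h1, h2⟩ := abs_osc_lt_one hκ0.le hκ θ
    obtain ⟨e1, e2⟩ := cosh_log_sub h1 h2
    have c : 1 - osc κ θ ^ 2 ≠ 0 := by nlinarith
    rw [lamCurve, e1, e2]
    field_simp
    ring
  have hvel : ∀ θ, oscVel κ X Y θ = (lamCurve κ X Y θ).2 * (2 * (1 - osc κ θ ^ 2)) := fun θ => by
    obtain ⟨h1, h2⟩ := abs_osc_lt_one hκ0.le hκ θ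
    have c : 1 - osc κ θ ^ 2 ≠ 0 := by nlinarith
    rw [lamCurve]
    field_simp
  have e : osc κ θ' = ε * osc κ θ := by
    rw [hosc, h, hosc θ]
    rcases hε with rfl | rfl
    · simp
    · simp [neg_div]
  refine exists_int_of_osc_eq hκ0 hX hY hε e ?_
  rw [hvel, h, hvel θ, e, mul_pow]
  have : ε ^ 2 = 1 := by rcases hε with rfl | rfl <;> norm_num
  rw [this, one_mul, Prod.smul_snd, smul_eq_mul, mul_assoc]

lemma exists_int_of_nuCurve_eq {κ X Y θ θ' ε : ℝ} (hκ0 : 0 < κ) (hX : 0 < X)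
    (hY : 0 < Y) (hε : ε = 1 ∨ ε = -1) (h : nuCurve κ X Y θ' = ε • nuCurve κ X Y θ) :
    ∃ n : ℤ, θ' = θ + n * Real.pi ∧ (-1 : ℝ) ^ n = ε := by
  have hosc : ∀ θ, osc κ θ = Real.tan ((nuCurve κ X Y θ).1 / 2) := fun θ => by
    rw [nuCurve, mul_div_cancel_left₀ _ two_ne_zero, Real.tan_arctan]
  have hvel : ∀ θ, oscVel κ X Y θ = (nuCurve κ X Y θ).2 * (2 * (1 + osc κ θ ^ 2)) := fun θ => by
    have c : 1 + osc κ θ ^ 2 ≠ 0 := by positivity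
    rw [nuCurve]
    field_simp
  have e : osc κ θ' = ε * osc κ θ := by
    rw [hosc, h, hosc θ]
    rcases hε with rfl | rfl
    · simp
    · simp [neg_div]
  refine exists_int_of_osc_eq hκ0 hX hY hε e ?_
  rw [hvel, h, hvel θ, e, mul_pow]
  have : ε ^ 2 = 1 := by rcases hε with rfl | rfl <;> norm_num
  rw [this, one_mul, Prod.smul_snd, smul_eq_mul, mul_assoc]

lemma abs_nuCurve_lt (κ X Y θ : ℝ) : |(nuCurve κ X Y θ).1| < Real.pi := by
  rw [nuCurve, abs_lt]
  have h1 := Real.neg_pi_div_two_lt_arctan (osc κ θ)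
  have h2 := Real.arctan_lt_pi_div_two (osc κ θ)
  constructor <;> simp only <;> linarith

/-- Therefore the involution about ν = 0 is also, modulo 2π, the reflection about the center of e.
-/
lemma exists_int_two_mul_center (e : Primary) : ∃ m : ℤ, 2 * e.center = 2 * Real.pi * m := by
  cases e
  · exact ⟨-1, by simp [Primary.center]⟩
  · exact ⟨0, by simp [Primary.center]⟩

/-- Points in the component of `e` represent the same point of the regularized phase space iff
they agree or are antipodal with respect to the center. -/
lemma samePoint_iff {e : Primary} {x x' u u' : ℝ × ℝ} (hu : |u.1| < Real.pi)
    (hu' : |u'.1| < Real.pi) :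
    SamePoint (x', (e.center, 0) + u') (x, (e.center, 0) + u) ↔
      ∃ ε : ℝ, (ε = 1 ∨ ε = -1) ∧ x' = ε • x ∧ u' = ε • u := by
  obtain ⟨m, hm⟩ := exists_int_two_mul_center e
  obtain ⟨x₁, x₂⟩ := x
  obtain ⟨y₁, y₂⟩ := x'
  obtain ⟨u₁, u₂⟩ := u
  obtain ⟨v₁, v₂⟩ := u'
  simp only [SamePoint, Prod.mk_add_mk, Prod.neg_mk, Prod.mk.injEq, Prod.smul_mk, smul_eq_mul,
    add_zero, zero_add] at *
  rw [abs_lt] at hu hu'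
  have hpi := Real.pi_pos
  have small : ∀ n : ℤ, ∀ r : ℝ, r = 2 * Real.pi * n → -(2 * Real.pi) < r → r < 2 * Real.pi →
      r = 0 := by
    intro n r hr h1 h2
    rw [hr] at h1 h2
    have h3 : (-1 : ℝ) < n := by nlinarith
    have h4 : (n : ℝ) < 1 := by nlinarith
    have h5 : -1 < n := by exact_mod_cast h3
    have h6 : n < 1 := by exact_mod_cast h4
    have : n = 0 := by omega
    rw [hr, this]; simp
  constructor
  · rintro ⟨n, ⟨⟨h1, h2⟩, h3, h4⟩ | ⟨⟨h1, h2⟩, h3, h4⟩⟩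
    · have := small n (u₁ - v₁) (by linarith) (by linarith) (by linarith)
      exact ⟨1, Or.inl rfl, ⟨by linarith, by linarith⟩, by linarith, by linarith⟩
    · have := small (n - m) (u₁ + v₁) (by push_cast; linarith) (by linarith) (by linarith)
      exact ⟨-1, Or.inr rfl, ⟨by linarith, by linarith⟩, by linarith, by linarith⟩
  · rintro ⟨ε, rfl | rfl, ⟨h1, h2⟩, h3, h4⟩
    · refine ⟨0, Or.inl ⟨⟨?_, ?_⟩, ?_, ?_⟩⟩ <;> push_cast <;> linarith
    · exact ⟨m, Or.inr ⟨⟨by linarith, by linarith⟩, by linarith, by linarith⟩⟩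

/-- The half period of the `lam`-oscillation on the level `(g, -h)`. -/
noncomputable def halfLam (g h : ℝ) : ℝ := halfPeriod (levelX 1 g h) (levelY 1 g h)

/-- The half period of the `ν`-oscillation on the level `(g, -h)`. -/
noncomputable def halfNu (a g h : ℝ) : ℝ := halfPeriod (levelX (a ^ 2) g h) (levelY (a ^ 2) g h)

section period

variable {μ g h : ℝ} {e : Primary} {s₁ s₂ : ℝ}

lemma levelOrbit_add_fst (ha : massDiff μ e ^ 2 < 1)
    (hr : IsRegularLevel (massDiff μ e) g h) (t : ℝ) (n : ℤ) :
    (levelOrbit μ e g h s₁ s₂ (t + n * halfLam g h)).1 =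
      ((-1 : ℝ) ^ n) • (levelOrbit μ e g h s₁ s₂ t).1 := by
  simp only [levelOrbit]
  rw [show t + n * halfLam g h + s₁ = t + s₁ + n * halfLam g h by ring, halfLam,
    angle_add_int_mul (hr.levelX_one_pos ha) (hr.levelY_one_pos ha), lamCurve_add_int_mul_pi]

/-- The `ν`-part of `levelOrbit`, relative to the center. -/
noncomputable def levelNu (μ : ℝ) (e : Primary) (g h s₂ t : ℝ) : ℝ × ℝ :=
  nuCurve (ampNu (massDiff μ e) g h) (levelX (massDiff μ e ^ 2) g h)
    (levelY (massDiff μ e ^ 2) g h)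
    (angle (levelX (massDiff μ e ^ 2) g h) (levelY (massDiff μ e ^ 2) g h) (t + s₂))

lemma levelOrbit_snd (t : ℝ) :
    (levelOrbit μ e g h s₁ s₂ t).2 = (e.center, 0) + levelNu μ e g h s₂ t := rfl

lemma levelNu_add (hr : IsRegularLevel (massDiff μ e) g h) (t : ℝ) (n : ℤ) :
    levelNu μ e g h s₂ (t + n * halfNu (massDiff μ e) g h) =
      ((-1 : ℝ) ^ n) • levelNu μ e g h s₂ t := by
  simp only [levelNu]
  rw [show t + n * halfNu (massDiff μ e) g h + s₂ = t + s₂ + n * halfNu (massDiff μ e) g h by ring,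
    halfNu, angle_add_int_mul hr.2.2 hr.levelY_pos, nuCurve_add_int_mul_pi]

lemma exists_int_of_levelOrbit_fst (ha : massDiff μ e ^ 2 < 1)
    (hr : IsRegularLevel (massDiff μ e) g h) (h1 : h - 2 < g) {S t ε : ℝ} (hε : ε = 1 ∨ ε = -1)
    (heq : (levelOrbit μ e g h s₁ s₂ (t + S)).1 = ε • (levelOrbit μ e g h s₁ s₂ t).1) :
    ∃ n : ℤ, S = n * halfLam g h ∧ (-1 : ℝ) ^ n = ε := by
  obtain ⟨n, hn, hn'⟩ := exists_int_of_lamCurve_eq (ampLam_pos hr ha h1)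
    (ampLam_lt_one hr ha) (hr.levelX_one_pos ha) (hr.levelY_one_pos ha) hε heq
  rw [show t + S + s₁ = t + s₁ + S by ring] at hn
  exact ⟨n, eq_int_mul_halfPeriod (hr.levelX_one_pos ha) (hr.levelY_one_pos ha) hn, hn'⟩

lemma exists_int_of_levelNu (hr : IsRegularLevel (massDiff μ e) g h)
    (h2 : g < h + 2 * massDiff μ e) {S t ε : ℝ} (hε : ε = 1 ∨ ε = -1)
    (heq : levelNu μ e g h s₂ (t + S) = ε • levelNu μ e g h s₂ t) :
    ∃ n : ℤ, S = n * halfNu (massDiff μ e) g h ∧ (-1 : ℝ) ^ n = ε := by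
  obtain ⟨n, hn, hn'⟩ := exists_int_of_nuCurve_eq (ampNu_pos hr h2) hr.2.2 hr.levelY_pos hε heq
  rw [show t + S + s₂ = t + s₂ + S by ring] at hn
  exact ⟨n, eq_int_mul_halfPeriod hr.2.2 hr.levelY_pos hn, hn'⟩

lemma halfLam_pos {a : ℝ} (ha : a ^ 2 < 1) (hr : IsRegularLevel a g h) : 0 < halfLam g h :=
  halfPeriod_pos (hr.levelX_one_pos ha) (hr.levelY_one_pos ha)

lemma halfNu_pos {a : ℝ} (hr : IsRegularLevel a g h) : 0 < halfNu a g h :=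
  halfPeriod_pos hr.2.2 hr.levelY_pos

lemma samePoint_levelOrbit_iff (t t' : ℝ) :
    SamePoint (levelOrbit μ e g h s₁ s₂ t') (levelOrbit μ e g h s₁ s₂ t) ↔
      ∃ ε : ℝ, (ε = 1 ∨ ε = -1) ∧
        (levelOrbit μ e g h s₁ s₂ t').1 = ε • (levelOrbit μ e g h s₁ s₂ t).1 ∧
        levelNu μ e g h s₂ t' = ε • levelNu μ e g h s₂ t :=
  samePoint_iff (abs_nuCurve_lt _ _ _ _) (abs_nuCurve_lt _ _ _ _)

lemma two_le_of_even {n : ℤ} {S H : ℝ} (hH : 0 < H) (hS : 0 < S) (h : S = n * H)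
    (hn : (-1 : ℝ) ^ n = 1) : 2 * H ≤ S := by
  have h0 : 0 < n := by
    rw [h] at hS
    exact_mod_cast pos_of_mul_pos_left hS hH.le
  have heven : Even n := by
    by_contra hodd
    rw [Int.not_even_iff_odd] at hodd
    rw [hodd.neg_one_zpow] at hn
    norm_num at hn
  have h2 : 2 ≤ n := by
    obtain ⟨m, rfl⟩ := heven
    omega
  rw [h]
  have : (2 : ℝ) ≤ n := by exact_mod_cast h2
  nlinarith

lemma isLeastPeriod_lam (ha : massDiff μ e ^ 2 < 1)
    (hr : IsRegularLevel (massDiff μ e) g h) (h1 : h - 2 < g) :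
    IsLeastPeriod (fun t => (levelOrbit μ e g h s₁ s₂ t).1) (2 * halfLam g h) := by
  have hH := halfLam_pos ha hr
  refine ⟨by linarith, fun t => ?_, fun S hS hper => ?_⟩
  · have := levelOrbit_add_fst (s₁ := s₁) (s₂ := s₂) ha hr t 2
    simpa using this
  · obtain ⟨n, hn, hn'⟩ := exists_int_of_levelOrbit_fst (t := 0) (ε := 1) ha hr h1 (Or.inl rfl)
      ((hper 0).trans (one_smul _ _).symm)
    exact two_le_of_even hH hS hn hn'

lemma isLeastPeriod_nu (hr : IsRegularLevel (massDiff μ e) g h)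
    (h2 : g < h + 2 * massDiff μ e) :
    IsLeastPeriod (fun t => (levelOrbit μ e g h s₁ s₂ t).2) (2 * halfNu (massDiff μ e) g h) := by
  have hH := halfNu_pos hr
  simp only [levelOrbit_snd]
  refine ⟨by linarith, fun t => ?_, fun S hS hper => ?_⟩
  · have := levelNu_add (s₂ := s₂) hr t 2
    simp only [Int.cast_ofNat] at this
    simp only [this]
    simp
  · obtain ⟨n, hn, hn'⟩ := exists_int_of_levelNu (t := 0) (ε := 1) hr h2 (Or.inl rfl)
      ((add_left_cancel (hper 0)).trans (one_smul _ _).symm)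
    exact two_le_of_even hH hS hn hn'

lemma IsLeastPeriod.unique {α : Type*} {f : ℝ → α} {S T : ℝ} (hS : IsLeastPeriod f S)
    (hT : IsLeastPeriod f T) : S = T :=
  le_antisymm (hS.2.2 T hT.1 hT.2.1) (hT.2.2 S hS.1 hS.2.1)

/-- A level carries a `T_{k,l}`-torus iff it is a satellite level with period ratio `k / l`. -/
lemma isTklTorus_iff (ha : massDiff μ e ^ 2 < 1) {k l : ℕ} :
    IsTklTorus μ e k l g (-h) ↔
      (IsRegularLevel (massDiff μ e) g h ∧ h - 2 < g ∧ g < h + 2 * massDiff μ e) ∧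
        halfNu (massDiff μ e) g h / halfLam g h = k / l := by
  rw [IsTklTorus, isSatelliteLevel_iff]
  refine and_congr_right fun ⟨hr, h1, h2⟩ => ?_
  have horb := isOrbitOnLevel_levelOrbit ha hr h1.le h2.le 0 0
  constructor
  · rintro ⟨-, Tl, Tn, hT, hall⟩
    obtain ⟨p1, p2⟩ := hall _ horb
    rw [p1.unique (isLeastPeriod_lam ha hr h1), p2.unique (isLeastPeriod_nu hr h2),
      mul_div_mul_left _ _ two_ne_zero] at hT
    exact hT
  · intro hT
    refine ⟨⟨_, horb⟩, 2 * halfLam g h, 2 * halfNu (massDiff μ e) g h, ?_, fun γ hγ => ?_⟩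
    · rw [mul_div_mul_left _ _ two_ne_zero, hT]
    · obtain ⟨s₁, s₂, rfl⟩ := hγ.exists_eq ha hr h1 h2
      exact ⟨isLeastPeriod_lam ha hr h1, isLeastPeriod_nu hr h2⟩

/-- The multiplicity of a `T_{k,l}`-orbit over a collision orbit with winding number `n`. -/
def coverMult (k l n : ℕ) : ℕ := if Even (k + l) then n else 2 * n

/-- The least period of the orbits on a `T_{k,l}`-torus in the regularized phase space. -/
lemma isOrbitPeriod_levelOrbit (ha : massDiff μ e ^ 2 < 1)
    (hr : IsRegularLevel (massDiff μ e) g h) (h1 : h - 2 < g) (h2 : g < h + 2 * massDiff μ e)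
    {k l : ℕ} (hk : 0 < k) (hl : 0 < l) (hkl : Nat.Coprime k l)
    (hratio : halfNu (massDiff μ e) g h / halfLam g h = k / l) :
    IsOrbitPeriod (levelOrbit μ e g h s₁ s₂) (coverMult k l k * halfLam g h) ∧
      (coverMult k l k : ℝ) * halfLam g h = coverMult k l l * halfNu (massDiff μ e) g h := by
  have hH := halfLam_pos ha hr
  have hN := halfNu_pos hr
  have hl' : (0 : ℝ) < l := by exact_mod_cast hl
  have hk' : (0 : ℝ) < k := by exact_mod_cast hk
  rw [div_eq_div_iff hH.ne' hl'.ne'] at hratio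
  have heq : (coverMult k l k : ℝ) * halfLam g h =
      coverMult k l l * halfNu (massDiff μ e) g h := by
    unfold coverMult
    split_ifs
    · linarith
    · push_cast; linarith
  refine ⟨⟨?_, fun t => ?_, fun S hS hper => ?_⟩, heq⟩
  · refine mul_pos ?_ hH
    unfold coverMult
    split_ifs <;> push_cast <;> linarith
  · rw [samePoint_levelOrbit_iff]
    refine ⟨(-1) ^ (coverMult k l k : ℤ), neg_one_zpow_cases _, ?_, ?_⟩
    · exact_mod_cast levelOrbit_add_fst ha hr t (coverMult k l k : ℤ)
    · have hpar : (-1 : ℝ) ^ (coverMult k l k : ℤ) = (-1 : ℝ) ^ (coverMult k l l : ℤ) := by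
        rw [zpow_natCast, zpow_natCast]
        unfold coverMult
        split_ifs with hev
        · rcases Nat.even_or_odd k with hk | hk
          · have hl : Even l := (Nat.even_add.1 hev).1 hk
            rw [hk.neg_one_pow, hl.neg_one_pow]
          · have hl : Odd l := by
              rw [← Nat.not_even_iff_odd] at hk ⊢
              exact fun hl => hk ((Nat.even_add.1 hev).2 hl)
            rw [hk.neg_one_pow, hl.neg_one_pow]
        · simp
      rw [hpar, heq]
      exact_mod_cast levelNu_add hr t (coverMult k l l : ℤ)
  · obtain ⟨ε, hε, e1, e2⟩ := (samePoint_levelOrbit_iff _ _).1 (hper 0)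
    obtain ⟨n, hn, hn'⟩ := exists_int_of_levelOrbit_fst ha hr h1 hε e1
    obtain ⟨m, hm, hm'⟩ := exists_int_of_levelNu hr h2 hε e2
    -- Minimality: S is n half periods of λ and m of ν, so nl = mk, and coprimality gives (n, m) =
    -- q(k, l).
    have hnm : (n : ℝ) * l = m * k := by
      have h3 : (n : ℝ) * halfLam g h = m * halfNu (massDiff μ e) g h := by rw [← hn, hm]
      have h4 : halfLam g h * (n * l) = halfLam g h * (m * k) := by
        linear_combination (l : ℝ) * h3 + m * hratio
      exact mul_left_cancel₀ hH.ne' h4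
    have hnm' : n * l = m * k := by exact_mod_cast hnm
    have hdvd : (k : ℤ) ∣ n := by
      have : (k : ℤ) ∣ n * l := ⟨m, by rw [hnm']; ring⟩
      exact (Int.isCoprime_iff_gcd_eq_one.2 (by simpa using hkl)).dvd_of_dvd_mul_right this
    obtain ⟨q, rfl⟩ := hdvd
    have hm2 : m = l * q := by
      have hk0 : (k : ℤ) ≠ 0 := by exact_mod_cast hk.ne'
      apply mul_right_cancel₀ hk0
      rw [← hnm']; ring
    have hnpos : 0 < (k : ℤ) * q := by
      rw [hn] at hS
      exact_mod_cast pos_of_mul_pos_left hS hH.le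
    have hq : 0 < q := pos_of_mul_pos_right hnpos (by positivity)
    have hle : (coverMult k l k : ℤ) ≤ k * q := by
      unfold coverMult
      split_ifs with hev
      · nlinarith
      -- Equal signs make q(k + l) even, so q is even when k + l is odd.
      · have hq2 : Even q := by
          have h3 : (-1 : ℝ) ^ ((k : ℤ) * q + m) = 1 := by
            rw [zpow_add₀ (by norm_num), hn', hm']
            rcases hε with rfl | rfl <;> norm_num
          have h4 : Even ((k : ℤ) * q + m) := by
            by_contra hodd
            rw [Int.not_even_iff_odd] at hodd
            rw [hodd.neg_one_zpow] at h3
            norm_num at h3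
          rw [hm2, ← add_mul, Int.even_mul] at h4
          exact h4.resolve_left (by exact_mod_cast hev)
        have : 2 ≤ q := by
          obtain ⟨r, rfl⟩ := hq2
          omega
        push_cast
        nlinarith
    rw [hn]
    exact mul_le_mul_of_nonneg_right (by exact_mod_cast hle) hH.le

lemma int_one_le_of_pos {n : ℤ} {S H : ℝ} (hH : 0 < H) (hS : 0 < S) (h : S = n * H) : H ≤ S := by
  have h0 : 0 < n := by
    rw [h] at hS
    exact_mod_cast pos_of_mul_pos_left hS hH.le
  have : (1 : ℝ) ≤ n := by exact_mod_cast h0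
  rw [h]
  nlinarith

lemma lamCurve_zero (X Y θ : ℝ) : lamCurve 0 X Y θ = 0 := by simp [lamCurve, osc, oscVel]

lemma nuCurve_zero (X Y θ : ℝ) : nuCurve 0 X Y θ = 0 := by simp [nuCurve, osc, oscVel]

/-- The λ-part vanishes identically and is blind to the sign, so a single half period of ν closes
the orbit in the quotient. -/
lemma isOrbitPeriod_interior (hr : IsRegularLevel (massDiff μ e) g h) (h1 : g = h - 2)
    (h2 : g < h + 2 * massDiff μ e) :
    IsOrbitPeriod (levelOrbit μ e g h s₁ s₂) (halfNu (massDiff μ e) g h) := by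
  have hN := halfNu_pos hr
  have h0 : ∀ t, (levelOrbit μ e g h s₁ s₂ t).1 = 0 := fun t => by
    have : ampLam g h = 0 := by simp [ampLam, h1]
    simp only [levelOrbit, this, lamCurve_zero]
  refine ⟨hN, fun t => ?_, fun S hS hper => ?_⟩
  · rw [samePoint_levelOrbit_iff]
    refine ⟨-1, Or.inr rfl, by rw [h0, h0, smul_zero], ?_⟩
    simpa using levelNu_add (s₂ := s₂) hr t 1
  · obtain ⟨ε, hε, -, e2⟩ := (samePoint_levelOrbit_iff _ _).1 (hper 0)
    obtain ⟨m, hm, -⟩ := exists_int_of_levelNu hr h2 hε e2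
    exact int_one_le_of_pos hN hS hm

lemma isOrbitPeriod_exterior (ha : massDiff μ e ^ 2 < 1)
    (hr : IsRegularLevel (massDiff μ e) g h) (h1 : h - 2 < g)
    (h2 : g = h + 2 * massDiff μ e) :
    IsOrbitPeriod (levelOrbit μ e g h s₁ s₂) (halfLam g h) := by
  have hN := halfLam_pos ha hr
  have h0 : ∀ t, levelNu μ e g h s₂ t = 0 := fun t => by
    have : ampNu (massDiff μ e) g h = 0 := by simp [ampNu, h2]
    simp only [levelNu, this, nuCurve_zero]
  refine ⟨hN, fun t => ?_, fun S hS hper => ?_⟩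
  · rw [samePoint_levelOrbit_iff]
    refine ⟨-1, Or.inr rfl, ?_, by rw [h0, h0, smul_zero]⟩
    simpa using levelOrbit_add_fst (s₁ := s₁) (s₂ := s₂) ha hr t 1
  · obtain ⟨ε, hε, e1, -⟩ := (samePoint_levelOrbit_iff _ _).1 (hper 0)
    obtain ⟨m, hm, -⟩ := exists_int_of_levelOrbit_fst ha hr h1 hε e1
    exact int_one_le_of_pos hN hS hm

lemma isInteriorCollisionOrbit_levelOrbit (ha : massDiff μ e ^ 2 < 1)
    (hr : IsRegularLevel (massDiff μ e) g h) (h1 : g = h - 2)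
    (h2 : g ≤ h + 2 * massDiff μ e) :
    IsInteriorCollisionOrbit μ e (-h) (levelOrbit μ e g h s₁ s₂) := by
  refine ⟨(isOrbitOnLevel_levelOrbit ha hr h1.ge h2 s₁ s₂).1, fun t => ?_⟩
  have h0 : (levelOrbit μ e g h s₁ s₂ t).1 = 0 := by
    have : ampLam g h = 0 := by simp [ampLam, h1]
    simp only [levelOrbit, this, lamCurve_zero]
  simp only [position, h0]
  refine ⟨by simp, ?_⟩
  simp only [Prod.fst_zero, Real.cosh_zero, one_mul, abs_div, abs_two]
  linarith [Real.abs_cos_le_one (levelOrbit μ e g h s₁ s₂ t).2.1]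

lemma isExteriorCollisionOrbit_levelOrbit (ha : massDiff μ e ^ 2 < 1)
    (hr : IsRegularLevel (massDiff μ e) g h) (h1 : h - 2 ≤ g)
    (h2 : g = h + 2 * massDiff μ e) :
    IsExteriorCollisionOrbit μ e (-h) (levelOrbit μ e g h s₁ s₂) := by
  refine ⟨(isOrbitOnLevel_levelOrbit ha hr h1 h2.le s₁ s₂).1, fun t => ?_⟩
  have h0 : levelNu μ e g h s₂ t = 0 := by
    have : ampNu (massDiff μ e) g h = 0 := by simp [ampNu, h2]
    simp only [levelNu, this, nuCurve_zero]
  have h3 : (levelOrbit μ e g h s₁ s₂ t).2.1 = e.center := by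
    rw [levelOrbit_snd, h0]; simp
  simp only [position, h3, sin_center]
  refine ⟨by simp, ?_⟩
  have hc : |Real.cos e.center| = 1 := by
    rw [← sq_eq_sq₀ (abs_nonneg _) zero_le_one, sq_abs, cos_center_sq, one_pow]
  rw [abs_div, abs_mul, hc, abs_two, mul_one]
  have := Real.one_le_cosh (levelOrbit μ e g h s₁ s₂ t).1.1
  rw [abs_of_pos (by linarith)]
  linarith

end period

/-! ### Monotonicity and continuity of the period ratio -/

/-- The period ratio `T_ν / T_lam` on the level `(g, -h)`. -/
noncomputable def ratio (a g h : ℝ) : ℝ := halfNu a g h / halfLam g h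

section monotone

variable {a g h : ℝ}

lemma IsRegularLevel.mono (hr : IsRegularLevel a g h) {g' : ℝ} (hg : g ≤ g') :
    IsRegularLevel a g' h := by
  have h1 : g * h ≤ g' * h := mul_le_mul_of_nonneg_right hg hr.1.le
  have h2 : √(g * h + a ^ 2) ≤ √(g' * h + a ^ 2) := Real.sqrt_le_sqrt (by linarith)
  refine ⟨hr.1, by linarith [hr.2.1], hr.2.2.trans_le ?_⟩
  unfold levelX
  linarith

/-- Strict concavity of the square root: raising g increases D more for the ν-motion than for the
λ-motion. -/
lemma sqrt_add_sub_sqrt_lt {p q d : ℝ} (hp : 0 < p) (hpq : p < q) (hd : 0 < d) :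
    √(q + d) - √q < √(p + d) - √p := by
  have e1 := Real.sq_sqrt hp.le
  have e2 := Real.sq_sqrt (hp.trans hpq).le
  have e3 := Real.sq_sqrt (add_pos hp hd).le
  have e4 := Real.sq_sqrt (add_pos (hp.trans hpq) hd).le
  have l1 := Real.sqrt_lt_sqrt hp.le hpq
  have l2 : √(p + d) < √(q + d) := Real.sqrt_lt_sqrt (by linarith) (by linarith)
  have l3 : √p < √(p + d) := Real.sqrt_lt_sqrt hp.le (by linarith)
  have p1 := Real.sqrt_pos.2 hp
  by_contra hcon
  push Not at hcon
  nlinarith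

/-- The period ratio is strictly decreasing in `g`. -/
lemma ratio_lt_ratio (ha : a ^ 2 < 1) (hr : IsRegularLevel a g h) {g' : ℝ} (hg : g < g') :
    ratio a g' h < ratio a g h := by
  have hr' := hr.mono hg.le
  have h0 := hr.1
  have hgh : 0 < (g' - g) * h := mul_pos (by linarith) h0
  have hc := sqrt_add_sub_sqrt_lt (p := g * h + a ^ 2) (q := g * h + 1) hr.2.1 (by linarith) hgh
  rw [show g * h + 1 + (g' - g) * h = g' * h + 1 by ring,
    show g * h + a ^ 2 + (g' - g) * h = g' * h + a ^ 2 by ring] at hc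
  -- Index 1 is the ν-motion, index 2 the λ-motion; primes refer to the larger level g'.
  have key := halfPeriod_mul_lt (B := g + h) (B' := g' + h) (D₁ := 2 * √(g * h + a ^ 2))
    (D₁' := 2 * √(g' * h + a ^ 2)) (D₂ := 2 * √(g * h + 1)) (D₂' := 2 * √(g' * h + 1))
    (by linarith) (mul_pos two_pos (Real.sqrt_pos.2 hr.2.1)) hr.2.2
    (mul_lt_mul_of_pos_left (Real.sqrt_lt_sqrt hr.2.1.le (by linarith)) two_pos)
    (by linarith) (mul_le_mul_of_nonneg_left (Real.sqrt_le_sqrt (by linarith)) zero_le_two)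
  have e : ∀ w : ℝ, 2 * (2 * w) = 4 * w := fun w => by ring
  simp only [e] at key
  rw [ratio, ratio, div_lt_div_iff₀ (halfLam_pos ha hr') (halfLam_pos ha hr)]
  exact key

lemma continuous_levelX (s : ℝ) : Continuous fun p : ℝ × ℝ => levelX s p.1 p.2 := by
  unfold levelX; fun_prop

lemma continuous_levelY (s : ℝ) : Continuous fun p : ℝ × ℝ => levelY s p.1 p.2 := by
  unfold levelY; fun_prop

lemma continuousAt_halfPeriod_level {s : ℝ} (hX : 0 < levelX s g h) (hY : 0 < levelY s g h) :
    ContinuousAt (fun p : ℝ × ℝ => halfPeriod (levelX s p.1 p.2) (levelY s p.1 p.2)) (g, h) := by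
  have hopen : IsOpen {p : ℝ × ℝ | 0 < p.1 ∧ 0 < p.2} :=
    IsOpen.and (isOpen_lt continuous_const continuous_fst)
      (isOpen_lt continuous_const continuous_snd)
  have h1 := continuousOn_halfPeriod.continuousAt
    (x := (levelX s g h, levelY s g h)) (hopen.mem_nhds ⟨hX, hY⟩)
  exact h1.comp (f := fun p : ℝ × ℝ => (levelX s p.1 p.2, levelY s p.1 p.2)) (x := (g, h))
    ((continuous_levelX s).prodMk (continuous_levelY s)).continuousAt

lemma continuousAt_halfNu (hr : IsRegularLevel a g h) :
    ContinuousAt (fun p : ℝ × ℝ => halfNu a p.1 p.2) (g, h) :=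
  continuousAt_halfPeriod_level hr.2.2 hr.levelY_pos

lemma continuousAt_halfLam (ha : a ^ 2 < 1) (hr : IsRegularLevel a g h) :
    ContinuousAt (fun p : ℝ × ℝ => halfLam p.1 p.2) (g, h) :=
  continuousAt_halfPeriod_level (hr.levelX_one_pos ha) (hr.levelY_one_pos ha)

lemma continuousAt_ratio (ha : a ^ 2 < 1) (hr : IsRegularLevel a g h) :
    ContinuousAt (fun p : ℝ × ℝ => ratio a p.1 p.2) (g, h) :=
  (continuousAt_halfNu hr).div (continuousAt_halfLam ha hr) (halfLam_pos ha hr).ne'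

lemma eventually_isRegularLevel (hr : IsRegularLevel a g h) :
    ∀ᶠ p : ℝ × ℝ in 𝓝 (g, h), IsRegularLevel a p.1 p.2 := by
  have h1 : IsOpen {p : ℝ × ℝ | IsRegularLevel a p.1 p.2} := by
    refine IsOpen.and (isOpen_lt continuous_const continuous_snd)
      (IsOpen.and (isOpen_lt continuous_const (by fun_prop)) ?_)
    exact isOpen_lt continuous_const (continuous_levelX _)
  exact h1.mem_nhds hr

lemma exists_ratio_eq (ha : a ^ 2 < 1) {g₁ g₂ r : ℝ} (hr : IsRegularLevel a g₁ h) (h12 : g₁ ≤ g₂)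
    (h1 : r < ratio a g₁ h) (h2 : ratio a g₂ h < r) : ∃ g ∈ Ioo g₁ g₂, ratio a g h = r := by
  have hcont : ContinuousOn (fun g => ratio a g h) (Icc g₁ g₂) := fun g hg => by
    have := continuousAt_ratio ha (hr.mono hg.1)
    exact (this.comp (f := fun g : ℝ => (g, h)) (by fun_prop)).continuousWithinAt
  exact intermediate_value_Ioo' h12 hcont ⟨h2, h1⟩

end monotone

/-! ### The ratio on the collision lines and near the separatrix -/

/-- The half period on the levels of the two boundary lines, up to scaling. -/
noncomputable def scaledHalf (x : ℝ) : ℝ := halfPeriod (1 + x) (2 * x)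

lemma scaledHalf_pos {x : ℝ} (hx : 0 < x) : 0 < scaledHalf x :=
  halfPeriod_pos (by linarith) (by linarith)

lemma scaledHalf_lt {x y : ℝ} (hx : 0 < x) (hxy : x < y) : scaledHalf y < scaledHalf x :=
  halfPeriod_lt (by linarith) (by linarith) (by linarith) (by linarith)

lemma scaledHalf_le {x y : ℝ} (hx : 0 < x) (hxy : x ≤ y) : scaledHalf y ≤ scaledHalf x := by
  rcases hxy.eq_or_lt with rfl | h
  · exact le_rfl
  · exact (scaledHalf_lt hx h).le

lemma continuousOn_scaledHalf : ContinuousOn scaledHalf (Ioi 0) :=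
  continuousOn_halfPeriod.comp (f := fun x : ℝ => (1 + x, 2 * x)) (by fun_prop) fun x hx => by
    have : (0 : ℝ) < x := hx
    exact ⟨by simp only; linarith, by simp only; linarith⟩

lemma exists_scaledHalf_eq_of_lt {r : ℝ} (hr : 0 < r) (hr1 : r < scaledHalf 1) :
    ∃ x, 1 < x ∧ scaledHalf x = r := by
  obtain ⟨M, hM1, hM⟩ : ∃ M, 1 < M ∧ scaledHalf M < r := by
    have hpi := Real.pi_pos
    -- Chosen so that 2M > (π/r)², which makes the bound π/√(2M) smaller than r.
    refine ⟨2 * (Real.pi / r) ^ 2 + 2, by nlinarith [sq_nonneg (Real.pi / r)], ?_⟩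
    have hm : 0 < 2 * (Real.pi / r) ^ 2 + 2 := by positivity
    refine (halfPeriod_le hm (by linarith) (by linarith)).trans_lt ?_
    rw [div_lt_iff₀ (by positivity), ← div_lt_iff₀' hr, Real.lt_sqrt (by positivity)]
    nlinarith [sq_nonneg (Real.pi / r)]
  have hcont : ContinuousOn scaledHalf (Icc 1 M) :=
    continuousOn_scaledHalf.mono fun x hx => zero_lt_one.trans_le hx.1
  obtain ⟨x, hx, hx'⟩ := intermediate_value_Ioo' hM1.le hcont ⟨hM, hr1⟩
  exact ⟨x, hx.1, hx'⟩

lemma exists_scaledHalf_eq_of_gt {r : ℝ} (hr1 : scaledHalf 1 < r) :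
    ∃ x, 0 < x ∧ x < 1 ∧ scaledHalf x = r := by
  -- The arguments are exchanged because the blow-up lemma wants the vanishing parameter first.
  have hlim : Tendsto (fun x : ℝ => halfPeriod (2 * x) (1 + x)) (𝓝[>] 0) atTop := by
    have hpos : ∀ᶠ x : ℝ in 𝓝[>] 0, 0 < x := eventually_mem_nhdsWithin
    refine tendsto_halfPeriod_atTop (M := 2) ?_ ?_ ?_ ?_
    · have : Tendsto (fun x : ℝ => 2 * x) (𝓝 0) (𝓝 (2 * 0)) := by
        apply Continuous.tendsto; fun_prop
      rw [mul_zero] at this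
      exact this.mono_left nhdsWithin_le_nhds
    · filter_upwards [hpos] with x hx; linarith
    · filter_upwards [hpos] with x hx; linarith
    · filter_upwards [nhdsWithin_le_nhds (Iio_mem_nhds (zero_lt_one (α := ℝ)))] with x hx
      have : x < 1 := hx
      linarith
  obtain ⟨m, ⟨h1, hm0⟩, hm1⟩ := ((hlim.eventually_gt_atTop r).and
    (eventually_mem_nhdsWithin.and
      (nhdsWithin_le_nhds (Iio_mem_nhds (zero_lt_one (α := ℝ)))))).exists.imp
    fun x hx => (⟨⟨hx.1, hx.2.1⟩, hx.2.2⟩ : (_ ∧ _) ∧ _)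
  rw [halfPeriod_comm] at h1
  have hm0' : 0 < m := hm0
  have hm1' : m < 1 := hm1
  have hcont : ContinuousOn scaledHalf (Icc m 1) :=
    continuousOn_scaledHalf.mono fun x hx => hm0'.trans_le hx.1
  obtain ⟨x, hx, hx'⟩ := intermediate_value_Ioo' hm1'.le hcont ⟨hr1, h1⟩
  exact ⟨x, hm0'.trans hx.1, hx.2, hx'⟩

lemma halfPeriod_level_eq {s g h : ℝ} (hB : 0 < g + h) :
    halfPeriod (levelX s g h) (levelY s g h) =
      scaledHalf (2 * √(g * h + s) / (g + h)) / √(g + h) := by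
  rw [scaledHalf, ← halfPeriod_mul hB]
  congr 1
  · unfold levelX; field_simp
  · unfold levelY; field_simp; ring

lemma ratio_eq_of_pos {a g h : ℝ} (hB : 0 < g + h) : ratio a g h =
    scaledHalf (2 * √(g * h + a ^ 2) / (g + h)) / scaledHalf (2 * √(g * h + 1) / (g + h)) := by
  rw [ratio, halfNu, halfLam, halfPeriod_level_eq hB, halfPeriod_level_eq hB]
  rw [div_div_div_cancel_right₀ (Real.sqrt_pos.2 hB).ne']

section boundary

variable {a h : ℝ}

lemma isRegularLevel_exterior (h0 : 0 < h) (hha : 0 < h + a) :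
    IsRegularLevel a (h + 2 * a) h := by
  refine ⟨h0, ?_, ?_⟩
  · rw [show (h + 2 * a) * h + a ^ 2 = (h + a) ^ 2 by ring]; positivity
  · unfold levelX
    have := Real.sqrt_nonneg ((h + 2 * a) * h + a ^ 2)
    linarith

/-- Here gh + a² = (h + a)², so X = Y for the ν-motion and its half period is elementary. The
remaining argument has square 1 + (1 - a²)/(h + a)², decreasing in h. -/
lemma ratio_exterior (hha : 0 < h + a) : ratio a (h + 2 * a) h =
    scaledHalf 1 / scaledHalf (√((h + 2 * a) * h + 1) / (h + a)) := by
  rw [ratio_eq_of_pos (by linarith), show (h + 2 * a) * h + a ^ 2 = (h + a) ^ 2 by ring,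
    Real.sqrt_sq hha.le, show h + 2 * a + h = 2 * (h + a) by ring,
    mul_div_mul_left _ _ two_ne_zero, mul_div_mul_left _ _ two_ne_zero, div_self hha.ne']

lemma isRegularLevel_interior (ha : a ^ 2 < 1) (h1 : 1 + √(1 - a ^ 2) < h) :
    IsRegularLevel a (h - 2) h := by
  have hs := Real.sqrt_nonneg (1 - a ^ 2)
  have hsq := Real.sq_sqrt (sub_pos.2 ha).le
  refine ⟨by linarith, ?_, ?_⟩
  · nlinarith
  · unfold levelX
    have := Real.sqrt_nonneg ((h - 2) * h + a ^ 2)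
    linarith

/-- Here gh + 1 = (h - 1)², so X = Y for the λ-motion. The remaining argument has square 1 - (1 -
a²)/(h - 1)², increasing in h. -/
lemma ratio_interior (h1 : 1 < h) : ratio a (h - 2) h =
    scaledHalf (√((h - 2) * h + a ^ 2) / (h - 1)) / scaledHalf 1 := by
  have h1' : 0 < h - 1 := by linarith
  rw [ratio_eq_of_pos (by linarith), show (h - 2) * h + 1 = (h - 1) ^ 2 by ring,
    Real.sqrt_sq h1'.le, show h - 2 + h = 2 * (h - 1) by ring,
    mul_div_mul_left _ _ two_ne_zero, mul_div_mul_left _ _ two_ne_zero, div_self h1'.ne']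

/-- On the interior collision line the ratio exceeds `r` exactly before a certain energy. -/
lemma exists_interior_threshold (ha : a ^ 2 < 1) {r : ℝ} (hr : 1 < r) :
    ∃ hb, 1 + √(1 - a ^ 2) < hb ∧ ratio a (hb - 2) hb = r ∧
      (∀ h, 1 + √(1 - a ^ 2) < h → h < hb → r < ratio a (h - 2) h) ∧
      ∀ h, hb ≤ h → ratio a (h - 2) h ≤ r := by
  have hj := scaledHalf_pos one_pos
  obtain ⟨x, hx0, hx1, hx⟩ := exists_scaledHalf_eq_of_gt (r := r * scaledHalf 1)
    (lt_mul_of_one_lt_left hj hr)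
  have hx2 : 0 < 1 - x ^ 2 := by nlinarith
  have ha' : 0 < 1 - a ^ 2 := sub_pos.2 ha
  -- The solution of x² = 1 - (1 - a²)/η², where η stands for h - 1.
  set η := √((1 - a ^ 2) / (1 - x ^ 2)) with hη
  have hη2 : η ^ 2 * (1 - x ^ 2) = 1 - a ^ 2 := by
    rw [hη, Real.sq_sqrt (by positivity)]; field_simp
  have hη1 : √(1 - a ^ 2) < η := by
    refine Real.sqrt_lt_sqrt ha'.le ?_
    rw [lt_div_iff₀ hx2]
    nlinarith [mul_pos ha' (pow_pos hx0 2)]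
  have hs0 := Real.sqrt_pos.2 ha'
  have hη0 : 0 < η := hs0.trans hη1
  have hcmp : ∀ h, 1 < h → (h < 1 + η → √((h - 2) * h + a ^ 2) / (h - 1) < x) ∧
      (1 + η ≤ h → x ≤ √((h - 2) * h + a ^ 2) / (h - 1)) := by
    intro h h1
    have h1' : 0 < h - 1 := by linarith
    constructor
    · intro hlt
      rw [div_lt_iff₀ h1', Real.sqrt_lt' (by positivity), mul_pow]
      nlinarith [mul_pos (sub_pos.2 hlt) (by linarith : 0 < η + (h - 1))]
    · intro hle
      rw [le_div_iff₀ h1']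
      refine Real.le_sqrt_of_sq_le ?_
      rw [mul_pow]
      nlinarith [mul_nonneg (sub_nonneg.2 hle) (by linarith : 0 ≤ η + (h - 1))]
  have hr0 : r = scaledHalf x / scaledHalf 1 := by rw [hx]; field_simp
  refine ⟨1 + η, by linarith, ?_, ?_, ?_⟩
  · rw [ratio_interior (by linarith)]
    have : √((1 + η - 2) * (1 + η) + a ^ 2) / (1 + η - 1) = x := by
      rw [show (1 + η - 2) * (1 + η) + a ^ 2 = (x * η) ^ 2 by linear_combination hη2,
        Real.sqrt_sq (by positivity)]
      rw [add_sub_cancel_left, mul_div_cancel_right₀ _ hη0.ne']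
    rw [this, hr0]
  · intro h h1 h2
    have hh1 : 1 < h := by linarith
    rw [ratio_interior hh1, hr0]
    refine div_lt_div_of_pos_right (scaledHalf_lt ?_ ((hcmp h hh1).1 h2)) hj
    exact div_pos (Real.sqrt_pos.2 (isRegularLevel_interior ha h1).2.1) (by linarith)
  · intro h h2
    have hh1 : 1 < h := by linarith
    rw [ratio_interior hh1, hr0]
    exact div_le_div_of_nonneg_right (scaledHalf_le hx0 ((hcmp h hh1).2 h2)) hj.le

/-- On the exterior collision line the ratio falls below `r` exactly from a certain energy on. -/
lemma exists_exterior_threshold (ha : a ^ 2 < 1) {r : ℝ} (hr : 1 < r) :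
    ∃ η, 0 < η ∧ (0 < η - a → ratio a (η - a + 2 * a) (η - a) = r) ∧
      (∀ h, 0 < h + a → η < h + a → ratio a (h + 2 * a) h < r) ∧
      ∀ h, 0 < h + a → h + a ≤ η → r ≤ ratio a (h + 2 * a) h := by
  have hj := scaledHalf_pos one_pos
  have hr' : 0 < r := by linarith
  obtain ⟨x, hx1, hx⟩ := exists_scaledHalf_eq_of_lt (r := scaledHalf 1 / r) (by positivity)
    (div_lt_self hj hr)
  have hx0 : 0 < x := by linarith
  have hx2 : 0 < x ^ 2 - 1 := by nlinarith
  have ha' : 0 < 1 - a ^ 2 := sub_pos.2 ha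
  -- The solution of x² = 1 + (1 - a²)/η², where η stands for h + a.
  set η := √((1 - a ^ 2) / (x ^ 2 - 1)) with hη
  have hη2 : η ^ 2 * (x ^ 2 - 1) = 1 - a ^ 2 := by
    rw [hη, Real.sq_sqrt (by positivity)]; field_simp
  have hη0 : 0 < η := Real.sqrt_pos.2 (by positivity)
  have hr0 : r = scaledHalf 1 / scaledHalf x := by rw [hx]; field_simp
  have hjx := scaledHalf_pos hx0
  have hpos : ∀ h, 0 < h + a → 0 < √((h + 2 * a) * h + 1) / (h + a) := by
    intro h hh
    refine div_pos (Real.sqrt_pos.2 ?_) hh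
    nlinarith [sq_nonneg (h + a)]
  refine ⟨η, hη0, ?_, ?_, ?_⟩
  · intro _
    rw [ratio_exterior (by linarith)]
    have : √((η - a + 2 * a) * (η - a) + 1) / (η - a + a) = x := by
      rw [show (η - a + 2 * a) * (η - a) + 1 = (x * η) ^ 2 by linear_combination -hη2,
        Real.sqrt_sq (by positivity), sub_add_cancel]
      field_simp
    rw [this, hr0]
  · intro h hh hlt
    rw [ratio_exterior hh, hr0]
    refine div_lt_div_of_pos_left hj hjx (scaledHalf_lt (hpos h hh) ?_)
    rw [div_lt_iff₀ hh, Real.sqrt_lt' (by positivity), mul_pow]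
    nlinarith [mul_pos (mul_pos (sub_pos.2 hlt) (by linarith : 0 < η + (h + a))) hx2]
  · intro h hh hle
    rw [ratio_exterior hh, hr0]
    refine div_le_div_of_nonneg_left hj.le (scaledHalf_pos (hpos h hh)) (scaledHalf_le hx0 ?_)
    rw [le_div_iff₀ hh]
    refine Real.le_sqrt_of_sq_le ?_
    rw [mul_pow]
    nlinarith [mul_nonneg (mul_nonneg (sub_nonneg.2 hle) (by linarith : 0 ≤ η + (h + a))) hx2.le]

/-- At energies above the critical one the ratio is unbounded near the lower end of the levels. -/
lemma exists_ratio_gt (ha : a ^ 2 < 1) (h0 : 0 < h) (hha : 0 < h + a)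
    (h1 : h ≤ 1 + √(1 - a ^ 2)) (r : ℝ) :
    ∃ g, IsRegularLevel a g h ∧ h - 2 ≤ g ∧ g ≤ h + 2 * a ∧ r < ratio a g h := by
  have ha1 := abs_lt.1 ((sq_lt_one_iff_abs_lt_one a).1 ha)
  obtain ⟨g₀, hg2, hga, hreg, hp, hX, hlim⟩ : ∃ g₀, h - 2 ≤ g₀ ∧ g₀ < h + 2 * a ∧
      (∀ g, g₀ < g → IsRegularLevel a g h) ∧ 0 ≤ g₀ * h + a ^ 2 ∧ 0 ≤ levelX (a ^ 2) g₀ h ∧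
      Tendsto (fun g => halfNu a g h) (𝓝[>] g₀) atTop := by
    have limX : ∀ g₀, Tendsto (fun g => levelX (a ^ 2) g h) (𝓝[>] g₀)
        (𝓝 (levelX (a ^ 2) g₀ h)) := fun g₀ => by
      have : Continuous fun g => levelX (a ^ 2) g h := by unfold levelX; fun_prop
      exact this.continuousWithinAt
    have limY : ∀ g₀, Tendsto (fun g => levelY (a ^ 2) g h) (𝓝[>] g₀)
        (𝓝 (levelY (a ^ 2) g₀ h)) := fun g₀ => by
      have : Continuous fun g => levelY (a ^ 2) g h := by unfold levelY; fun_prop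
      exact this.continuousWithinAt
    -- If a ≤ h, the ν-potential has its maximum at cos φ = -a/h, and Y tends to 0 as g decreases to
    -- -a²/h. Otherwise the maximum is at φ = π, and X tends to 0 as g decreases to h - 2a.
    rcases le_or_gt a h with hah | hah
    · have hp0 : -a ^ 2 / h * h + a ^ 2 = 0 := by field_simp; ring
      have hB : 0 ≤ -a ^ 2 / h + h := by
        have : -a ^ 2 / h + h = (h - a) * (h + a) / h := by field_simp; ring
        rw [this]
        exact div_nonneg (mul_nonneg (by linarith) hha.le) h0.le
      have hreg : ∀ g, -a ^ 2 / h < g → IsRegularLevel a g h := fun g hg => by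
        have h2 : 0 < g * h + a ^ 2 := by
          have := mul_lt_mul_of_pos_right hg h0
          linarith
        refine ⟨h0, h2, ?_⟩
        unfold levelX
        linarith [Real.sqrt_pos.2 h2]
      have hY0 : levelY (a ^ 2) (-a ^ 2 / h) h = 0 := by simp [levelY, hp0]
      refine ⟨-a ^ 2 / h, ?_, ?_, hreg, hp0.ge, ?_, ?_⟩
      · rw [le_div_iff₀ h0]
        -- The claim is h² - 2h + a² ≤ 0. For h ≤ 1 it follows from |a| ≤ h, for h ≥ 1 from (h - 1)²
        -- ≤ 1 - a².
        rcases le_total h 1 with h3 | h3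
        · nlinarith
        · have hsq := Real.sq_sqrt (sub_pos.2 ha).le
          have := Real.sqrt_nonneg (1 - a ^ 2)
          nlinarith
      · rw [div_lt_iff₀ h0]
        nlinarith
      · unfold levelX
        rw [hp0]; simpa using hB
      · unfold halfNu
        simp only [halfPeriod_comm (levelX _ _ _)]
        refine tendsto_halfPeriod_atTop (M := levelX (a ^ 2) (-a ^ 2 / h) h + 1)
          (by have := limY (-a ^ 2 / h); rwa [hY0] at this) ?_ ?_ ?_
        · filter_upwards [self_mem_nhdsWithin] with g hg using (hreg g hg).levelY_pos
        · filter_upwards [self_mem_nhdsWithin] with g hg using (hreg g hg).2.2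
        · exact ((limX _).eventually_lt_const (lt_add_one _)).mono fun g hg => hg.le
    · have hp0 : (h - 2 * a) * h + a ^ 2 = (a - h) ^ 2 := by ring
      have hX0 : levelX (a ^ 2) (h - 2 * a) h = 0 := by
        rw [levelX, hp0, Real.sqrt_sq (by linarith)]; ring
      have hreg : ∀ g, h - 2 * a < g → IsRegularLevel a g h := fun g hg => by
        have h2 : (a - h) ^ 2 < g * h + a ^ 2 := by
          have := mul_lt_mul_of_pos_right hg h0
          linarith
        refine ⟨h0, (sq_nonneg _).trans_lt h2, ?_⟩
        have := Real.lt_sqrt_of_sq_lt h2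
        unfold levelX
        linarith
      refine ⟨h - 2 * a, by linarith, by linarith, hreg, by rw [hp0]; positivity, hX0.ge, ?_⟩
      unfold halfNu
      refine tendsto_halfPeriod_atTop (M := levelY (a ^ 2) (h - 2 * a) h + 1)
          (by have := limX (h - 2 * a); rwa [hX0] at this) ?_ ?_ ?_
      · filter_upwards [self_mem_nhdsWithin] with g hg using (hreg g hg).2.2
      · filter_upwards [self_mem_nhdsWithin] with g hg using (hreg g hg).levelY_pos
      · exact ((limY _).eventually_lt_const (lt_add_one _)).mono fun g hg => hg.le
  -- The λ-parameters stay positive at g₀ since 1 > a²; so the λ-period has a finite limit there and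
  -- only the ν-period blows up.
  have hp1 : 0 < g₀ * h + 1 := by linarith
  have hX1 : 0 < levelX 1 g₀ h := by
    refine hX.trans_lt ?_
    have := Real.sqrt_lt_sqrt hp (show g₀ * h + a ^ 2 < g₀ * h + 1 by linarith)
    unfold levelX
    linarith
  have hc : Tendsto (fun g => halfLam g h) (𝓝[>] g₀) (𝓝 (halfLam g₀ h)) := by
    have := continuousAt_halfPeriod_level hX1 (levelY_pos hp1)
    exact (this.comp (f := fun g : ℝ => (g, h)) (by fun_prop)).continuousWithinAt
  have hpos : 0 < halfLam g₀ h := halfPeriod_pos hX1 (levelY_pos hp1)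
  have hrat : Tendsto (fun g => ratio a g h) (𝓝[>] g₀) atTop := by
    simp only [ratio, div_eq_mul_inv]
    exact hlim.atTop_mul_pos (inv_pos.2 hpos) (hc.inv₀ hpos.ne')
  obtain ⟨g, h3, h4, h5⟩ := ((hrat.eventually_gt_atTop r).and (eventually_mem_nhdsWithin.and
    (nhdsWithin_le_nhds (Iio_mem_nhds hga)))).exists
  have h4' : g₀ < g := h4
  have h5' : g < h + 2 * a := h5
  exact ⟨g, hreg g h4', by linarith, h5'.le, h3⟩

/-- The satellite levels with a given period ratio `r > 1` lie over an interval of energies. -/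
lemma exists_energy_interval (ha : a ^ 2 < 1) {r : ℝ} (hr : 1 < r) :
    ∃ hd hb, 0 ≤ hd ∧ hd < hb ∧ 1 + √(1 - a ^ 2) < hb ∧ ratio a (hb - 2) hb = r ∧
      (0 < hd → 0 < hd + a ∧ ratio a (hd + 2 * a) hd = r) ∧ (a ≤ 0 → 0 < hd) ∧
      (∀ g h, IsRegularLevel a g h → h - 2 < g → g < h + 2 * a → ratio a g h = r →
        hd < h ∧ h < hb) ∧
      ∀ h, hd < h → h < hb → ∃ g, IsRegularLevel a g h ∧ h - 2 < g ∧ g < h + 2 * a ∧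
        ratio a g h = r := by
  have ha1 := abs_lt.1 ((sq_lt_one_iff_abs_lt_one a).1 ha)
  obtain ⟨hb, hb1, hb2, hb3, hb4⟩ := exists_interior_threshold ha hr
  obtain ⟨η, hη0, hη1, hη2, hη3⟩ := exists_exterior_threshold ha hr
  have hs := Real.sqrt_nonneg (1 - a ^ 2)
  -- The value 0 occurs when the exterior threshold is not at negative energy; the family then
  -- persists up to c = 0.
  refine ⟨max 0 (η - a), hb, le_max_left _ _, max_lt (by linarith) ?_, hb1, hb2, ?_, ?_, ?_, ?_⟩
  -- At h = hb the ratio is r at the interior end, hence below r at the exterior end, so hb lies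
  -- beyond the exterior threshold.
  · have h1 := ratio_lt_ratio ha (isRegularLevel_interior ha hb1)
      (show hb - 2 < hb + 2 * a by linarith)
    rw [hb2] at h1
    by_contra hcon
    push Not at hcon
    exact absurd h1 (not_lt.2 (hη3 hb (by linarith) (by linarith)))
  · intro hpos
    have h1 : max 0 (η - a) = η - a := by
      rcases max_choice 0 (η - a) with h | h
      · rw [h] at hpos; exact absurd hpos (lt_irrefl _)
      · exact h
    rw [h1] at hpos ⊢
    exact ⟨by linarith, hη1 hpos⟩
  · intro ha0
    exact lt_max_of_lt_right (by linarith)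
  · intro g h hreg h1 h2 h3
    have hha : 0 < h + a := (Real.sqrt_nonneg _).trans_lt (hreg.sqrt_lt h2).1
    refine ⟨max_lt hreg.1 ?_, ?_⟩
    · by_contra hcon
      push Not at hcon
      have h4 := ratio_lt_ratio ha hreg h2
      have h5 := hη3 h hha (by linarith)
      linarith
    · by_contra hcon
      push Not at hcon
      have h4 := ratio_lt_ratio ha (isRegularLevel_interior ha (by linarith)) h1
      have h5 := hb4 h hcon
      linarith
  · intro h h1 h2
    have h0 : 0 < h := (le_max_left _ _).trans_lt h1
    have hη : η < h + a := by linarith [(le_max_right 0 (η - a)).trans_lt h1]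
    have hha : 0 < h + a := hη0.trans hη
    have hext := hη2 h hha hη
    obtain ⟨g₁, hreg, h3, h4, h5⟩ : ∃ g, IsRegularLevel a g h ∧ h - 2 ≤ g ∧ g ≤ h + 2 * a ∧
        r < ratio a g h := by
      -- A level with ratio above r is found near the separatrix, or on the interior line below the
      -- threshold hb.
      rcases le_or_gt h (1 + √(1 - a ^ 2)) with hh | hh
      · exact exists_ratio_gt ha h0 hha hh r
      · exact ⟨h - 2, isRegularLevel_interior ha hh, le_rfl, by linarith, hb3 h hh h2⟩
    obtain ⟨g, hg, hgr⟩ := exists_ratio_eq ha hreg h4 h5 hext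
    exact ⟨g, hreg.mono hg.1.le, by linarith [hg.1], hg.2, hgr⟩

end boundary

/-! ### Continuity of the level curve -/

/-- The torus over `(g, -h)` is a regular torus of satellite motions with period ratio `r`. -/
def IsTorusOfRatio (a r g h : ℝ) : Prop :=
  IsRegularLevel a g h ∧ h - 2 < g ∧ g < h + 2 * a ∧ ratio a g h = r

/-- `f h` is the level of the torus with period ratio `r` at the energy `-h`. -/
def IsLevelCurve (a r : ℝ) (I : Set ℝ) (f : ℝ → ℝ) : Prop :=
  ∀ h ∈ I, IsTorusOfRatio a r (f h) h

section curve

variable {a r g₀ h₀ : ℝ} {I : Set ℝ} {f : ℝ → ℝ}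

lemma eq_of_ratio_eq {g g' h : ℝ} (ha : a ^ 2 < 1) (hr : IsRegularLevel a g h)
    (hr' : IsRegularLevel a g' h) (heq : ratio a g h = ratio a g' h) : g = g' := by
  rcases lt_trichotomy g g' with h1 | h1 | h1
  · exact absurd heq (ratio_lt_ratio ha hr h1).ne'
  · exact h1
  · exact absurd heq (ratio_lt_ratio ha hr' h1).ne

lemma eventually_level {P : ℝ × ℝ → Prop} (h : ∀ᶠ p in 𝓝 (g₀, h₀), P p) :
    (∀ᶠ g in 𝓝 g₀, P (g, h₀)) ∧ ∀ᶠ y in 𝓝 h₀, P (g₀, y) :=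
  ⟨(Continuous.prodMk_left h₀).continuousAt.eventually h,
    (Continuous.prodMk_right g₀).continuousAt.eventually h⟩

/-- The level curve is continuous up to any regular level with the same period ratio. -/
lemma IsLevelCurve.tendsto (ha : a ^ 2 < 1) (hf : IsLevelCurve a r I f)
    (hr : IsRegularLevel a g₀ h₀) (hrat : ratio a g₀ h₀ = r) :
    Tendsto f (𝓝[I] h₀) (𝓝 g₀) := by
  have hcont : ∀ g, IsRegularLevel a g h₀ → ContinuousAt (fun h => ratio a g h) h₀ := fun g hg =>
    (continuousAt_ratio ha hg).comp (f := fun h : ℝ => (g, h)) (by fun_prop)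
  refine tendsto_order.2 ⟨fun b hb => ?_, fun b hb => ?_⟩
  · have e1 : ∀ᶠ g in 𝓝[<] g₀, IsRegularLevel a g h₀ :=
      nhdsWithin_le_nhds (eventually_level (eventually_isRegularLevel hr)).1
    have e2 : ∀ᶠ g in 𝓝[<] g₀, g ∈ Ioo b g₀ := Ioo_mem_nhdsLT hb
    obtain ⟨b', hb'r, hb'⟩ := (e1.and e2).exists
    have h1 : r < ratio a b' h₀ := hrat ▸ ratio_lt_ratio ha hb'r hb'.2
    filter_upwards [self_mem_nhdsWithin, nhdsWithin_le_nhds ((hcont b' hb'r).eventually_const_lt h1)]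
      with h hI h2
    obtain ⟨hreg, -, -, h3⟩ := hf h hI
    by_contra hcon
    push Not at hcon
    have := ratio_lt_ratio ha hreg (hcon.trans_lt hb'.1)
    linarith
  · have hreg' := hr.mono hb.le
    have h1 : ratio a b h₀ < r := hrat ▸ ratio_lt_ratio ha hr hb
    filter_upwards [self_mem_nhdsWithin, nhdsWithin_le_nhds ((hcont b hreg').eventually_lt_const h1),
      nhdsWithin_le_nhds (eventually_level (eventually_isRegularLevel hreg')).2] with h hI h2 h4
    obtain ⟨hreg, -, -, h3⟩ := hf h hI
    by_contra hcon
    push Not at hcon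
    rcases hcon.eq_or_lt with h5 | h5
    · rw [h5] at h2; linarith
    · have := ratio_lt_ratio ha h4 h5
      linarith

end curve

/-! ### Uniform convergence to the collision orbits -/

lemma eventually_forall_dist_lt {α β E : Type*} [TopologicalSpace α] [TopologicalSpace β]
    [PseudoMetricSpace E] {Ψ : α × β → E} {p₀ : α} {K : Set β} (hK : IsCompact K)
    (hΨ : ∀ θ ∈ K, ContinuousAt Ψ (p₀, θ)) {ε : ℝ} (hε : 0 < ε) :
    ∀ᶠ p in 𝓝 p₀, ∀ θ ∈ K, dist (Ψ (p, θ)) (Ψ (p₀, θ)) < ε := by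
  refine hK.eventually_forall_of_forall_eventually fun θ hθ => ?_
  have h1 := hΨ θ hθ
  have h2 : ContinuousAt (fun z : α × β => Ψ (p₀, z.2)) (p₀, θ) :=
    ContinuousAt.comp (g := Ψ) (f := fun z : α × β => (p₀, z.2)) h1 (by fun_prop)
  have h3 := h1.dist h2
  have h4 : dist (Ψ (p₀, θ)) (Ψ (p₀, θ)) < ε := by rwa [dist_self]
  exact h3.eventually_lt_const h4

lemma continuous_oscVel : Continuous fun q : (ℝ × ℝ × ℝ) × ℝ => oscVel q.1.1 q.1.2.1 q.1.2.2 q.2 := by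
  unfold oscVel angForm; fun_prop

lemma continuous_osc : Continuous fun q : (ℝ × ℝ × ℝ) × ℝ => osc q.1.1 q.2 := by
  unfold osc; fun_prop

lemma continuousAt_lamCurve {q₀ : (ℝ × ℝ × ℝ) × ℝ} (h0 : 0 ≤ q₀.1.1) (h1 : q₀.1.1 < 1) :
    ContinuousAt (fun q : (ℝ × ℝ × ℝ) × ℝ => lamCurve q.1.1 q.1.2.1 q.1.2.2 q.2) q₀ := by
  obtain ⟨h2, h3⟩ := abs_osc_lt_one h0 h1 q₀.2
  have c := continuous_osc.continuousAt (x := q₀)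
  have v := continuous_oscVel.continuousAt (x := q₀)
  unfold lamCurve
  refine ContinuousAt.prodMk (ContinuousAt.sub ?_ ?_) (v.div ?_ ?_)
  · exact (continuousAt_const.add c).log (show 1 + osc q₀.1.1 q₀.2 ≠ 0 by linarith)
  · exact (continuousAt_const.sub c).log (show 1 - osc q₀.1.1 q₀.2 ≠ 0 by linarith)
  · exact continuousAt_const.mul (continuousAt_const.sub (c.pow 2))
  · exact mul_ne_zero two_ne_zero (by nlinarith)

lemma continuous_nuCurve :
    Continuous fun q : (ℝ × ℝ × ℝ) × ℝ => nuCurve q.1.1 q.1.2.1 q.1.2.2 q.2 := by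
  unfold nuCurve
  refine Continuous.prodMk (continuous_const.mul (Real.continuous_arctan.comp continuous_osc))
    (continuous_oscVel.div (continuous_const.mul (continuous_const.add (continuous_osc.pow 2)))
      fun q => ?_)
  positivity

lemma continuousAt_level_angle {s g h θ : ℝ} (hX : 0 < levelX s g h) (hY : 0 < levelY s g h)
    (m : ℝ) : ContinuousAt (fun z : (ℝ × ℝ) × ℝ =>
      angle (levelX s z.1.1 z.1.2) (levelY s z.1.1 z.1.2)
        (m * halfPeriod (levelX s z.1.1 z.1.2) (levelY s z.1.1 z.1.2) * z.2)) ((g, h), θ) := by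
  have hopen : IsOpen {p : (ℝ × ℝ) × ℝ | 0 < p.1.1 ∧ 0 < p.1.2} :=
    IsOpen.and (isOpen_lt continuous_const (by fun_prop)) (isOpen_lt continuous_const (by fun_prop))
  have h1 := continuousOn_angle.continuousAt (x := ((levelX s g h, levelY s g h),
    m * halfPeriod (levelX s g h) (levelY s g h) * θ)) (hopen.mem_nhds ⟨hX, hY⟩)
  have hH : ContinuousAt (fun z : (ℝ × ℝ) × ℝ =>
      halfPeriod (levelX s z.1.1 z.1.2) (levelY s z.1.1 z.1.2)) ((g, h), θ) :=
    (continuousAt_halfPeriod_level hX hY).comp (f := fun z : (ℝ × ℝ) × ℝ => z.1) (x := ((g, h), θ))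
      continuousAt_fst
  have hXY : ContinuousAt (fun z : (ℝ × ℝ) × ℝ =>
      (levelX s z.1.1 z.1.2, levelY s z.1.1 z.1.2)) ((g, h), θ) :=
    (((continuous_levelX s).comp continuous_fst).prodMk
      ((continuous_levelY s).comp continuous_fst)).continuousAt
  exact h1.comp (f := fun z : (ℝ × ℝ) × ℝ => ((levelX s z.1.1 z.1.2, levelY s z.1.1 z.1.2),
    m * halfPeriod (levelX s z.1.1 z.1.2) (levelY s z.1.1 z.1.2) * z.2)) (x := ((g, h), θ))
    (hXY.prodMk ((continuousAt_const.mul hH).mul continuousAt_snd))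

/-- The `lam`-curve on the level `(g, -h)`. -/
noncomputable def levelLamCurve (g h θ : ℝ) : ℝ × ℝ :=
  lamCurve (ampLam g h) (levelX 1 g h) (levelY 1 g h) θ

/-- The `ν`-curve on the level `(g, -h)`, relative to the center. -/
noncomputable def levelNuCurve (a g h θ : ℝ) : ℝ × ℝ :=
  nuCurve (ampNu a g h) (levelX (a ^ 2) g h) (levelY (a ^ 2) g h) θ

/-- The angle on the level `(g, -h)`. -/
noncomputable def levelAngle (s g h t : ℝ) : ℝ := angle (levelX s g h) (levelY s g h) t

section uniform

variable {a g h ε : ℝ}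

lemma continuousAt_levelLamCurve (ha : a ^ 2 < 1) (hr : IsRegularLevel a g h) (θ : ℝ) :
    ContinuousAt (fun z : (ℝ × ℝ) × ℝ => levelLamCurve z.1.1 z.1.2 z.2) ((g, h), θ) := by
  have hX : Continuous fun z : (ℝ × ℝ) × ℝ => levelX 1 z.1.1 z.1.2 :=
    (continuous_levelX 1).comp continuous_fst
  have hY : Continuous fun z : (ℝ × ℝ) × ℝ => levelY 1 z.1.1 z.1.2 :=
    (continuous_levelY 1).comp continuous_fst
  have hκ : ContinuousAt (fun z : (ℝ × ℝ) × ℝ => ampLam z.1.1 z.1.2) ((g, h), θ) := by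
    unfold ampLam
    exact (ContinuousAt.div (a := ((g, h), θ)) (by fun_prop) hX.continuousAt
      (hr.levelX_one_pos ha).ne').sqrt
  exact (continuousAt_lamCurve (q₀ := ((ampLam g h, levelX 1 g h, levelY 1 g h), θ))
    (Real.sqrt_nonneg _) (ampLam_lt_one hr ha)).comp (x := ((g, h), θ))
    (f := fun z : (ℝ × ℝ) × ℝ =>
      ((ampLam z.1.1 z.1.2, levelX 1 z.1.1 z.1.2, levelY 1 z.1.1 z.1.2), z.2))
    ((hκ.prodMk (hX.continuousAt.prodMk hY.continuousAt)).prodMk continuousAt_snd)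

lemma continuousAt_levelNuCurve (hr : IsRegularLevel a g h) (θ : ℝ) :
    ContinuousAt (fun z : (ℝ × ℝ) × ℝ => levelNuCurve a z.1.1 z.1.2 z.2) ((g, h), θ) := by
  have hX : Continuous fun z : (ℝ × ℝ) × ℝ => levelX (a ^ 2) z.1.1 z.1.2 :=
    (continuous_levelX (a ^ 2)).comp continuous_fst
  have hY : Continuous fun z : (ℝ × ℝ) × ℝ => levelY (a ^ 2) z.1.1 z.1.2 :=
    (continuous_levelY (a ^ 2)).comp continuous_fst
  have hκ : ContinuousAt (fun z : (ℝ × ℝ) × ℝ => ampNu a z.1.1 z.1.2) ((g, h), θ) := by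
    unfold ampNu
    exact (ContinuousAt.div (a := ((g, h), θ)) (by fun_prop) hX.continuousAt hr.2.2.ne').sqrt
  exact (continuous_nuCurve.continuousAt).comp (x := ((g, h), θ))
    (f := fun z : (ℝ × ℝ) × ℝ =>
      ((ampNu a z.1.1 z.1.2, levelX (a ^ 2) z.1.1 z.1.2, levelY (a ^ 2) z.1.1 z.1.2), z.2))
    ((hκ.prodMk (hX.continuousAt.prodMk hY.continuousAt)).prodMk continuousAt_snd)

lemma eventually_dist_comp_lt {E : Type*} [PseudoMetricSpace E] (Φ : ℝ → ℝ → ℝ → E)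
    (A : ℝ → ℝ → ℝ → ℝ) (hε : 0 < ε)
    (hΦ : ∀ θ, ContinuousAt (fun z : (ℝ × ℝ) × ℝ => Φ z.1.1 z.1.2 z.2) ((g, h), θ))
    (hA : ∀ θ, ContinuousAt (fun z : (ℝ × ℝ) × ℝ => A z.1.1 z.1.2 z.2) ((g, h), θ)) :
    ∀ᶠ p in 𝓝 (g, h), ∀ θ ∈ Icc (0 : ℝ) 1,
      dist (Φ p.1 p.2 (A p.1 p.2 θ)) (Φ g h (A g h θ)) < ε :=
  eventually_forall_dist_lt (Ψ := fun z : (ℝ × ℝ) × ℝ => Φ z.1.1 z.1.2 (A z.1.1 z.1.2 z.2))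
    (p₀ := (g, h)) isCompact_Icc (fun θ _ =>
      ContinuousAt.comp (g := fun z : (ℝ × ℝ) × ℝ => Φ z.1.1 z.1.2 z.2)
        (f := fun z : (ℝ × ℝ) × ℝ => (z.1, A z.1.1 z.1.2 z.2)) (x := ((g, h), θ))
        (hΦ (A g h θ)) (continuousAt_fst.prodMk (hA θ))) hε

lemma continuousAt_levelAngle_halfLam (ha : a ^ 2 < 1) (hr : IsRegularLevel a g h) (m θ : ℝ) :
    ContinuousAt (fun z : (ℝ × ℝ) × ℝ =>
      levelAngle 1 z.1.1 z.1.2 (m * halfLam z.1.1 z.1.2 * z.2)) ((g, h), θ) := by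
  unfold levelAngle halfLam
  exact continuousAt_level_angle (hr.levelX_one_pos ha) (hr.levelY_one_pos ha) m

lemma continuousAt_levelAngle_halfNu (hr : IsRegularLevel a g h) (m θ : ℝ) :
    ContinuousAt (fun z : (ℝ × ℝ) × ℝ =>
      levelAngle (a ^ 2) z.1.1 z.1.2 (m * halfNu a z.1.1 z.1.2 * z.2)) ((g, h), θ) := by
  unfold levelAngle halfNu
  exact continuousAt_level_angle hr.2.2 hr.levelY_pos m

lemma eventually_dist_levelLamCurve_angle (ha : a ^ 2 < 1) (hr : IsRegularLevel a g h)
    (hε : 0 < ε) (m : ℝ) : ∀ᶠ p in 𝓝 (g, h), ∀ θ ∈ Icc (0 : ℝ) 1,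
      dist (levelLamCurve p.1 p.2 (levelAngle 1 p.1 p.2 (m * halfLam p.1 p.2 * θ)))
        (levelLamCurve g h (levelAngle 1 g h (m * halfLam g h * θ))) < ε :=
  eventually_dist_comp_lt levelLamCurve
    (fun g h θ => levelAngle 1 g h (m * halfLam g h * θ)) hε
    (continuousAt_levelLamCurve ha hr) (continuousAt_levelAngle_halfLam ha hr m)

lemma eventually_dist_levelNuCurve_angle (hr : IsRegularLevel a g h)
    (hε : 0 < ε) (m : ℝ) : ∀ᶠ p in 𝓝 (g, h), ∀ θ ∈ Icc (0 : ℝ) 1,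
      dist (levelNuCurve a p.1 p.2 (levelAngle (a ^ 2) p.1 p.2 (m * halfNu a p.1 p.2 * θ)))
        (levelNuCurve a g h (levelAngle (a ^ 2) g h (m * halfNu a g h * θ))) < ε :=
  eventually_dist_comp_lt (levelNuCurve a)
    (fun g h θ => levelAngle (a ^ 2) g h (m * halfNu a g h * θ)) hε
    (continuousAt_levelNuCurve hr) (continuousAt_levelAngle_halfNu hr m)

lemma levelLamCurve_eq_zero (h1 : g = h - 2) (θ : ℝ) : levelLamCurve g h θ = 0 := by
  have : ampLam g h = 0 := by simp [ampLam, h1]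
  rw [levelLamCurve, this, lamCurve_zero]

lemma levelNuCurve_eq_zero (h2 : g = h + 2 * a) (θ : ℝ) : levelNuCurve a g h θ = 0 := by
  have : ampNu a g h = 0 := by simp [ampNu, h2]
  rw [levelNuCurve, this, nuCurve_zero]

/-- The limit curve is a point, so closeness is uniform in two unrelated angles. This makes the
convergence independent of the phase of the dying oscillation. -/
lemma eventually_dist_levelLamCurve (ha : a ^ 2 < 1) (hr : IsRegularLevel a g h)
    (h1 : g = h - 2) (hε : 0 < ε) :
    ∀ᶠ p in 𝓝 (g, h), ∀ θ θ', dist (levelLamCurve p.1 p.2 θ) (levelLamCurve g h θ') < ε := by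
  filter_upwards [eventually_forall_dist_lt (Ψ := fun z : (ℝ × ℝ) × ℝ =>
    levelLamCurve z.1.1 z.1.2 z.2) (isCompact_Icc (a := 0) (b := 2 * Real.pi))
    (fun θ _ => continuousAt_levelLamCurve ha hr θ) hε] with p hp θ θ'
  have hper : Function.Periodic (levelLamCurve p.1 p.2) (2 * Real.pi) := fun θ => by
    have := lamCurve_add_int_mul_pi (ampLam p.1 p.2) (levelX 1 p.1 p.2) (levelY 1 p.1 p.2) θ 2
    simpa [levelLamCurve] using this
  obtain ⟨φ, hφ, e⟩ := hper.exists_mem_Ico₀ Real.two_pi_pos θ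
  have := hp φ (Ico_subset_Icc_self hφ)
  rw [levelLamCurve_eq_zero h1] at this ⊢
  rwa [e]

lemma eventually_dist_levelNuCurve (hr : IsRegularLevel a g h)
    (h2 : g = h + 2 * a) (hε : 0 < ε) :
    ∀ᶠ p in 𝓝 (g, h), ∀ θ θ', dist (levelNuCurve a p.1 p.2 θ) (levelNuCurve a g h θ') < ε := by
  filter_upwards [eventually_forall_dist_lt (Ψ := fun z : (ℝ × ℝ) × ℝ =>
    levelNuCurve a z.1.1 z.1.2 z.2) (isCompact_Icc (a := 0) (b := 2 * Real.pi))
    (fun θ _ => continuousAt_levelNuCurve hr θ) hε] with p hp θ θ'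
  have hper : Function.Periodic (levelNuCurve a p.1 p.2) (2 * Real.pi) := fun θ => by
    have := nuCurve_add_int_mul_pi (ampNu a p.1 p.2) (levelX (a ^ 2) p.1 p.2)
      (levelY (a ^ 2) p.1 p.2) θ 2
    simpa [levelNuCurve] using this
  obtain ⟨φ, hφ, e⟩ := hper.exists_mem_Ico₀ Real.two_pi_pos θ
  have := hp φ (Ico_subset_Icc_self hφ)
  rw [levelNuCurve_eq_zero h2] at this ⊢
  rwa [e]

end uniform

lemma levelOrbit_eq (μ : ℝ) (e : Primary) (g h s₁ s₂ t : ℝ) : levelOrbit μ e g h s₁ s₂ t =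
    (levelLamCurve g h (levelAngle 1 g h (t + s₁)), (e.center, 0) +
      levelNuCurve (massDiff μ e) g h (levelAngle (massDiff μ e ^ 2) g h (t + s₂))) := rfl

section cover

variable {μ : ℝ} {e : Primary} {k l : ℕ} {g : ℝ → ℝ} {F : Filter ℝ} {g₀ h₀ : ℝ}

lemma convergesToCover_interior (ha : massDiff μ e ^ 2 < 1) (hk : 0 < k) (hl : 0 < l)
    (hkl : Nat.Coprime k l) (hr : IsRegularLevel (massDiff μ e) g₀ h₀) (h1 : g₀ = h₀ - 2)
    (h2 : g₀ < h₀ + 2 * massDiff μ e)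
    (hlim : Tendsto (fun c => (g c, -c)) F (𝓝 (g₀, h₀)))
    (hT : ∀ᶠ c in F, IsTorusOfRatio (massDiff μ e) (k / l) (g c) (-c)) :
    ConvergesToCover μ e g F (coverMult k l l) (levelOrbit μ e g₀ h₀ 0 0) := by
  refine ⟨_, isOrbitPeriod_interior hr h1 h2, fun ε hε => ?_⟩
  have hper : ∀ᶠ p in 𝓝 (g₀, h₀), |(coverMult k l l : ℝ) * halfNu (massDiff μ e) p.1 p.2 -
      coverMult k l l * halfNu (massDiff μ e) g₀ h₀| < ε := by
    have := (continuousAt_halfNu hr).const_mul (coverMult k l l : ℝ)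
    exact (Metric.tendsto_nhds.1 this ε hε)
  filter_upwards [hT, hlim.eventually hper,
    hlim.eventually (eventually_dist_levelLamCurve ha hr h1 hε),
    hlim.eventually (eventually_dist_levelNuCurve_angle hr hε (coverMult k l l))]
    with c ⟨hreg, hc1, hc2, hrat⟩ hc3 hc4 hc5 γ hγ
  replace hγ : IsOrbitOnLevel μ e (g c) (- -c) γ := by rwa [neg_neg]
  obtain ⟨s₁, s₂, rfl⟩ := hγ.exists_eq ha hreg hc1 hc2
  obtain ⟨hP, hPeq⟩ := isOrbitPeriod_levelOrbit (s₁ := s₁) (s₂ := s₂) ha hreg hc1 hc2 hk hl hkl hrat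
  rw [hPeq] at hP
  -- The shift cancels the phase of the surviving ν-oscillation; the phase of the λ-part does not
  -- matter.
  refine ⟨_, -s₂, hP, hc3, fun θ hθ => ?_⟩
  rw [levelOrbit_eq, levelOrbit_eq, Prod.dist_eq, max_lt_iff]
  refine ⟨hc4 _ _, ?_⟩
  simp only [dist_add_left]
  have := hc5 θ hθ
  rw [show -s₂ + coverMult k l l * halfNu (massDiff μ e) (g c) (-c) * θ + s₂ =
    coverMult k l l * halfNu (massDiff μ e) (g c) (-c) * θ by ring, add_zero]
  exact this

lemma convergesToCover_exterior (ha : massDiff μ e ^ 2 < 1) (hk : 0 < k) (hl : 0 < l)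
    (hkl : Nat.Coprime k l) (hr : IsRegularLevel (massDiff μ e) g₀ h₀) (h1 : h₀ - 2 < g₀)
    (h2 : g₀ = h₀ + 2 * massDiff μ e)
    (hlim : Tendsto (fun c => (g c, -c)) F (𝓝 (g₀, h₀)))
    (hT : ∀ᶠ c in F, IsTorusOfRatio (massDiff μ e) (k / l) (g c) (-c)) :
    ConvergesToCover μ e g F (coverMult k l k) (levelOrbit μ e g₀ h₀ 0 0) := by
  refine ⟨_, isOrbitPeriod_exterior ha hr h1 h2, fun ε hε => ?_⟩
  have hper : ∀ᶠ p in 𝓝 (g₀, h₀), |(coverMult k l k : ℝ) * halfLam p.1 p.2 -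
      coverMult k l k * halfLam g₀ h₀| < ε := by
    have := (continuousAt_halfLam ha hr).const_mul (coverMult k l k : ℝ)
    exact (Metric.tendsto_nhds.1 this ε hε)
  filter_upwards [hT, hlim.eventually hper,
    hlim.eventually (eventually_dist_levelNuCurve hr h2 hε),
    hlim.eventually (eventually_dist_levelLamCurve_angle ha hr hε (coverMult k l k))]
    with c ⟨hreg, hc1, hc2, hrat⟩ hc3 hc4 hc5 γ hγ
  replace hγ : IsOrbitOnLevel μ e (g c) (- -c) γ := by rwa [neg_neg]
  obtain ⟨s₁, s₂, rfl⟩ := hγ.exists_eq ha hreg hc1 hc2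
  have hP := (isOrbitPeriod_levelOrbit (s₁ := s₁) (s₂ := s₂) ha hreg hc1 hc2 hk hl hkl hrat).1
  refine ⟨_, -s₁, hP, hc3, fun θ hθ => ?_⟩
  rw [levelOrbit_eq, levelOrbit_eq, Prod.dist_eq, max_lt_iff]
  simp only [dist_add_left]
  refine ⟨?_, hc4 _ _⟩
  have := hc5 θ hθ
  rw [show -s₁ + coverMult k l k * halfLam (g c) (-c) * θ + s₁ =
    coverMult k l k * halfLam (g c) (-c) * θ by ring, add_zero]
  exact this

end cover

/-! ### Assembly, with h = -c -/

lemma critEnergy_eq (μ : ℝ) (e : Primary) :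
    critEnergy μ = -(1 + √(1 - massDiff μ e ^ 2)) := by
  have h : 1 - massDiff μ e ^ 2 = 2 ^ 2 * (μ * (1 - μ)) := by
    cases e <;> simp only [massDiff, Primary.mass] <;> ring
  rw [h, Real.sqrt_mul (by norm_num), Real.sqrt_sq zero_le_two, critEnergy]
  ring

end EulerProblem

theorem lemma3p3 (μ : ℝ) (hμ₀ : 0 < μ) (hμ₁ : μ < 1) (e : EulerProblem.Primary)
    (k l : ℕ) (hl : 0 < l) (hlk : l < k) (hkl : Nat.Coprime k l) :
    -- the family is a curve of tori, parametrized by the energy in an interval `(cb, cd)`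
    ∃ (cb cd : ℝ) (g : ℝ → ℝ),
      cb < EulerProblem.critEnergy μ ∧ cb < cd ∧ cd ≤ 0 ∧
      ContinuousOn g (Ioo cb cd) ∧
      (∀ G c : ℝ, EulerProblem.IsTklTorus μ e k l G c ↔ c ∈ Ioo cb cd ∧ G = g c) ∧
      -- bifurcation from the interior collision orbit
      (∃ ζ : ℝ → EulerProblem.Phase, EulerProblem.IsInteriorCollisionOrbit μ e cb ζ ∧
        EulerProblem.ConvergesToCover μ e g (𝓝[>] cb) (if Even (k + l) then l else 2 * l) ζ) ∧
      -- death at the exterior collision orbit, unless the family persists up to zero energy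
      (cd < 0 → ∃ ζ : ℝ → EulerProblem.Phase, EulerProblem.IsExteriorCollisionOrbit μ e cd ζ ∧
        EulerProblem.ConvergesToCover μ e g (𝓝[<] cd) (if Even (k + l) then k else 2 * k) ζ) ∧
      (e.mass μ ≤ 1 / 2 → cd < 0) := by
  open EulerProblem in
  have ha := massDiff_sq_lt_one hμ₀ hμ₁ e
  set a := massDiff μ e with ha_def
  have ha1 := abs_lt.1 ((sq_lt_one_iff_abs_lt_one a).1 ha)
  have hk : 0 < k := hl.trans hlk
  have hl' : (0 : ℝ) < l := by exact_mod_cast hl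
  have hr1 : (1 : ℝ) < k / l := by
    rw [one_lt_div hl']; exact_mod_cast hlk
  obtain ⟨hd, hb, hd0, hdb, hb1, hb2, hd1, hd2, honly, hex⟩ := exists_energy_interval ha hr1
  choose! f hf using hex
  have hT : ∀ h ∈ Ioo hd hb, IsTorusOfRatio a (k / l) (f h) h := fun h hh => hf h hh.1 hh.2
  have hcurve : IsLevelCurve a (k / l) (Ioo hd hb) f := hT
  have hneg : ∀ {c : ℝ}, c ∈ Ioo (-hb) (-hd) ↔ -c ∈ Ioo hd hb := fun {c} =>
    ⟨fun h => ⟨by linarith [h.2], by linarith [h.1]⟩, fun h => ⟨by linarith [h.2], by linarith [h.1]⟩⟩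
  have hmaps : ∀ {s : Set ℝ} {c₀ : ℝ}, s ⊆ Ioo (-hb) (-hd) →
      Tendsto (fun c : ℝ => -c) (𝓝[s] c₀) (𝓝[Ioo hd hb] (-c₀)) := fun {s c₀} hs =>
    tendsto_nhdsWithin_iff.2 ⟨(continuous_neg.tendsto c₀).mono_left nhdsWithin_le_nhds,
      eventually_of_mem self_mem_nhdsWithin fun c hc => hneg.1 (hs hc)⟩
  -- Stated for any filter near c₀, with c₀ possibly an end of the interval: there the limit lies on
  -- a collision line, which is still a regular level in the sense of `IsRegularLevel`.
  have hlim : ∀ {F : Filter ℝ} {c₀ g₀ : ℝ}, F ≤ 𝓝 c₀ → (∀ᶠ c in F, c ∈ Ioo (-hb) (-hd)) →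
      IsRegularLevel a g₀ (-c₀) → ratio a g₀ (-c₀) = k / l →
      Tendsto (fun c => (f (-c), -c)) F (𝓝 (g₀, -c₀)) := fun {F c₀ g₀} hF hI hr hrat => by
    have h1 : Tendsto (fun c : ℝ => -c) F (𝓝[Ioo hd hb] (-c₀)) :=
      tendsto_nhdsWithin_iff.2 ⟨(continuous_neg.tendsto c₀).mono_left hF,
        hI.mono fun c hc => hneg.1 hc⟩
    exact ((hcurve.tendsto ha hr hrat).comp h1).prodMk_nhds
      (h1.mono_right nhdsWithin_le_nhds)
  refine ⟨-hb, -hd, fun c => f (-c), ?_, by linarith, by linarith, ?_, ?_, ?_, ?_, ?_⟩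
  · rw [critEnergy_eq μ e]; linarith
  · intro c hc
    obtain ⟨hreg, -, -, hrat⟩ := hT _ (hneg.1 hc)
    exact (hcurve.tendsto ha hreg hrat).comp (hmaps subset_rfl)
  · intro G c
    have hiff := isTklTorus_iff (g := G) (h := -c) ha (k := k) (l := l)
    rw [neg_neg] at hiff
    rw [hiff, hneg]
    constructor
    · rintro ⟨⟨hreg, h1, h2⟩, hrat⟩
      have hI := honly G (-c) hreg h1 h2 hrat
      obtain ⟨hreg', -, -, hrat'⟩ := hT _ hI
      exact ⟨hI, eq_of_ratio_eq ha hreg hreg' (hrat.trans hrat'.symm)⟩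
    · rintro ⟨hI, rfl⟩
      obtain ⟨hreg, h1, h2, hrat⟩ := hT _ hI
      exact ⟨⟨hreg, h1, h2⟩, hrat⟩
  · have hreg := isRegularLevel_interior ha hb1
    refine ⟨levelOrbit μ e (hb - 2) hb 0 0,
      isInteriorCollisionOrbit_levelOrbit ha hreg rfl (by linarith), ?_⟩
    have hI : ∀ᶠ c in 𝓝[>] (-hb), c ∈ Ioo (-hb) (-hd) := Ioo_mem_nhdsGT (by linarith)
    have := hlim (c₀ := -hb) (g₀ := hb - 2) nhdsWithin_le_nhds hI
      (by rwa [neg_neg]) (by rwa [neg_neg])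
    rw [neg_neg] at this
    exact convergesToCover_interior ha hk hl hkl hreg rfl (by linarith) this
      (hI.mono fun c hc => hT _ (hneg.1 hc))
  · intro hcd
    obtain ⟨hda, hrat⟩ := hd1 (by linarith)
    have hreg := isRegularLevel_exterior (by linarith) hda
    refine ⟨levelOrbit μ e (hd + 2 * a) hd 0 0,
      isExteriorCollisionOrbit_levelOrbit ha hreg (by linarith) rfl, ?_⟩
    have hI : ∀ᶠ c in 𝓝[<] (-hd), c ∈ Ioo (-hb) (-hd) := Ioo_mem_nhdsLT (by linarith)
    have := hlim (c₀ := -hd) (g₀ := hd + 2 * a) nhdsWithin_le_nhds hI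
      (by rwa [neg_neg]) (by rwa [neg_neg])
    rw [neg_neg] at this
    exact convergesToCover_exterior ha hk hl hkl hreg (by linarith) rfl this
      (hI.mono fun c hc => hT _ (hneg.1 hc))
  · intro hm
    -- Mass at most 1/2 means a ≤ 0, which puts the exterior threshold η - a at a positive h.
    have := hd2 (by rw [ha_def, massDiff]; linarith)
    linarith
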